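/- Let $H$ be a real Hilbert space, $V\subset H$ an open neighbourhood of $0$, and $\mathcal L\in C^1(V,\mathbb R)$ with $\mathcal L'(0)=0$. Assume that $\nabla\mathcal L$ has at every $u\in V$ a Gâteaux derivative $B(u)$ which is a bounded self-adjoint operator, and that $B=P+Q$ on $V$, where each $P(x)$ is bounded, self-adjoint and positive definite, each $Q(x)$ is self-adjoint and compact, $Q$ is continuous at $0$ in operator norm, and for every sequence $x_k\to 0$ in $V$: $P(x_k)u\to P(0)u$ for all $u\in H$, and there are $C_0>0$, $k_0$ with $(P(x_k)u,u)\ge C_0\|u\|^2$ for all $u\in H$, $k\ge k_0$. Let $H=H^+\oplus H^0\oplus H^-$ be the orthogonal decomposition into the positive definite, null and negative definite spaces of $B(0)$, and suppose $H^0\neq\{0\}$. Let $\mathcal G_1,\dots,\mathcal G_n\in C^1(V,\mathbb R)$ with $\mathcal G_j'(0)=0$, such that $\nabla\mathcal G_j$ has a bounded self-adjoint Gâteaux derivative $\mathcal G_j''(u)$ at every $u\in V$ and $\mathcal G_j''$ is continuous at $0$ in operator norm. Put $\mathcal L_\lambda=\mathcal L+\sum_{j=1}^n\lambda_j\mathcal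 G_j$, let $P^\perp$ be the orthogonal projection onto $(H^0)^\perp$, let $B_E(0,t)$ be the open ball of radius $t$ in a subspace $E$, and let $\mathcal Q_{r,s}=B_{H^+}(0,r)+B_{H^-}(0,s)$. Then $H^0$ and $H^-$ are finite-dimensional, and there is $a>0$ with $(B(0)u,u)\ge a\|u\|^2$ on $H^+$ and $(B(0)u,u)\le -a\|u\|^2$ on $H^-$. Moreover there are arbitrarily small $\delta,\epsilon,r,s>0$ with $B_{H^0}(0,\epsilon)+\mathcal Q_{r,s}\subset V$ such that the following hold. 1. For all $(\lambda,z)\in[-\delta,\delta]^n\times B_{H^0}(0,\epsilon)$ there is exactly one $\psi(\lambda,z)\in\mathcal Q_{r,s}$ with $P^\perp\nabla\mathcal L(z+\psi(\lambda,z))+\sum_j\lambda_jP^\perp\nabla\mathcal G_j(z+\psi(\lambda,z))=0$. The map $\psi$ is continuous, $\psi(\lambda,0)=0$, and $\|\psi(\lambda,z_1)-\psi(\lambda,z_2)\|\le 3\|z_1-z_2\|$. 2. There are a relatively open set $\mathcal W\subset[-\delta,\delta]^n\times V$ that contains $[-\delta,\delta]^n\times W$ for some open neighbourhood $W$ of $0$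 in $H$, and a homeomorphism $$[-\delta,\delta]^n\times B_{H^0}(0,\epsilon)\times\mathcal Q_{r,s}\to\mathcal W,\qquad(\lambda,z,u)\mapsto(\lambda,\Phi_\lambda(z,u)),$$ with $\Phi_\lambda(0,0)=0$ and $$\mathcal L_\lambda(\Phi_\lambda(z,u^++u^-))=\|u^+\|^2-\|u^-\|^2+\mathcal L_\lambda(z+\psi(\lambda,z))$$ for all $\lambda\in[-\delta,\delta]^n$, $z\in B_{H^0}(0,\epsilon)$, $u^+\in B_{H^+}(0,r)$, $u^-\in B_{H^-}(0,s)$. Moreover $\Phi_\lambda(z,u)=z+\psi(\lambda,z)+\phi_{\lambda,z}(u)$ with $\phi_{\lambda,z}(u)\in H^+\oplus H^-$, $\phi_{\lambda,z}(0)=0$, and $\phi_{\lambda,z}(u^++u^-)\in H^-$ if and only if $u^+=0$. 3. For each $\lambda\in[-\delta,\delta]^n$ the functional $\mathcal L^\circ_\lambda(z)=\mathcal L_\lambda(z+\psi(\lambda,z))$ on $B_{H^0}(0,\epsilon)$ is $C^1$, with $D\mathcal L^\circ_\lambda(z)[h]=D\mathcal L(z+\psi(\lambda,z))[h]+\sum_j\lambda_jD\mathcal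 G_j(z+\psi(\lambda,z))[h]$ for all $h\in H^0$. If $\mathcal L$ and all $\mathcal G_j$ are of class $C^{2-0}$ ($C^1$ with locally Lipschitz derivative), so is $\mathcal L^\circ_\lambda$. 4. If a group $G$ (for instance a compact Lie group) acts on $H$ by linear isometries and $V$, $\mathcal L$, $\mathcal G_1,\dots,\mathcal G_n$ are $G$-invariant, then $H^0$ and $(H^0)^\perp$ are $G$-invariant, and for each $\lambda\in[-\delta,\delta]^n$ the maps $\psi(\lambda,\cdot)$ and $\Phi_\lambda$ are $G$-equivariant and $\mathcal L^\circ_\lambda$ is $G$-invariant. -/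

import Mathlib

open Set Filter Topology
open scoped RealInnerProductSpace

section SplittingDefinitions

variable {H : Type*} [NormedAddCommGroup H] [InnerProductSpace ℝ H]

/-- `A` is the Gâteaux derivative of the map `f` at `u`: `A` is a bounded linear operator whose value
`A h` is the (two-sided) directional derivative of `f` at `u` in every direction `h`. -/
def HasGateauxDerivAt (f : H → H) (A : H →L[ℝ] H) (u : H) : Prop :=
  ∀ h : H, HasLineDerivAt ℝ f (A h) u h

/-- The basic hypothesis on a `C¹` functional `L` defined on an open neighbourhood `V` of the origin
of `H`, relative to a dense linear subspace `X`: the gradient of `L` has a self-adjoint Gâteaux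
derivative `B = P + Q` on `V ∩ X`, with `P` positive definite and `Q` compact, subject to the
conditions (D1)-(D4). -/
structure SplittingHypothesis [CompleteSpace H] (X : Submodule ℝ H) (V : Set H) (L : H → ℝ)
    (B P Q : H → H →L[ℝ] H) : Prop where
  dense : Dense (X : Set H)
  isOpen : IsOpen V
  zero_mem : (0 : H) ∈ V
  contDiffOn : ContDiffOn ℝ 1 L V
  critical : fderiv ℝ L 0 = 0
  selfAdjoint_B : ∀ x ∈ V ∩ X, IsSelfAdjoint (B x)
  gateaux : ∀ x ∈ V ∩ X, HasGateauxDerivAt (gradient L) (B x) x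
  decomposition : ∀ x ∈ V ∩ X, B x = P x + Q x
  selfAdjoint_P : ∀ x ∈ V ∩ X, IsSelfAdjoint (P x)
  posDef_P : ∀ x ∈ V ∩ X, ∀ u : H, u ≠ 0 → 0 < ⟪P x u, u⟫
  selfAdjoint_Q : ∀ x ∈ V ∩ X, IsSelfAdjoint (Q x)
  compact_Q : ∀ x ∈ V ∩ X, IsCompactOperator (Q x)
  D1 : ∀ c : ℝ, c ≤ 0 → Module.End.eigenspace (B 0 : H →ₗ[ℝ] H) c ≤ X
  D2 : ∀ x : ℕ → H, (∀ k, x k ∈ V ∩ X) → Tendsto (fun k => ‖x k‖) atTop (𝓝 0) →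
    ∀ u : H, Tendsto (fun k => ‖P (x k) u - P 0 u‖) atTop (𝓝 0)
  D3 : ContinuousWithinAt Q (V ∩ X) 0
  D4 : ∀ x : ℕ → H, (∀ k, x k ∈ V ∩ X) → Tendsto (fun k => ‖x k‖) atTop (𝓝 0) →
    ∃ C > (0 : ℝ), ∃ k₀ : ℕ, ∀ u : H, ∀ k ≥ k₀, C * ‖u‖ ^ 2 ≤ ⟪P (x k) u, u⟫

/-- The hypothesis on a perturbing `C¹` functional `G` on `V`: the origin is a critical point, and
the gradient has a self-adjoint Gâteaux derivative `G₂ u` at every `u ∈ V`, with `G₂` continuous at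
the origin for the operator norm. -/
structure PerturbationHypothesis [CompleteSpace H] (V : Set H) (G : H → ℝ)
    (G₂ : H → H →L[ℝ] H) : Prop where
  contDiffOn : ContDiffOn ℝ 1 G V
  critical : fderiv ℝ G 0 = 0
  selfAdjoint : ∀ u ∈ V, IsSelfAdjoint (G₂ u)
  gateaux : ∀ u ∈ V, HasGateauxDerivAt (gradient G) (G₂ u) u
  continuous_at_zero : ContinuousWithinAt G₂ V 0

/-- `H⁰`: the null space of `A`. -/
abbrev nullSpace (A : H →L[ℝ] H) : Submodule ℝ H := (A : H →ₗ[ℝ] H).ker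

/-- `H⁻`: the negative definite space of `A`. Under the basic hypothesis the nonpositive part of the
spectrum of `A = B 0` consists of finitely many eigenvalues of finite multiplicity, so that the
negative spectral subspace is the sum of the eigenspaces of the negative eigenvalues. -/
noncomputable def negSpace (A : H →L[ℝ] H) : Submodule ℝ H :=
  ⨆ (c : ℝ) (_ : c < 0), Module.End.eigenspace (A : H →ₗ[ℝ] H) c

/-- `H⁺`: the positive definite space of `A`, the orthogonal complement of `H⁰ + H⁻`. -/
noncomputable def posSpace (A : H →L[ℝ] H) : Submodule ℝ H := (nullSpace A ⊔ negSpace A)ᗮ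

/-- `B_{H⁰}(0, ε)`, as a subset of `H`. -/
def nullBall (A : H →L[ℝ] H) (ε : ℝ) : Set H := {z | z ∈ nullSpace A ∧ ‖z‖ < ε}

/-- `B_{H⁺}(0, r) + B_{H⁻}(0, s)`, as a subset of `H`. -/
def saddleBox (A : H →L[ℝ] H) (r s : ℝ) : Set H :=
  {u | ∃ up ∈ posSpace A, ∃ um ∈ negSpace A, ‖up‖ < r ∧ ‖um‖ < s ∧ u = up + um}

/-- The cube `[-δ, δ]ⁿ`. -/
def paramCube (n : ℕ) (δ : ℝ) : Set (Fin n → ℝ) := Icc (fun _ => -δ) (fun _ => δ)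

/-- The perturbed functional `L + ∑ λⱼ Gⱼ`. -/
noncomputable def perturbed {n : ℕ} (L : H → ℝ) (G : Fin n → H → ℝ) (lam : Fin n → ℝ) (u : H) : ℝ :=
  L u + ∑ j, lam j * G j u

/-- The reduced functional `z ↦ L_λ (z + ψ (λ, z))` on `H⁰`. -/
noncomputable def reduced {n : ℕ} (A : H →L[ℝ] H) (L : H → ℝ) (G : Fin n → H → ℝ)
    (ψ : (Fin n → ℝ) → H → H) (lam : Fin n → ℝ) (z : nullSpace A) : ℝ :=
  perturbed L G lam ((z : H) + ψ lam (z : H))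

/-- Class `C^{2-0}` on an open set `U`: `C¹` with locally Lipschitz derivative. -/
def IsC2Minus {E : Type*} [NormedAddCommGroup E] [NormedSpace ℝ E] (f : E → ℝ) (U : Set E) : Prop :=
  ContDiffOn ℝ 1 f U ∧ LocallyLipschitzOn U (fderiv ℝ f)

end SplittingDefinitions

/-!
The theorem is a parametrized splitting (generalized Morse) lemma for functionals whose Hessian `B`
is continuous at the origin only in the strong operator topology.

*Uniform definiteness.* Write `B = P + Q`. Since `Q` is compact and continuous at `0`, while `P`
converges strongly and stays coercive along sequences tending to `0`, the form of `B x` for small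
`x` is a uniformly coercive form plus a nearly constant, weakly continuous one. This makes `H⁰` and
`H⁻` finite-dimensional and `B 0` definite on `H⁺` and `H⁻`, and it gives the same coercivity on
`H⁺` for `B x` with `x` near `0` (`SplittingHypothesis.eventually_form_posSpace`). On the
finite-dimensional spaces `H⁰` and `H⁻` strong convergence is already uniform. By the mean value
theorem along segments, the gradients `∇L_λ` are then Lipschitz near `0`, and strongly monotone on
`H⁺ ⊕ H⁻` after the sign of the `H⁻` component is reversed: this is the notion `IsSaddleFamily`,
and it is all that the rest uses.

*Reduction.* The equation `P^⊥ ∇L_λ (z + u) = 0` is a strongly monotone equation for `u`, up to the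
sign reversal, so that it has a unique solution `ψ (λ, z)`, which is continuous in `(λ, z)` and
Lipschitz in `z` (`IsSaddleFamily.exists_isReduction`). Although `ψ` need not be differentiable, the
reduced functional is `C¹`, because the gradient at `z + ψ (λ, z)` is orthogonal to all increments
of `ψ` (`IsReduction.hasFDerivAt`).

*Morse chart.* Centred at `z + ψ (λ, z)`, the functional restricted to `H⁺ ⊕ H⁻` is strongly convex
along `H⁺` and strongly concave along `H⁻`. For each `u⁺` it has a unique maximum over the fibre
`u⁺ + H⁻`, at a point `u⁺ + φ u⁺` of the *ridge*. The functional along the ridge, and its drop from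
the ridge along the fibre, are comparable with squared norms and strictly increasing along rays, so
`x ↦ (√(g x) / ‖x‖) • x` turns each of them into a squared norm, and it is a homeomorphism near `0`
jointly in all the parameters (`IsRadialFamily.exists_isRadialInverse`). Inverting these two radial
changes of variable yields the chart `morseMap`, and adding the point `z + ψ (λ, z)` yields `Φ`
(`IsMorseData.exists_homeomorph`).

*Equivariance.* Each ingredient is characterized by a uniqueness property that isometries leaving
the functionals invariant respect (`IsReduction.map_eq`, `IsMorseData.splittingMap_map`).
-/

/-! ### Weak limits along ultrafilters -/

section WeakLimits

variable {H : Type*} [NormedAddCommGroup H] [InnerProductSpace ℝ H] [CompleteSpace H] {X : Type*}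

/-- Weak compactness of the unit ball, for families along an ultrafilter. -/
theorem exists_weak_limit (𝒰 : Ultrafilter X) (u : X → H) (hu : ∀ x, ‖u x‖ ≤ 1) :
    ∃ u₀ : H, ∀ v, Tendsto (fun x => ⟪u x, v⟫) 𝒰 (𝓝 ⟪u₀, v⟫) := by
  have hc := WeakDual.isCompact_closedBall (𝕜 := ℝ) (E := H) 0 1
  let f : X → WeakDual ℝ H := fun x => StrongDual.toWeakDual (InnerProductSpace.toDual ℝ H (u x))
  have hf : ∀ x, f x ∈ WeakDual.toStrongDual ⁻¹' Metric.closedBall (0 : StrongDual ℝ H) 1 := by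
    intro x
    have : ‖InnerProductSpace.toDual ℝ H (u x)‖ ≤ 1 := by
      rw [LinearIsometryEquiv.norm_map]; exact hu x
    simpa [f] using this
  obtain ⟨y, -, hy⟩ := hc.ultrafilter_le_nhds (𝒰.map f)
    (by
      simp only [Ultrafilter.coe_map, le_principal_iff, mem_map]
      exact Filter.univ_mem' hf)
  refine ⟨(InnerProductSpace.toDual ℝ H).symm (WeakDual.toStrongDual y), fun v => ?_⟩
  rw [InnerProductSpace.toDual_symm_apply]
  have h1 : Tendsto f 𝒰 (𝓝 y) := hy
  exact ((WeakDual.eval_continuous v).tendsto y).comp h1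

omit [CompleteSpace H] in
theorem tendsto_inner_of_weak {l : Filter X} {u w : X → H} {u₀ w₀ : H} (hu : ∀ x, ‖u x‖ ≤ 1)
    (hw : Tendsto w l (𝓝 w₀)) (hweak : ∀ v, Tendsto (fun x => ⟪u x, v⟫) l (𝓝 ⟪u₀, v⟫)) :
    Tendsto (fun x => ⟪w x, u x⟫) l (𝓝 ⟪w₀, u₀⟫) := by
  have h1 : Tendsto (fun x => ⟪w x - w₀, u x⟫) l (𝓝 0) := by
    have h2 : Tendsto (fun x => ‖w x - w₀‖) l (𝓝 0) := tendsto_iff_norm_sub_tendsto_zero.1 hw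
    refine squeeze_zero_norm (fun x => ?_) h2
    calc ‖⟪w x - w₀, u x⟫‖ ≤ ‖w x - w₀‖ * ‖u x‖ := norm_inner_le_norm _ _
      _ ≤ ‖w x - w₀‖ := mul_le_of_le_one_right (norm_nonneg _) (hu x)
  have h3 := h1.add (hweak w₀)
  rw [zero_add] at h3
  rw [real_inner_comm]
  refine h3.congr fun x => ?_
  rw [inner_sub_left, real_inner_comm w₀ (u x)]; ring

theorem IsCompactOperator.tendsto_of_weak {𝒰 : Ultrafilter X} {Q : H →L[ℝ] H}
    (hQ : IsCompactOperator Q) {u : X → H} {u₀ : H} (hu : ∀ x, ‖u x‖ ≤ 1)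
    (hweak : ∀ v, Tendsto (fun x => ⟪u x, v⟫) 𝒰 (𝓝 ⟪u₀, v⟫)) :
    Tendsto (fun x => Q (u x)) 𝒰 (𝓝 (Q u₀)) := by
  have hc := hQ.isCompact_closure_image_closedBall 1
  obtain ⟨y, -, hy⟩ := hc.ultrafilter_le_nhds (𝒰.map (fun x => Q (u x)))
    (by
      simp only [Ultrafilter.coe_map, le_principal_iff, mem_map]
      exact Filter.univ_mem' fun x => subset_closure ⟨u x, by simpa using hu x, rfl⟩)
  have hy' : Tendsto (fun x => Q (u x)) 𝒰 (𝓝 y) := hy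
  have : y = Q u₀ := by
    refine ext_inner_right ℝ fun v => ?_
    refine tendsto_nhds_unique (hy'.inner tendsto_const_nhds) ?_
    have := hweak (ContinuousLinearMap.adjoint Q v)
    rw [ContinuousLinearMap.adjoint_inner_right] at this
    refine this.congr fun x => ?_
    rw [ContinuousLinearMap.adjoint_inner_right]
  rwa [this] at hy'

/-- Lower semicontinuity of the forms `⟪(P x + Q x) u, u⟫` on weakly convergent families of unit
vectors: the coercivity of `P x` controls the mass `1 - ‖u₀‖ ^ 2` lost in the weak limit `u₀`. -/
theorem form_weak_lower_bound {𝒰 : Ultrafilter X} {P Q : X → H →L[ℝ] H} {P₀ Q₀ : H →L[ℝ] H}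
    {C m : ℝ} {b : X → ℝ} {u : X → H} {u₀ : H}
    (hsymm : ∀ᶠ x in 𝒰, IsSelfAdjoint (P x))
    (hP : ∀ v, Tendsto (fun x => P x v) 𝒰 (𝓝 (P₀ v)))
    (hcoer : ∀ᶠ x in 𝒰, ∀ v, C * ‖v‖ ^ 2 ≤ ⟪P x v, v⟫)
    (hQ : Tendsto Q 𝒰 (𝓝 Q₀)) (hQ₀ : IsCompactOperator Q₀)
    (hu : ∀ x, ‖u x‖ = 1) (hweak : ∀ v, Tendsto (fun x => ⟪u x, v⟫) 𝒰 (𝓝 ⟪u₀, v⟫))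
    (hb : ∀ᶠ x in 𝒰, ⟪(P x + Q x) (u x), u x⟫ ≤ b x) (hbm : Tendsto b 𝒰 (𝓝 m)) :
    ⟪(P₀ + Q₀) u₀, u₀⟫ + C * (1 - ‖u₀‖ ^ 2) ≤ m ∧ ‖u₀‖ ≤ 1 := by
  have hu1 : ∀ x, ‖u x‖ ≤ 1 := fun x => (hu x).le
  constructor
  · have hPu : Tendsto (fun x => ⟪P x u₀, u x⟫) 𝒰 (𝓝 ⟪P₀ u₀, u₀⟫) :=
      tendsto_inner_of_weak hu1 (hP u₀) hweak
    have hPu' : Tendsto (fun x => ⟪P x u₀, u₀⟫) 𝒰 (𝓝 ⟪P₀ u₀, u₀⟫) :=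
      (hP u₀).inner tendsto_const_nhds
    have hQu : Tendsto (fun x => Q x (u x)) 𝒰 (𝓝 (Q₀ u₀)) := by
      have h1 : Tendsto (fun x => Q x (u x) - Q₀ (u x)) 𝒰 (𝓝 0) := by
        refine squeeze_zero_norm (fun x => ?_) (tendsto_iff_norm_sub_tendsto_zero.1 hQ)
        simpa [hu x] using (Q x - Q₀).le_opNorm (u x)
      have h2 := h1.add (hQ₀.tendsto_of_weak hu1 hweak)
      simpa using h2
    have hQu' : Tendsto (fun x => ⟪Q x (u x), u x⟫) 𝒰 (𝓝 ⟪Q₀ u₀, u₀⟫) :=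
      tendsto_inner_of_weak hu1 hQu hweak
    have hlim := (((hPu.const_mul 2).sub hPu').add
      ((((hweak u₀).const_mul 2).const_sub (1 + ‖u₀‖ ^ 2)).const_mul C)).add hQu'
    have hle := le_of_tendsto_of_tendsto hlim hbm (by
      filter_upwards [hsymm, hcoer, hb] with x h1 h2 h3
      have h4 := h2 (u x - u₀)
      have h5 : ⟪P x (u x), u₀⟫ = ⟪P x u₀, u x⟫ := by
        rw [h1.isSymmetric.apply_clm, real_inner_comm]
      have h6 : ‖u x - u₀‖ ^ 2 = 1 - 2 * ⟪u x, u₀⟫ + ‖u₀‖ ^ 2 := by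
        rw [norm_sub_sq_real, hu x]; ring
      rw [h6, map_sub, inner_sub_left, inner_sub_right, inner_sub_right, h5] at h4
      rw [add_apply, inner_add_left] at h3
      linarith)
    rw [add_apply, inner_add_left]
    rw [real_inner_self_eq_norm_sq] at hle
    linarith
  · have h1 : ⟪u₀, u₀⟫ ≤ ‖u₀‖ := le_of_tendsto (hweak u₀) (Eventually.of_forall fun x => by
      simpa [hu x] using real_inner_le_norm (u x) u₀)
    rw [real_inner_self_eq_norm_sq] at h1
    nlinarith [norm_nonneg u₀]

end WeakLimits

/-! ### The spectral decomposition of a compact perturbation of a coercive operator -/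

section Spectral

variable {H : Type*} [NormedAddCommGroup H] [InnerProductSpace ℝ H]

theorem finiteDimensional_of_form_nonpos {P Q : H →L[ℝ] H} {C : ℝ} (hC : 0 < C)
    (hP : ∀ u, C * ‖u‖ ^ 2 ≤ ⟪P u, u⟫) (hQ : IsCompactOperator Q) {K : Submodule ℝ H}
    (hK : ∀ u ∈ K, ⟪(P + Q) u, u⟫ ≤ 0) : FiniteDimensional ℝ K := by
  by_contra hfin
  obtain ⟨R, f, hR, hfR, hsep⟩ := exists_seq_norm_le_one_le_norm_sub (𝕜 := ℝ) (E := K) hfin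
  obtain ⟨y, -, φ, hφ, hlim⟩ := (hQ.isCompact_closure_image_closedBall R).tendsto_subseq
    (x := fun n => Q (f n)) (fun n => subset_closure ⟨f n, by simpa using hfR n, rfl⟩)
  obtain ⟨N, hN⟩ := Metric.cauchySeq_iff.1 hlim.cauchySeq (C / (2 * R)) (by positivity)
  have h1 := hN N le_rfl (N + 1) (by omega)
  have h2 := hsep (hφ (Nat.lt_succ_self N)).ne
  set d : K := f (φ N) - f (φ (N + 1)) with hd
  have h3 : ‖Q d‖ < C / (2 * R) := by
    simpa [dist_eq_norm, hd] using h1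
  have h4 : ‖(d : H)‖ ≤ 2 * R := by
    have h5 := norm_sub_le (f (φ N)) (f (φ (N + 1)))
    have h6 := hfR (φ N)
    have h7 := hfR (φ (N + 1))
    have h8 : ‖(d : H)‖ = ‖f (φ N) - f (φ (N + 1))‖ := rfl
    linarith
  have h5 : 1 ≤ ‖(d : H)‖ := h2
  have h6 := hK d d.2
  rw [add_apply, inner_add_left] at h6
  have h7 := hP d
  have h8 := abs_le.1 (abs_real_inner_le_norm (Q d) d)
  have h9 : ‖Q d‖ * ‖(d : H)‖ ≤ ‖Q d‖ * (2 * R) := by gcongr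
  have h10 : ‖Q d‖ * (2 * R) < C := (lt_div_iff₀ (by positivity)).1 h3
  nlinarith [sq_nonneg (‖(d : H)‖ - 1)]

theorem inner_eq_zero_of_mem_nullSpace_negSpace {A : H →L[ℝ] H} (hA : (A : H →ₗ[ℝ] H).IsSymmetric)
    {x y : H} (hx : x ∈ nullSpace A) (hy : y ∈ negSpace A) : ⟪x, y⟫ = 0 := by
  have hle : negSpace A ≤ (nullSpace A)ᗮ := by
    refine iSup₂_le fun c hc y hy => ?_
    rw [Submodule.mem_orthogonal]
    intro x hx
    have h1 : A x = 0 := hx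
    have h2 : A y = c • y := Module.End.mem_eigenspace_iff.1 hy
    have h3 : ⟪A x, y⟫ = ⟪x, A y⟫ := hA x y
    rw [h1, h2, inner_zero_left, inner_smul_right] at h3
    exact (mul_eq_zero.1 h3.symm).resolve_left hc.ne
  exact (Submodule.mem_orthogonal _ _).1 (hle hy) x hx

theorem form_neg_of_mem_negSpace {A : H →L[ℝ] H} (hA : (A : H →ₗ[ℝ] H).IsSymmetric) {v : H}
    (hv : v ∈ negSpace A) (hv0 : v ≠ 0) : ⟪A v, v⟫ < 0 := by
  rw [negSpace, ← iSup_subtype (p := fun c : ℝ => c < 0)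
    (f := fun c => Module.End.eigenspace (A : H →ₗ[ℝ] H) c.1)] at hv
  obtain ⟨f, hf, rfl⟩ := (Submodule.mem_iSup_iff_exists_finsupp _ _).1 hv
  have hOF := hA.orthogonalFamily_eigenspaces.comp
    (Subtype.val_injective (p := fun c : ℝ => c < 0))
  have h1 : A (f.sum fun _ x => x) = ∑ c ∈ f.support, (c : ℝ) • f c := by
    rw [Finsupp.sum, map_sum]
    exact Finset.sum_congr rfl fun c _ => Module.End.mem_eigenspace_iff.1 (hf c)
  have h2 := hOF.inner_sum (fun c => (c : ℝ) • (⟨f c, hf c⟩ : Module.End.eigenspace _ _))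
    (fun c => ⟨f c, hf c⟩) f.support
  have h3 : ⟪∑ c ∈ f.support, (c : ℝ) • f c, ∑ c ∈ f.support, f c⟫ =
      ∑ c ∈ f.support, (c : ℝ) * ‖f c‖ ^ 2 := by
    refine Eq.trans h2 (Finset.sum_congr rfl fun c _ => ?_)
    rw [real_inner_smul_left, real_inner_self_eq_norm_sq]
    rfl
  rw [h1, Finsupp.sum, h3]
  have hne : f.support.Nonempty := by
    rw [Finsupp.support_nonempty_iff]
    rintro rfl
    simp at hv0
  refine Finset.sum_neg (fun c hc => ?_) hne
  have : 0 < ‖f c‖ := norm_pos_iff.2 (Finsupp.mem_support_iff.1 hc)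
  exact mul_neg_of_neg_of_pos c.2 (by positivity)

theorem form_nonpos_of_mem_negSpace {A : H →L[ℝ] H} (hA : (A : H →ₗ[ℝ] H).IsSymmetric) {v : H}
    (hv : v ∈ negSpace A) : ⟪A v, v⟫ ≤ 0 := by
  rcases eq_or_ne v 0 with rfl | hv0
  · simp
  · exact (form_neg_of_mem_negSpace hA hv hv0).le

theorem exists_form_le_of_mem_negSpace {A : H →L[ℝ] H} (hA : (A : H →ₗ[ℝ] H).IsSymmetric)
    [FiniteDimensional ℝ (negSpace A)] :
    ∃ a > (0 : ℝ), ∀ u ∈ negSpace A, ⟪A u, u⟫ ≤ -a * ‖u‖ ^ 2 := by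
  have : ProperSpace (negSpace A) := FiniteDimensional.proper_real _
  rcases (Metric.sphere (0 : negSpace A) 1).eq_empty_or_nonempty with h | h
  · refine ⟨1, one_pos, fun u hu => ?_⟩
    have hu0 : u = 0 := by
      by_contra hu0
      have : (⟨‖u‖⁻¹ • u, Submodule.smul_mem _ _ hu⟩ : negSpace A) ∈
          Metric.sphere (0 : negSpace A) 1 := by
        simp [norm_smul, norm_ne_zero_iff.2 hu0]
      rw [h] at this
      exact this
    simp [hu0]
  · have hcont : Continuous fun u : negSpace A => ⟪A (u : H), (u : H)⟫ := by fun_prop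
    obtain ⟨x, hx, hmax⟩ := (isCompact_sphere (0 : negSpace A) 1).exists_isMaxOn h
      hcont.continuousOn
    have hx1 : ‖x‖ = 1 := by simpa using hx
    have hx0 : (x : H) ≠ 0 := by
      intro h0
      have : x = 0 := Subtype.ext h0
      simp [this] at hx1
    refine ⟨-⟪A (x : H), (x : H)⟫, neg_pos.2 (form_neg_of_mem_negSpace hA x.2 hx0), fun u hu => ?_⟩
    rcases eq_or_ne u 0 with rfl | hu0
    · simp
    have hn : ‖u‖ ≠ 0 := norm_ne_zero_iff.2 hu0
    have h1 := hmax (show (⟨‖u‖⁻¹ • u, Submodule.smul_mem _ _ hu⟩ : negSpace A) ∈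
      Metric.sphere (0 : negSpace A) 1 by simp [norm_smul, hn])
    simp only [mem_ofPred_eq, map_smul, real_inner_smul_left, real_inner_smul_right] at h1
    have h2 : ⟪A u, u⟫ = ‖u‖ ^ 2 * (‖u‖⁻¹ * (‖u‖⁻¹ * ⟪A u, u⟫)) := by field_simp
    rw [h2, neg_neg, mul_comm]
    gcongr

theorem map_mem_posSpace {A : H →L[ℝ] H} (hA : (A : H →ₗ[ℝ] H).IsSymmetric) {u : H}
    (hu : u ∈ posSpace A) : A u ∈ posSpace A := by
  have hinv : ∀ w ∈ nullSpace A ⊔ negSpace A, A w ∈ nullSpace A ⊔ negSpace A := by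
    have h1 : nullSpace A ⊔ negSpace A ≤
        (nullSpace A ⊔ negSpace A).comap (A : H →ₗ[ℝ] H) := by
      refine sup_le (fun w hw => ?_) (iSup₂_le fun c hc w hw => ?_)
      · have : A w = 0 := hw
        simp [this]
      · have h2 : A w = c • w := Module.End.mem_eigenspace_iff.1 hw
        rw [Submodule.mem_comap, ContinuousLinearMap.coe_coe, h2]
        exact Submodule.smul_mem _ _
          (Submodule.mem_sup_right (Submodule.mem_iSup_of_mem c (Submodule.mem_iSup_of_mem hc hw)))
    exact fun w hw => h1 hw
  rw [posSpace, Submodule.mem_orthogonal] at hu ⊢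
  intro w hw
  have h3 : ⟪A w, u⟫ = ⟪w, A u⟫ := hA w u
  rw [← h3]
  exact hu _ (hinv w hw)

theorem mem_posSpace_of_weak {A : H →L[ℝ] H} {X : Type*} {l : Filter X} [l.NeBot] {u : X → H}
    {u₀ : H} (hu : ∀ x, u x ∈ posSpace A)
    (hweak : ∀ v, Tendsto (fun x => ⟪u x, v⟫) l (𝓝 ⟪u₀, v⟫)) : u₀ ∈ posSpace A := by
  rw [posSpace, Submodule.mem_orthogonal']
  intro w hw
  refine tendsto_nhds_unique (hweak w) (tendsto_const_nhds.congr fun x => ?_)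
  exact ((Submodule.mem_orthogonal' _ _).1 (hu x) w hw).symm

/-- A minimiser of a symmetric form on the unit sphere of an invariant subspace is an
eigenvector. -/
theorem apply_eq_smul_of_form_minimal {A : H →L[ℝ] H} (hA : (A : H →ₗ[ℝ] H).IsSymmetric)
    {K : Submodule ℝ H} (hK : ∀ u ∈ K, A u ∈ K) {m : ℝ} (hm : ∀ u ∈ K, m * ‖u‖ ^ 2 ≤ ⟪A u, u⟫)
    {u₀ : H} (hu₀ : u₀ ∈ K) (hmin : ⟪A u₀, u₀⟫ ≤ m * ‖u₀‖ ^ 2) : A u₀ = m • u₀ := by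
  set w := A u₀ - m • u₀ with hw
  have hwK : w ∈ K := K.sub_mem (hK _ hu₀) (K.smul_mem _ hu₀)
  have hexp : ∀ t : ℝ, 0 ≤ 2 * t * ‖w‖ ^ 2 + t ^ 2 * (⟪A w, w⟫ - m * ‖w‖ ^ 2) := by
    intro t
    have h1 := hm (u₀ + t • w) (K.add_mem hu₀ (K.smul_mem _ hwK))
    have h2 : ⟪A w, u₀⟫ = ⟪A u₀, w⟫ := by
      have : ⟪A w, u₀⟫ = ⟪w, A u₀⟫ := hA w u₀
      rw [this, real_inner_comm]
    have h3 : ‖w‖ ^ 2 = ⟪A u₀, w⟫ - m * ⟪u₀, w⟫ := by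
      rw [← real_inner_self_eq_norm_sq]
      nth_rw 1 [hw]
      rw [inner_sub_left, real_inner_smul_left]
    rw [norm_add_sq_real, norm_smul, real_inner_smul_right, map_add, map_smul, inner_add_left,
      inner_add_right, inner_add_right, real_inner_smul_left, real_inner_smul_left,
      real_inner_smul_right, real_inner_smul_right, h2, mul_pow, Real.norm_eq_abs, sq_abs] at h1
    linear_combination h1 + hmin - (2 * t) * h3
  have hw0 : ‖w‖ ^ 2 = 0 := by
    set b := ⟪A w, w⟫ - m * ‖w‖ ^ 2 with hb
    have hb0 : 0 ≤ b := sub_nonneg.2 (hm w hwK)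
    by_contra hne
    have hpos : 0 < ‖w‖ ^ 2 := lt_of_le_of_ne (sq_nonneg _) (Ne.symm hne)
    -- the quadratic polynomial of `hexp` takes a negative value here
    have h1 := hexp (-(‖w‖ ^ 2 / (b + 1)))
    have h2 : 2 * (-(‖w‖ ^ 2 / (b + 1))) * ‖w‖ ^ 2 + (-(‖w‖ ^ 2 / (b + 1))) ^ 2 * b =
        -(‖w‖ ^ 2 / (b + 1)) ^ 2 * (b + 2) := by
      field_simp
      ring
    rw [h2] at h1
    have h3 : 0 < (‖w‖ ^ 2 / (b + 1)) ^ 2 * (b + 2) := by positivity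
    linarith
  exact sub_eq_zero.1 (norm_eq_zero.1 (pow_eq_zero_iff two_ne_zero |>.1 hw0))

/-- The form of a compact perturbation of a coercive operator is coercive on `posSpace`: below the
coercivity constant its infimum on the unit sphere is attained, hence an eigenvalue, and it is
positive because the eigenvectors of nonpositive eigenvalues are orthogonal to `posSpace`. -/
theorem exists_le_form_of_mem_posSpace [CompleteSpace H] {P Q : H →L[ℝ] H} {C : ℝ} (hC : 0 < C)
    (hPs : IsSelfAdjoint P) (hQs : IsSelfAdjoint Q)
    (hP : ∀ u, C * ‖u‖ ^ 2 ≤ ⟪P u, u⟫) (hQ : IsCompactOperator Q) :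
    ∃ a > (0 : ℝ), ∀ u ∈ posSpace (P + Q), a * ‖u‖ ^ 2 ≤ ⟪(P + Q) u, u⟫ := by
  have hA : ((P + Q : H →L[ℝ] H) : H →ₗ[ℝ] H).IsSymmetric := (hPs.add hQs).isSymmetric
  set A := P + Q with hAdef
  set K := posSpace A with hK
  set s : Set ℝ := {c | ∃ u ∈ K, ‖u‖ = 1 ∧ ⟪A u, u⟫ = c} with hs
  have hscale : ∀ m : ℝ, (∀ c ∈ s, m ≤ c) → ∀ u ∈ K, m * ‖u‖ ^ 2 ≤ ⟪A u, u⟫ := by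
    intro m hm u hu
    rcases eq_or_ne u 0 with rfl | hu0
    · simp
    have hn : ‖u‖ ≠ 0 := norm_ne_zero_iff.2 hu0
    have h1 := hm _ ⟨‖u‖⁻¹ • u, K.smul_mem _ hu, by simp [norm_smul, hn], rfl⟩
    simp only [map_smul, real_inner_smul_left, real_inner_smul_right] at h1
    have h2 : ⟪A u, u⟫ = (‖u‖⁻¹ * (‖u‖⁻¹ * ⟪A u, u⟫)) * ‖u‖ ^ 2 := by field_simp
    rw [h2]
    gcongr
  rcases s.eq_empty_or_nonempty with hempty | hne
  · exact ⟨1, one_pos, hscale 1 (by simp [hempty])⟩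
  have hbdd : BddBelow s := by
    refine ⟨-‖A‖, ?_⟩
    rintro c ⟨u, -, hu1, rfl⟩
    have h1 := abs_le.1 (abs_real_inner_le_norm (A u) u)
    have h2 := A.le_opNorm u
    rw [hu1, mul_one] at h1 h2
    linarith
  set m := sInf s with hm
  have hmle : ∀ c ∈ s, m ≤ c := fun c hc => csInf_le hbdd hc
  rcases le_or_gt C m with hCm | hmC
  · exact ⟨C, hC, hscale C fun c hc => hCm.trans (hmle c hc)⟩
  have hseq : ∀ k : ℕ, ∃ u ∈ K, ‖u‖ = 1 ∧ ⟪A u, u⟫ ≤ m + 1 / ((k : ℝ) + 1) := by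
    intro k
    obtain ⟨c, ⟨u, huK, hu1, rfl⟩, hc⟩ := exists_lt_of_csInf_lt hne
      (show sInf s < m + 1 / ((k : ℝ) + 1) by
        have : 0 < 1 / ((k : ℝ) + 1) := by positivity
        linarith)
    exact ⟨u, huK, hu1, hc.le⟩
  choose u huK hu1 hub using hseq
  obtain ⟨u₀, hweak⟩ := exists_weak_limit (hyperfilter ℕ) u fun k => (hu1 k).le
  have hlim : Tendsto (fun k : ℕ => m + 1 / ((k : ℝ) + 1)) (hyperfilter ℕ) (𝓝 m) := by
    have := (tendsto_one_div_add_atTop_nhds_zero_nat (𝕜 := ℝ)).const_add m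
    rw [add_zero] at this
    exact this.mono_left Nat.hyperfilter_le_atTop
  obtain ⟨hle, hu₀1⟩ := form_weak_lower_bound (P := fun _ : ℕ => P) (Q := fun _ => Q)
    (Eventually.of_forall fun _ => hPs) (fun v => tendsto_const_nhds)
    (Eventually.of_forall fun _ => hP) tendsto_const_nhds hQ hu1 hweak
    (Eventually.of_forall hub) hlim
  have hu₀K : u₀ ∈ K := mem_posSpace_of_weak huK hweak
  have h1 := hscale m hmle u₀ hu₀K
  have h2 : ‖u₀‖ ^ 2 = 1 := by
    have : ‖u₀‖ ^ 2 ≤ 1 := by nlinarith [norm_nonneg u₀]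
    nlinarith
  have h3 : A u₀ = m • u₀ := by
    refine apply_eq_smul_of_form_minimal hA (fun u hu => map_mem_posSpace hA hu)
      (hscale m hmle) hu₀K ?_
    rw [h2] at hle ⊢
    linarith
  have hm0 : 0 < m := by
    by_contra hm0
    have h4 : u₀ ∈ nullSpace A ⊔ negSpace A := by
      rcases (not_lt.1 hm0).eq_or_lt with h | h
      · refine Submodule.mem_sup_left ?_
        rw [h, zero_smul] at h3
        exact h3
      · exact Submodule.mem_sup_right (Submodule.mem_iSup_of_mem m (Submodule.mem_iSup_of_mem h
          (Module.End.mem_eigenspace_iff.2 h3)))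
    have h5 := (Submodule.mem_orthogonal _ _).1 hu₀K u₀ h4
    rw [real_inner_self_eq_norm_sq, h2] at h5
    exact one_ne_zero h5
  exact ⟨m, hm0, hscale m hmle⟩

end Spectral

/-! ### Zeros of strongly monotone maps -/

section StronglyMonotone

variable {H : Type*} [NormedAddCommGroup H] [InnerProductSpace ℝ H]

/-- `u ↦ u - (a / M ^ 2) • T u` is a contraction of the closed ball of radius `ρ` of `K`. -/
theorem exists_zero_of_strongly_monotone [CompleteSpace H] {K : Submodule ℝ H}
    (hK : IsClosed (K : Set H))
    {T : H → H} {ρ a M : ℝ} (hρ : 0 ≤ ρ) (ha : 0 < a) (haM : a ≤ M)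
    (hTK : ∀ u ∈ K, ‖u‖ ≤ ρ → T u ∈ K)
    (hlip : ∀ u ∈ K, ∀ v ∈ K, ‖u‖ ≤ ρ → ‖v‖ ≤ ρ → ‖T u - T v‖ ≤ M * ‖u - v‖)
    (hmono : ∀ u ∈ K, ∀ v ∈ K, ‖u‖ ≤ ρ → ‖v‖ ≤ ρ → a * ‖u - v‖ ^ 2 ≤ ⟪T u - T v, u - v⟫)
    (h0 : ‖T 0‖ ≤ a * ρ / 2) : ∃ u ∈ K, ‖u‖ ≤ ρ ∧ T u = 0 := by
  have hM : 0 < M := ha.trans_le haM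
  set τ := a / M ^ 2 with hτ
  have hτ0 : 0 < τ := by positivity
  set κ := 1 - a ^ 2 / (2 * M ^ 2) with hκ
  have hq : a ^ 2 / M ^ 2 ≤ 1 := by
    rw [div_le_one (by positivity)]; gcongr
  have hq' : a ^ 2 / (2 * M ^ 2) = a ^ 2 / M ^ 2 / 2 := by ring
  have hq0 : 0 < a ^ 2 / M ^ 2 := by positivity
  have hκ0 : 0 ≤ κ := by rw [hκ, hq']; linarith
  have hκ1 : κ < 1 := by rw [hκ, hq']; linarith
  set s : Set H := {u | u ∈ K ∧ ‖u‖ ≤ ρ} with hs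
  set c : H → H := fun u => u - τ • T u with hc
  have hcontr : ∀ u ∈ s, ∀ v ∈ s, ‖c u - c v‖ ≤ κ * ‖u - v‖ := by
    rintro u ⟨hu, hu'⟩ v ⟨hv, hv'⟩
    have h1 := hlip u hu v hv hu' hv'
    have h2 := hmono u hu v hv hu' hv'
    have h3 : c u - c v = (u - v) - τ • (T u - T v) := by
      simp only [hc, smul_sub]; abel
    have h4 : ‖c u - c v‖ ^ 2 ≤ (κ * ‖u - v‖) ^ 2 := by
      rw [h3, norm_sub_sq_real, real_inner_smul_right, norm_smul, mul_pow, Real.norm_eq_abs,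
        sq_abs, real_inner_comm]
      have h5 : ‖T u - T v‖ ^ 2 ≤ M ^ 2 * ‖u - v‖ ^ 2 := by
        rw [← mul_pow]; gcongr
      have h6 : τ ^ 2 * ‖T u - T v‖ ^ 2 ≤ τ ^ 2 * (M ^ 2 * ‖u - v‖ ^ 2) := by gcongr
      have h7 : τ * (a * ‖u - v‖ ^ 2) ≤ τ * ⟪T u - T v, u - v⟫ := by gcongr
      have h8 : τ * a = a ^ 2 / M ^ 2 := by rw [hτ]; ring
      have h9 : τ ^ 2 * M ^ 2 = a ^ 2 / M ^ 2 := by rw [hτ]; field_simp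
      have h10 : 1 - a ^ 2 / M ^ 2 ≤ κ ^ 2 := by
        rw [hκ, hq']; nlinarith
      have h11 : (1 - a ^ 2 / M ^ 2) * ‖u - v‖ ^ 2 ≤ κ ^ 2 * ‖u - v‖ ^ 2 := by gcongr
      rw [mul_pow]
      rw [← mul_assoc, h9] at h6
      rw [← mul_assoc, h8] at h7
      linarith
    exact (sq_le_sq₀ (norm_nonneg _) (by positivity)).1 h4
  have h0s : (0 : H) ∈ s := ⟨K.zero_mem, by simpa using hρ⟩
  have hmaps : MapsTo c s s := by
    rintro u ⟨hu, hu'⟩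
    refine ⟨K.sub_mem hu (K.smul_mem _ (hTK u hu hu')), ?_⟩
    have h1 := hcontr u ⟨hu, hu'⟩ 0 h0s
    rw [sub_zero] at h1
    have h2 : ‖c 0‖ ≤ τ * (a * ρ / 2) := by
      simp only [hc, zero_sub, norm_neg, norm_smul, Real.norm_eq_abs, abs_of_pos hτ0]
      gcongr
    have h3 : ‖c u‖ ≤ ‖c u - c 0‖ + ‖c 0‖ := by simpa using norm_add_le (c u - c 0) (c 0)
    have h4 : κ * ‖u‖ ≤ κ * ρ := by gcongr
    have h5 : τ * (a * ρ / 2) = (1 - κ) * ρ := by rw [hτ, hκ]; field_simp; ring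
    linarith
  have hclosed : IsClosed s := hK.inter (isClosed_le continuous_norm continuous_const)
  have hcontr' : ContractingWith ⟨κ, hκ0⟩ (MapsTo.restrict c s s hmaps) := by
    refine ⟨by exact_mod_cast hκ1, LipschitzWith.of_dist_le_mul fun x y => ?_⟩
    have := hcontr x x.2 y y.2
    rw [← dist_eq_norm, ← dist_eq_norm] at this
    exact this
  obtain ⟨y, hy, hfix, -⟩ := hcontr'.exists_fixedPoint' hclosed.isComplete hmaps h0s
    (edist_ne_top _ _)
  refine ⟨y, hy.1, hy.2, ?_⟩
  have h1 : y - τ • T y = y := hfix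
  exact (smul_eq_zero.1 (sub_eq_self.1 h1)).resolve_left hτ0.ne'

/-- A family of strongly monotone equations on the closed ball of radius `ρ` of `K` has a unique
solution, which depends continuously on the parameter. -/
theorem exists_continuousOn_zero [CompleteSpace H] {X : Type*} [TopologicalSpace X] {S : Set X}
    {K : Submodule ℝ H} (hK : IsClosed (K : Set H))
    {T : X → H → H} {ρ a M : ℝ} (hρ : 0 ≤ ρ) (ha : 0 < a) (haM : a ≤ M)
    (hTK : ∀ p ∈ S, ∀ u ∈ K, ‖u‖ ≤ ρ → T p u ∈ K)
    (hlip : ∀ p ∈ S, ∀ u ∈ K, ∀ v ∈ K, ‖u‖ ≤ ρ → ‖v‖ ≤ ρ → ‖T p u - T p v‖ ≤ M * ‖u - v‖)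
    (hmono : ∀ p ∈ S, ∀ u ∈ K, ∀ v ∈ K, ‖u‖ ≤ ρ → ‖v‖ ≤ ρ →
      a * ‖u - v‖ ^ 2 ≤ ⟪T p u - T p v, u - v⟫)
    (h0 : ∀ p ∈ S, ‖T p 0‖ ≤ a * ρ / 2)
    (hcont : ∀ u ∈ K, ‖u‖ ≤ ρ → ContinuousOn (fun p => T p u) S) :
    ∃ ψ : X → H, ContinuousOn ψ S ∧ ∀ p ∈ S, ψ p ∈ K ∧ ‖ψ p‖ ≤ ρ ∧ a * ‖ψ p‖ ≤ ‖T p 0‖ ∧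
      ∀ u ∈ K, ‖u‖ ≤ ρ → (T p u = 0 ↔ u = ψ p) := by
  classical
  have hex : ∀ p, ∃ u, p ∈ S → u ∈ K ∧ ‖u‖ ≤ ρ ∧ T p u = 0 := by
    intro p
    by_cases hp : p ∈ S
    · obtain ⟨u, h⟩ := exists_zero_of_strongly_monotone hK hρ ha haM (hTK p hp) (hlip p hp)
        (hmono p hp) (h0 p hp)
      exact ⟨u, fun _ => h⟩
    · exact ⟨0, fun h => absurd h hp⟩
  choose ψ hψ using hex
  have hest : ∀ p ∈ S, ∀ u ∈ K, ‖u‖ ≤ ρ → a * ‖ψ p - u‖ ≤ ‖T p u‖ := by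
    intro p hp u hu hu'
    obtain ⟨h1, h2, h3⟩ := hψ p hp
    have h4 := hmono p hp _ h1 u hu h2 hu'
    rw [h3, zero_sub, inner_neg_left] at h4
    have h5 := abs_le.1 (abs_real_inner_le_norm (T p u) (ψ p - u))
    rcases (norm_nonneg (ψ p - u)).eq_or_lt with h | h
    · rw [← h]; simp
    · refine le_of_mul_le_mul_right ?_ h
      nlinarith
  refine ⟨ψ, fun p hp => ?_, fun p hp => ⟨(hψ p hp).1, (hψ p hp).2.1, ?_, fun u hu hu' =>
    ⟨fun h => ?_, fun h => h ▸ (hψ p hp).2.2⟩⟩⟩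
  · obtain ⟨h1, h2, h3⟩ := hψ p hp
    rw [ContinuousWithinAt, tendsto_iff_norm_sub_tendsto_zero]
    have h4 := (hcont _ h1 h2 p hp).norm
    rw [ContinuousWithinAt, h3, norm_zero] at h4
    have h5 := h4.const_mul a⁻¹
    rw [mul_zero] at h5
    refine squeeze_zero' (Eventually.of_forall fun _ => norm_nonneg _) ?_ h5
    filter_upwards [self_mem_nhdsWithin] with q hq
    rw [← div_eq_inv_mul, le_div_iff₀' ha]
    exact hest q hq _ h1 h2
  · simpa using hest p hp 0 K.zero_mem (by simpa using hρ)
  · have := hest p hp u hu hu'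
    rw [h, norm_zero] at this
    have h6 : ‖ψ p - u‖ ≤ 0 := by
      by_contra hlt
      exact absurd this (not_le.2 (mul_pos ha (not_le.1 hlt)))
    exact (sub_eq_zero.1 (norm_le_zero_iff.1 h6)).symm

end StronglyMonotone

/-! ### The radial square root of a star-convex function -/

section Radial

variable {H : Type*} [NormedAddCommGroup H] [InnerProductSpace ℝ H]
  {X : Type*} [TopologicalSpace X]

/-- The open ball of radius `R` in the subspace `K`, as a subset of the ambient space. -/
abbrev subBall (K : Submodule ℝ H) (R : ℝ) : Set H := {x | x ∈ K ∧ ‖x‖ < R}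

/-- The radial map `x ↦ √(g x) • (x / ‖x‖)`, whose squared norm is `g`. At `x = 0` it is `0`. -/
noncomputable def radialSqrt (g : H → ℝ) (x : H) : H := (√(g x) / ‖x‖) • x

/-- A continuous family `g p`, `p ∈ S`, of functions on the ball of radius `R` of a subspace `K`,
each of which vanishes at `0`, dominates `c ‖x‖ ^ 2` and is convex along rays from `0`. -/
structure IsRadialFamily (S : Set X) (K : Submodule ℝ H) (R c : ℝ) (g : X → H → ℝ) : Prop where
  radius_pos : 0 < R
  const_pos : 0 < c
  cont : ContinuousOn (fun q : X × H => g q.1 q.2) (S ×ˢ subBall K R)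
  map_zero : ∀ p ∈ S, g p 0 = 0
  lower : ∀ p ∈ S, ∀ x ∈ K, ‖x‖ < R → c * ‖x‖ ^ 2 ≤ g p x
  star : ∀ p ∈ S, ∀ x ∈ K, ‖x‖ < R → ∀ t ∈ Icc (0 : ℝ) 1, g p (t • x) ≤ t * g p x

/-- `ξ p` is the inverse, on the ball of radius `√c * R` of `K`, of the radial square root of the
member `g p` of a radial family, and depends continuously on the parameter. -/
structure IsRadialInverse (S : Set X) (K : Submodule ℝ H) (R c : ℝ) (g : X → H → ℝ)
    (ξ : X → H → H) : Prop where
  cont : ContinuousOn (fun q : X × H => ξ q.1 q.2) (S ×ˢ subBall K (√c * R))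
  mem : ∀ p ∈ S, ∀ y ∈ subBall K (√c * R), ξ p y ∈ subBall K R
  eq_iff : ∀ p ∈ S, ∀ y ∈ subBall K (√c * R), ∀ x ∈ subBall K R,
    (radialSqrt (g p) x = y ↔ x = ξ p y)

namespace IsRadialFamily

variable {S : Set X} {K : Submodule ℝ H} {R c : ℝ} {g : X → H → ℝ}

theorem nonneg (h : IsRadialFamily S K R c g) {p : X} (hp : p ∈ S) {x : H} (hx : x ∈ K)
    (hxR : ‖x‖ < R) : 0 ≤ g p x :=
  le_trans (mul_nonneg h.const_pos.le (sq_nonneg _)) (h.lower p hp x hx hxR)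

theorem norm_radialSqrt (h : IsRadialFamily S K R c g) {p : X} (hp : p ∈ S) (x : H) :
    ‖radialSqrt (g p) x‖ = √(g p x) := by
  rcases eq_or_ne x 0 with rfl | hx0
  · simp [radialSqrt, h.map_zero p hp]
  · rw [radialSqrt, norm_smul, norm_div, norm_norm, Real.norm_eq_abs,
      abs_of_nonneg (Real.sqrt_nonneg _),
      div_mul_cancel₀ _ (norm_ne_zero_iff.2 hx0)]

theorem norm_sq_radialSqrt (h : IsRadialFamily S K R c g) {p : X} (hp : p ∈ S) {x : H} (hx : x ∈ K)
    (hxR : ‖x‖ < R) : ‖radialSqrt (g p) x‖ ^ 2 = g p x := by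
  rw [h.norm_radialSqrt hp, Real.sq_sqrt (h.nonneg hp hx hxR)]

theorem le_norm_radialSqrt (h : IsRadialFamily S K R c g) {p : X} (hp : p ∈ S) {x : H} (hx : x ∈ K)
    (hxR : ‖x‖ < R) : √c * ‖x‖ ≤ ‖radialSqrt (g p) x‖ := by
  rw [h.norm_radialSqrt hp]
  refine Real.le_sqrt_of_sq_le ?_
  rw [mul_pow, Real.sq_sqrt h.const_pos.le]
  exact h.lower p hp x hx hxR

theorem continuousOn_radialSqrt (h : IsRadialFamily S K R c g) :
    ContinuousOn (fun q : X × H => radialSqrt (g q.1) q.2) (S ×ˢ subBall K R) := by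
  rintro ⟨p, x⟩ ⟨hp, hx, hxR⟩
  have hg : ContinuousWithinAt (fun q : X × H => √(g q.1 q.2)) (S ×ˢ subBall K R) (p, x) :=
    (h.cont (p, x) ⟨hp, hx, hxR⟩).sqrt
  rcases eq_or_ne x 0 with rfl | hx0
  · have h0 : radialSqrt (g p) (0 : H) = 0 := by simp [radialSqrt]
    rw [ContinuousWithinAt, h0, tendsto_zero_iff_norm_tendsto_zero]
    rw [ContinuousWithinAt, h.map_zero p hp, Real.sqrt_zero] at hg
    refine hg.congr' ?_
    filter_upwards [self_mem_nhdsWithin] with q hq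
    exact (h.norm_radialSqrt hq.1 q.2).symm
  · refine ContinuousWithinAt.smul (hg.div continuous_snd.norm.continuousWithinAt ?_)
      continuous_snd.continuousWithinAt
    exact norm_ne_zero_iff.2 hx0

/-- `g` is monotone along rays. -/
theorem ray_mono (h : IsRadialFamily S K R c g) {p : X} (hp : p ∈ S) {e : H} (he : e ∈ K)
    (he1 : ‖e‖ ≤ 1) {s t : ℝ} (hs : 0 ≤ s) (hst : s ≤ t) (ht : t < R) :
    g p (s • e) ≤ g p (t • e) := by
  rcases hs.eq_or_lt with rfl | hs
  · rw [zero_smul, h.map_zero p hp]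
    refine h.nonneg hp (K.smul_mem _ he) ?_
    rw [norm_smul, Real.norm_of_nonneg hst]
    exact (mul_le_of_le_one_right hst he1).trans_lt ht
  have ht0 : 0 < t := hs.trans_le hst
  have hn : ‖t • e‖ < R := by
    rw [norm_smul, Real.norm_of_nonneg ht0.le]
    exact (mul_le_of_le_one_right ht0.le he1).trans_lt ht
  have h1 := h.star p hp (t • e) (K.smul_mem _ he) hn (s / t)
    ⟨by positivity, (div_le_one ht0).2 hst⟩
  rw [smul_smul, div_mul_cancel₀ _ ht0.ne'] at h1
  refine h1.trans (mul_le_of_le_one_left (h.nonneg hp (K.smul_mem _ he) hn)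
    ((div_le_one ht0).2 hst))

/-- `g` is strictly monotone along rays. -/
theorem ray_strictMono (h : IsRadialFamily S K R c g) {p : X} (hp : p ∈ S) {e : H} (he : e ∈ K)
    (he1 : ‖e‖ = 1) {s t : ℝ} (hs : 0 ≤ s) (hst : s < t) (ht : t < R) :
    g p (s • e) < g p (t • e) := by
  have ht0 : 0 < t := hs.trans_lt hst
  have hn : ‖t • e‖ = t := by rw [norm_smul, Real.norm_of_nonneg ht0.le, he1, mul_one]
  have h1 := h.star p hp (t • e) (K.smul_mem _ he) (by rw [hn]; exact ht) (s / t)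
    ⟨by positivity, (div_le_one ht0).2 hst.le⟩
  have h2 := h.lower p hp (t • e) (K.smul_mem _ he) (by rw [hn]; exact ht)
  rw [smul_smul, div_mul_cancel₀ _ ht0.ne'] at h1
  have h3 : 0 < g p (t • e) := lt_of_lt_of_le (by rw [hn]; have := h.const_pos; positivity) h2
  exact h1.trans_lt (mul_lt_of_lt_one_left h3 ((div_lt_one ht0).2 hst))

theorem radialSqrt_injOn (h : IsRadialFamily S K R c g) {p : X} (hp : p ∈ S) {x y : H}
    (hx : x ∈ K) (hxR : ‖x‖ < R) (hy : y ∈ K) (hyR : ‖y‖ < R)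
    (hxy : radialSqrt (g p) x = radialSqrt (g p) y) : x = y := by
  have hzero : ∀ z ∈ K, ‖z‖ < R → radialSqrt (g p) z = 0 → z = 0 := by
    intro z hz hzR h0
    have h1 := h.le_norm_radialSqrt hp hz hzR
    rw [h0, norm_zero] at h1
    by_contra hne
    exact absurd h1 (not_le.2 (mul_pos (Real.sqrt_pos.2 h.const_pos) (norm_pos_iff.2 hne)))
  have h00 : radialSqrt (g p) (0 : H) = 0 := by simp [radialSqrt]
  rcases eq_or_ne x 0 with rfl | hx0
  · exact (hzero y hy hyR (by rw [← hxy, h00])).symm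
  rcases eq_or_ne y 0 with rfl | hy0
  · exact hzero x hx hxR (by rw [hxy, h00])
  have hnx := norm_pos_iff.2 hx0
  have hny := norm_pos_iff.2 hy0
  have hs : √(g p x) = √(g p y) := by rw [← h.norm_radialSqrt hp, hxy, h.norm_radialSqrt hp]
  have hspos : 0 < √(g p x) := by
    have h1 := h.le_norm_radialSqrt hp hx hxR
    rw [h.norm_radialSqrt hp] at h1
    exact lt_of_lt_of_le (mul_pos (Real.sqrt_pos.2 h.const_pos) hnx) h1
  have hge : g p x = g p y := by
    rw [← Real.sq_sqrt (h.nonneg hp hx hxR), hs, Real.sq_sqrt (h.nonneg hp hy hyR)]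
  have hdir : ‖x‖⁻¹ • x = ‖y‖⁻¹ • y := by
    have h1 : √(g p x) • (‖x‖⁻¹ • x) = √(g p x) • (‖y‖⁻¹ • y) := by
      rw [smul_smul, smul_smul, ← div_eq_mul_inv, ← div_eq_mul_inv]
      nth_rw 2 [hs]
      exact hxy
    exact (smul_right_injective H hspos.ne') h1
  have he : ‖x‖⁻¹ • x ∈ K := K.smul_mem _ hx
  have he1 : ‖‖x‖⁻¹ • x‖ = 1 := by simp [norm_smul, hnx.ne']
  have hx' : ‖x‖ • (‖x‖⁻¹ • x) = x := smul_inv_smul₀ hnx.ne' x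
  have hy' : ‖y‖ • (‖x‖⁻¹ • x) = y := by rw [hdir]; exact smul_inv_smul₀ hny.ne' y
  rcases lt_trichotomy ‖x‖ ‖y‖ with hlt | heq | hlt
  · have := h.ray_strictMono hp he he1 hnx.le hlt hyR
    rw [hx', hy'] at this
    exact absurd hge this.ne
  · rw [← hx', ← hy', heq, ← heq]
  · have := h.ray_strictMono hp he he1 hny.le hlt hxR
    rw [hx', hy'] at this
    exact absurd hge this.ne'

theorem exists_radialSqrt_eq (h : IsRadialFamily S K R c g) {p : X} (hp : p ∈ S) {y : H}
    (hy : y ∈ K) (hyR : ‖y‖ < √c * R) : ∃ x ∈ K, ‖x‖ < R ∧ radialSqrt (g p) x = y := by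
  rcases eq_or_ne y 0 with rfl | hy0
  · exact ⟨0, K.zero_mem, by simpa using h.radius_pos, by simp [radialSqrt]⟩
  have hn := norm_pos_iff.2 hy0
  have hc := Real.sqrt_pos.2 h.const_pos
  set R' := ‖y‖ / √c with hR'
  have hR'0 : 0 < R' := by positivity
  have hR'R : R' < R := (div_lt_iff₀' hc).2 hyR
  set e := ‖y‖⁻¹ • y with he
  have heK : e ∈ K := K.smul_mem _ hy
  have he1 : ‖e‖ = 1 := by simp [he, norm_smul, hn.ne']
  have hnorm : ∀ t : ℝ, 0 ≤ t → ‖t • e‖ = t := fun t ht => by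
    rw [norm_smul, Real.norm_of_nonneg ht, he1, mul_one]
  have hcont : ContinuousOn (fun t : ℝ => g p (t • e)) (Icc 0 R') := by
    have h1 : ContinuousOn (fun t : ℝ => ((p, t • e) : X × H)) (Icc 0 R') := by fun_prop
    refine h.cont.comp h1 fun t ht => ⟨hp, K.smul_mem _ heK, ?_⟩
    rw [hnorm t ht.1]
    exact ht.2.trans_lt hR'R
  have hmem : ‖y‖ ^ 2 ∈ Icc (g p ((0 : ℝ) • e)) (g p (R' • e)) := by
    constructor
    · rw [zero_smul, h.map_zero p hp]; positivity
    · have h1 := h.lower p hp (R' • e) (K.smul_mem _ heK) (by rw [hnorm _ hR'0.le]; exact hR'R)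
      rw [hnorm _ hR'0.le, hR', div_pow, Real.sq_sqrt h.const_pos.le,
        mul_div_cancel₀ _ h.const_pos.ne'] at h1
      exact h1
  obtain ⟨t, ⟨ht0, htR⟩, ht⟩ := intermediate_value_Icc hR'0.le hcont hmem
  simp only at ht
  have htne : t ≠ 0 := by
    rintro rfl
    rw [zero_smul, h.map_zero p hp] at ht
    exact absurd ht (by positivity)
  refine ⟨t • e, K.smul_mem _ heK, by rw [hnorm t ht0]; exact htR.trans_lt hR'R, ?_⟩
  rw [radialSqrt, ht, hnorm t ht0, Real.sqrt_sq hn.le, smul_smul, div_mul_cancel₀ _ htne, he,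
    smul_inv_smul₀ hn.ne']

theorem exists_isRadialInverse (h : IsRadialFamily S K R c g) :
    ∃ ξ : X → H → H, IsRadialInverse S K R c g ξ := by
  classical
  have hex : ∀ p y, ∃ x, p ∈ S → y ∈ K → ‖y‖ < √c * R →
      x ∈ K ∧ ‖x‖ < R ∧ radialSqrt (g p) x = y := by
    intro p y
    by_cases hpy : p ∈ S ∧ y ∈ K ∧ ‖y‖ < √c * R
    · obtain ⟨x, hx⟩ := h.exists_radialSqrt_eq hpy.1 hpy.2.1 hpy.2.2
      exact ⟨x, fun _ _ _ => hx⟩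
    · exact ⟨0, fun h1 h2 h3 => absurd ⟨h1, h2, h3⟩ hpy⟩
  choose ξ hξ using hex
  refine ⟨ξ, ?_, fun p hp y ⟨hy, hyR⟩ => ⟨(hξ p y hp hy hyR).1, (hξ p y hp hy hyR).2.1⟩,
    fun p hp y ⟨hy, hyR⟩ x ⟨hx, hxR⟩ =>
      ⟨fun hxy => ?_, fun hxy => hxy ▸ (hξ p y hp hy hyR).2.2⟩⟩
  swap
  · exact h.radialSqrt_injOn hp hx hxR (hξ p y hp hy hyR).1 (hξ p y hp hy hyR).2.1
      (hxy.trans (hξ p y hp hy hyR).2.2.symm)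
  have hc := Real.sqrt_pos.2 h.const_pos
  set D := S ×ˢ subBall K (√c * R) with hD
  have hbound : ∀ q ∈ D, ‖ξ q.1 q.2‖ ≤ (√c)⁻¹ * ‖q.2‖ := by
    rintro ⟨p, y⟩ ⟨hp, hy, hyR⟩
    obtain ⟨h1, h2, h3⟩ := hξ p y hp hy hyR
    have := h.le_norm_radialSqrt hp h1 h2
    rw [h3] at this
    rw [← div_eq_inv_mul, le_div_iff₀' hc]
    exact this
  -- in polar coordinates, `ξ p y` lies on the ray through `y`
  have hpolar : ∀ q ∈ D, q.2 ≠ 0 → ‖ξ q.1 q.2‖ • (‖q.2‖⁻¹ • q.2) = ξ q.1 q.2 ∧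
      g q.1 (‖ξ q.1 q.2‖ • (‖q.2‖⁻¹ • q.2)) = ‖q.2‖ ^ 2 := by
    rintro ⟨p, y⟩ ⟨hp, hy, hyR⟩ hy0
    obtain ⟨h1, h2, h3⟩ := hξ p y hp hy hyR
    simp only at hy0 ⊢
    have hx0 : ξ p y ≠ 0 := by
      intro h0
      rw [h0] at h3
      exact hy0 (by rw [← h3]; simp [radialSqrt])
    have h4 : ‖y‖ = √(g p (ξ p y)) := by
      conv_lhs => rw [← h3]
      exact h.norm_radialSqrt hp _
    have h5 : ‖ξ p y‖ • (‖y‖⁻¹ • y) = ξ p y := by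
      have hyn := norm_pos_iff.2 hy0
      have hxn := norm_pos_iff.2 hx0
      have h6 : y = (‖y‖ / ‖ξ p y‖) • ξ p y := by
        conv_lhs => rw [← h3, radialSqrt, ← h4]
      have haux : ∀ (x z : H) (t : ℝ), 0 < t → 0 < ‖x‖ → z = (t / ‖x‖) • x →
          ‖x‖ • (t⁻¹ • z) = x := by
        rintro x z t ht hx rfl
        rw [smul_smul, smul_smul, show ‖x‖ * t⁻¹ * (t / ‖x‖) = 1 by field_simp, one_smul]
      exact haux _ _ _ hyn hxn h6
    refine ⟨h5, ?_⟩
    rw [h5, h4, Real.sq_sqrt (h.nonneg hp h1 h2)]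
  rintro ⟨p₀, y₀⟩ hq₀
  have hq₀' := hq₀
  obtain ⟨hp₀, hy₀, hy₀R⟩ := hq₀
  obtain ⟨hx1, hx2, hx3⟩ := hξ p₀ y₀ hp₀ hy₀ hy₀R
  rcases eq_or_ne y₀ 0 with rfl | hy0
  · have h0 : ξ p₀ 0 = 0 := by
      have := hbound _ hq₀'
      simpa using this
    rw [ContinuousWithinAt, h0]
    have h1 : Tendsto (fun q : X × H => (√c)⁻¹ * ‖q.2‖) (𝓝[D] (p₀, 0)) (𝓝 0) := by
      have h2 : Continuous fun q : X × H => (√c)⁻¹ * ‖q.2‖ := by fun_prop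
      have h3 := h2.tendsto (p₀, (0 : H))
      simp only [norm_zero, mul_zero] at h3
      exact h3.mono_left nhdsWithin_le_nhds
    refine squeeze_zero_norm' ?_ h1
    filter_upwards [self_mem_nhdsWithin] with q hq using hbound q hq
  have hne : ∀ᶠ q : X × H in 𝓝[D] (p₀, y₀), q.2 ≠ 0 :=
    (continuous_snd.continuousAt.eventually_ne hy0).filter_mono nhdsWithin_le_nhds
  have hray : ∀ b : ℝ, 0 ≤ b → b < R →
      Tendsto (fun q : X × H => g q.1 (b • (‖q.2‖⁻¹ • q.2))) (𝓝[D] (p₀, y₀))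
        (𝓝 (g p₀ (b • (‖y₀‖⁻¹ • y₀)))) := by
    intro b hb hbR
    have h1 : ContinuousWithinAt (fun q : X × H => (q.1, b • (‖q.2‖⁻¹ • q.2))) D (p₀, y₀) := by
      refine continuousWithinAt_fst.prodMk (ContinuousWithinAt.const_smul ?_ b)
      exact (continuousWithinAt_snd.norm.inv₀ (norm_ne_zero_iff.2 hy0)).smul continuousWithinAt_snd
    have hmaps : MapsTo (fun q : X × H => (q.1, b • (‖q.2‖⁻¹ • q.2))) D
        (S ×ˢ subBall K R) := by
      rintro ⟨p, y⟩ ⟨hp, hy, -⟩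
      refine ⟨hp, K.smul_mem _ (K.smul_mem _ hy), ?_⟩
      refine lt_of_le_of_lt ?_ hbR
      rw [norm_smul, Real.norm_of_nonneg hb]
      refine mul_le_of_le_one_right hb ?_
      rw [norm_smul, norm_inv, norm_norm]
      exact inv_mul_le_one
    exact ContinuousWithinAt.comp (g := fun q : X × H => g q.1 q.2) (x := (p₀, y₀))
      (h.cont _ (hmaps hq₀')) h1 hmaps
  set t₀ := ‖ξ p₀ y₀‖ with ht₀
  obtain ⟨hpol1, hpol2⟩ := hpolar _ hq₀' hy0
  simp only at hpol1 hpol2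
  rw [← ht₀] at hpol1 hpol2
  have hunit : ∀ y : H, y ≠ 0 → ‖‖y‖⁻¹ • y‖ = 1 := fun y hy => by
    simp [norm_smul, norm_ne_zero_iff.2 hy]
  have hnsq : Tendsto (fun q : X × H => ‖q.2‖ ^ 2) (𝓝[D] (p₀, y₀)) (𝓝 (‖y₀‖ ^ 2)) :=
    (continuous_snd.norm.pow 2).continuousWithinAt
  -- the length of `ξ` is continuous, by monotonicity along rays
  have hlen : Tendsto (fun q : X × H => ‖ξ q.1 q.2‖) (𝓝[D] (p₀, y₀)) (𝓝 t₀) := by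
    refine tendsto_order.2 ⟨fun b hb => ?_, fun b hb => ?_⟩
    · rcases lt_or_ge b 0 with hb0 | hb0
      · exact Eventually.of_forall fun q => hb0.trans_le (norm_nonneg _)
      have hlt := h.ray_strictMono hp₀ (K.smul_mem _ hy₀) (hunit y₀ hy0) hb0 hb hx2
      rw [hpol2] at hlt
      have hev := (hray b hb0 (hb.trans hx2)).eventually_lt hnsq hlt
      filter_upwards [hev, hne, self_mem_nhdsWithin] with q h1 h2 h3
      by_contra hle
      have h4 := h.ray_mono h3.1 (K.smul_mem _ h3.2.1) (hunit q.2 h2).le (norm_nonneg _)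
        (not_lt.1 hle) (hb.trans hx2)
      rw [(hpolar q h3 h2).2] at h4
      exact absurd h1 (not_lt.2 h4)
    · obtain ⟨b', hb1, hb2⟩ := exists_between (lt_min hb hx2)
      have hb'R : b' < R := hb2.trans_le (min_le_right _ _)
      have hb'b : b' < b := hb2.trans_le (min_le_left _ _)
      have hb'0 : 0 ≤ b' := (norm_nonneg _).trans hb1.le
      have hlt := h.ray_strictMono hp₀ (K.smul_mem _ hy₀) (hunit y₀ hy0) (norm_nonneg _) hb1 hb'R
      rw [hpol2] at hlt
      have hev := hnsq.eventually_lt (hray b' hb'0 hb'R) hlt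
      filter_upwards [hev, hne, self_mem_nhdsWithin] with q h1 h2 h3
      refine lt_of_le_of_lt ?_ hb'b
      by_contra hle
      have h4 := h.ray_mono h3.1 (K.smul_mem _ h3.2.1) (hunit q.2 h2).le hb'0
        (not_le.1 hle).le (hξ _ _ h3.1 h3.2.1 h3.2.2).2.1
      rw [(hpolar q h3 h2).2] at h4
      exact absurd h1 (not_lt.2 h4)
  have hdir : ContinuousWithinAt (fun q : X × H => ‖q.2‖⁻¹ • q.2) D (p₀, y₀) :=
    (continuousWithinAt_snd.norm.inv₀ (norm_ne_zero_iff.2 hy0)).smul continuousWithinAt_snd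
  have hlim := hlen.smul hdir
  rw [ContinuousWithinAt]
  simp only at hlim ⊢
  rw [hpol1] at hlim
  refine hlim.congr' ?_
  filter_upwards [hne, self_mem_nhdsWithin] with q h2 h3 using (hpolar q h3 h2).1

end IsRadialFamily

namespace IsRadialInverse

variable {S : Set X} {K : Submodule ℝ H} {R c : ℝ} {g : X → H → ℝ} {ξ : X → H → H}

theorem radialSqrt_eq (h : IsRadialInverse S K R c g ξ) {p : X} (hp : p ∈ S) {y : H}
    (hy : y ∈ subBall K (√c * R)) : radialSqrt (g p) (ξ p y) = y :=
  (h.eq_iff p hp y hy _ (h.mem p hp y hy)).2 rfl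

theorem map_zero (h : IsRadialInverse S K R c g ξ) (hR : 0 < R) (hc : 0 < c) {p : X} (hp : p ∈ S) :
    ξ p 0 = 0 := by
  have h0 : ∀ t : ℝ, 0 < t → (0 : H) ∈ subBall K t := fun t ht => ⟨K.zero_mem, by simpa using ht⟩
  refine ((h.eq_iff p hp 0 (h0 _ (mul_pos (Real.sqrt_pos.2 hc) hR)) 0 (h0 _ hR)).1 ?_).symm
  simp [radialSqrt]

end IsRadialInverse

end Radial

/-! ### Uniform estimates near the origin -/

section LocalEstimates

variable {H : Type*} [NormedAddCommGroup H] [InnerProductSpace ℝ H]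

theorem exists_inner_sub_eq_of_gateaux {F : H → H} {B : H → H →L[ℝ] H} {R : ℝ}
    (hF : ∀ x, ‖x‖ < R → HasGateauxDerivAt F (B x) x) {x y : H} (hx : ‖x‖ < R) (hy : ‖y‖ < R)
    (w : H) : ∃ ξ, ‖ξ‖ < R ∧ ⟪F y - F x, w⟫ = ⟪B ξ (y - x), w⟫ := by
  have hseg : ∀ t ∈ Icc (0 : ℝ) 1, ‖x + t • (y - x)‖ < R := by
    intro t ht
    have h1 := (convex_ball (0 : H) R).add_smul_sub_mem (x := x) (y := y) (by simpa using hx)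
      (by simpa using hy) ht
    simpa using h1
  have hderiv : ∀ t ∈ Icc (0 : ℝ) 1, HasDerivAt (fun t : ℝ => ⟪F (x + t • (y - x)), w⟫)
      ⟪B (x + t • (y - x)) (y - x), w⟫ t := by
    intro t ht
    have h1 := hF _ (hseg t ht) (y - x)
    unfold HasLineDerivAt at h1
    have h2 : HasDerivAt (fun s : ℝ => F (x + s • (y - x))) (B (x + t • (y - x)) (y - x)) t := by
      have h3 := HasDerivAt.scomp_of_eq t h1 ((hasDerivAt_id t).sub_const t) (by simp)
      simp only [one_smul] at h3
      refine h3.congr_of_eventuallyEq (Eventually.of_forall fun s => ?_)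
      simp only [Function.comp, id]
      congr 1
      module
    simpa using h2.inner ℝ (hasDerivAt_const t w)
  obtain ⟨t, ht, hslope⟩ := exists_hasDerivAt_eq_slope
    (fun t : ℝ => ⟪F (x + t • (y - x)), w⟫) _ zero_lt_one
    (fun t ht => (hderiv t ht).continuousAt.continuousWithinAt)
    (fun t ht => hderiv t (Ioo_subset_Icc_self ht))
  refine ⟨_, hseg t (Ioo_subset_Icc_self ht), ?_⟩
  rw [hslope]
  simp [inner_sub_left]

theorem eventually_norm_sub_apply_le_of_finiteDimensional {X : Type*} {l : Filter X}
    {B : X → H →L[ℝ] H} {B₀ : H →L[ℝ] H} (hB : ∀ v, Tendsto (fun x => B x v) l (𝓝 (B₀ v)))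
    (Y : Submodule ℝ H) [FiniteDimensional ℝ Y] {ω : ℝ} (hω : 0 < ω) :
    ∀ᶠ x in l, ∀ v ∈ Y, ‖B x v - B₀ v‖ ≤ ω * ‖v‖ := by
  let b := stdOrthonormalBasis ℝ Y
  have h1 : Tendsto (fun x => ∑ i, ‖B x (b i) - B₀ (b i)‖) l (𝓝 0) := by
    have : ∀ i, Tendsto (fun x => ‖B x (b i) - B₀ (b i)‖) l (𝓝 0) := fun i =>
      tendsto_iff_norm_sub_tendsto_zero.1 (hB (b i))
    simpa using tendsto_finsetSum Finset.univ fun i _ => this i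
  filter_upwards [h1.eventually_lt_const hω] with x hx v hv
  have h2 : v = ∑ i, ⟪(b i : H), v⟫ • (b i : H) := by
    have h3 := congrArg (Subtype.val) (b.sum_repr' ⟨v, hv⟩)
    rw [Submodule.coe_sum] at h3
    exact h3.symm
  have h4 : B x v - B₀ v = ∑ i, ⟪(b i : H), v⟫ • (B x (b i) - B₀ (b i)) := by
    conv_lhs => rw [h2]
    rw [map_sum, map_sum, ← Finset.sum_sub_distrib]
    exact Finset.sum_congr rfl fun i _ => by rw [map_smul, map_smul, smul_sub]
  calc ‖B x v - B₀ v‖ ≤ ∑ i, ‖⟪(b i : H), v⟫ • (B x (b i) - B₀ (b i))‖ := by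
        rw [h4]; exact norm_sum_le _ _
    _ ≤ ∑ i, ‖v‖ * ‖B x (b i) - B₀ (b i)‖ := by
        refine Finset.sum_le_sum fun i _ => ?_
        rw [norm_smul]
        gcongr
        refine (norm_inner_le_norm _ _).trans ?_
        have : ‖(b i : H)‖ = 1 := b.orthonormal.norm_eq_one i
        rw [this, one_mul]
    _ ≤ ω * ‖v‖ := by
        rw [← Finset.mul_sum, mul_comm]
        gcongr

omit [InnerProductSpace ℝ H] in
/-- An estimate with a constant that holds from some index on along each sequence in `V` tending to
`0`, with a constant depending on the sequence, holds near `0` with a single constant. -/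
theorem exists_eventually_nhds_zero_of_seq {V : Set H} (hV : V ∈ 𝓝 (0 : H)) {p : ℕ → H → Prop}
    (hp : ∀ x, Monotone fun c => p c x)
    (h : ∀ x : ℕ → H, (∀ k, x k ∈ V) → Tendsto x atTop (𝓝 0) → ∃ c, ∀ᶠ k in atTop, p c (x k)) :
    ∃ c, ∀ᶠ x in 𝓝 (0 : H), p c x := by
  by_contra! hcon
  have hex : ∀ c : ℕ, ∃ x, x ∈ V ∧ ‖x‖ < 1 / ((c : ℝ) + 1) ∧ ¬ p c x := by
    intro c
    have hball : ∀ᶠ x in 𝓝 (0 : H), ‖x‖ < 1 / ((c : ℝ) + 1) := by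
      have : Metric.ball (0 : H) (1 / ((c : ℝ) + 1)) ∈ 𝓝 (0 : H) :=
        Metric.ball_mem_nhds _ (by positivity)
      filter_upwards [this] with x hx using by simpa using hx
    obtain ⟨x, h1, h2, h3⟩ := ((hcon c).and_eventually (hball.and hV)).exists
    exact ⟨x, h3, h2, h1⟩
  choose x hxV hxn hxp using hex
  have hx0 : Tendsto x atTop (𝓝 0) :=
    squeeze_zero_norm (fun k => (hxn k).le) tendsto_one_div_add_atTop_nhds_zero_nat
  obtain ⟨c, hc⟩ := h x hxV hx0
  obtain ⟨k, hk, hck⟩ := (hc.and (eventually_ge_atTop c)).exists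
  exact hxp k (hp _ hck hk)

variable [CompleteSpace H]

namespace SplittingHypothesis

variable {V : Set H} {L : H → ℝ} {B P Q : H → H →L[ℝ] H}

theorem mem_nhds (h : SplittingHypothesis ⊤ V L B P Q) : V ∈ 𝓝 (0 : H) :=
  h.isOpen.mem_nhds h.zero_mem

theorem tendsto_P (h : SplittingHypothesis ⊤ V L B P Q) (u : H) :
    Tendsto (fun x => P x u) (𝓝 0) (𝓝 (P 0 u)) := by
  rw [Metric.tendsto_nhds]
  intro ε hε
  obtain ⟨-, hc⟩ := exists_eventually_nhds_zero_of_seq h.mem_nhds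
    (p := fun _ x => dist (P x u) (P 0 u) < ε) (fun x => monotone_const) (fun x hxV hx => by
      have := h.D2 x (fun k => ⟨hxV k, trivial⟩) (by simpa using hx.norm) u
      refine ⟨0, ?_⟩
      filter_upwards [this.eventually_lt_const hε] with k hk
      rwa [dist_eq_norm])
  exact hc

theorem eventually_coercive (h : SplittingHypothesis ⊤ V L B P Q) :
    ∃ C > (0 : ℝ), ∀ᶠ x in 𝓝 (0 : H), ∀ u, C * ‖u‖ ^ 2 ≤ ⟪P x u, u⟫ := by
  obtain ⟨c, hc⟩ := exists_eventually_nhds_zero_of_seq h.mem_nhds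
    (p := fun c x => ∀ u, 1 / ((c : ℝ) + 1) * ‖u‖ ^ 2 ≤ ⟪P x u, u⟫)
    (fun x c d hcd hc u => le_trans (by gcongr) (hc u)) (fun x hxV hx => by
      obtain ⟨C, hC, k₀, hk₀⟩ := h.D4 x (fun k => ⟨hxV k, trivial⟩) (by simpa using hx.norm)
      obtain ⟨c, hc⟩ := exists_nat_one_div_lt hC
      refine ⟨c, ?_⟩
      filter_upwards [eventually_ge_atTop k₀] with k hk u
      refine le_trans ?_ (hk₀ u k hk)
      gcongr)
  exact ⟨_, by positivity, hc⟩

theorem eventually_norm_P_le (h : SplittingHypothesis ⊤ V L B P Q) :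
    ∃ M : ℝ, ∀ᶠ x in 𝓝 (0 : H), ‖P x‖ ≤ M := by
  obtain ⟨c, hc⟩ := exists_eventually_nhds_zero_of_seq h.mem_nhds
    (p := fun c x => ‖P x‖ ≤ c)
    (fun x c d hcd (hc : ‖P x‖ ≤ c) => hc.trans (by exact_mod_cast hcd)) (fun x hxV hx => by
      have hbs := banach_steinhaus (g := fun k => P (x k)) (fun u => by
        have h1 := ((h.tendsto_P u).comp hx).norm
        obtain ⟨C, hC⟩ := h1.bddAbove_range
        exact ⟨C, fun k => hC ⟨k, rfl⟩⟩)
      obtain ⟨C, hC⟩ := hbs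
      obtain ⟨c, hc⟩ := exists_nat_ge C
      exact ⟨c, Eventually.of_forall fun k => (hC k).trans hc⟩)
  exact ⟨c, hc⟩

theorem tendsto_Q (h : SplittingHypothesis ⊤ V L B P Q) : Tendsto Q (𝓝 0) (𝓝 (Q 0)) := by
  have h1 := h.D3
  rw [Submodule.top_coe, inter_univ] at h1
  exact h1.continuousAt h.mem_nhds

theorem B_eq (h : SplittingHypothesis ⊤ V L B P Q) {x : H} (hx : x ∈ V) : B x = P x + Q x :=
  h.decomposition x ⟨hx, trivial⟩

theorem tendsto_B (h : SplittingHypothesis ⊤ V L B P Q) (u : H) :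
    Tendsto (fun x => B x u) (𝓝 0) (𝓝 (B 0 u)) := by
  rw [h.B_eq h.zero_mem]
  have h1 : Tendsto (fun x => Q x u) (𝓝 0) (𝓝 (Q 0 u)) :=
    ((ContinuousLinearMap.apply ℝ H u).continuous.tendsto (Q 0)).comp h.tendsto_Q
  refine ((h.tendsto_P u).add h1).congr' ?_
  filter_upwards [h.mem_nhds] with x hx
  rw [h.B_eq hx]; rfl

theorem eventually_norm_B_le (h : SplittingHypothesis ⊤ V L B P Q) :
    ∃ M : ℝ, ∀ᶠ x in 𝓝 (0 : H), ‖B x‖ ≤ M := by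
  obtain ⟨M, hM⟩ := h.eventually_norm_P_le
  refine ⟨M + (‖Q 0‖ + 1), ?_⟩
  filter_upwards [hM, h.tendsto_Q.norm.eventually_lt_const (lt_add_one ‖Q 0‖), h.mem_nhds]
    with x h1 h2 hx
  rw [h.B_eq hx]
  exact (norm_add_le _ _).trans (add_le_add h1 h2.le)

theorem isSelfAdjoint_B_zero (h : SplittingHypothesis ⊤ V L B P Q) : IsSelfAdjoint (B 0) :=
  h.selfAdjoint_B 0 ⟨h.zero_mem, trivial⟩

theorem exists_form_B_zero_bound (h : SplittingHypothesis ⊤ V L B P Q) :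
    ∃ a > (0 : ℝ), ∀ u ∈ posSpace (B 0), a * ‖u‖ ^ 2 ≤ ⟪B 0 u, u⟫ := by
  obtain ⟨C, hC, hCe⟩ := h.eventually_coercive
  have := exists_le_form_of_mem_posSpace hC (h.selfAdjoint_P 0 ⟨h.zero_mem, trivial⟩)
    (h.selfAdjoint_Q 0 ⟨h.zero_mem, trivial⟩) hCe.self_of_nhds
    (h.compact_Q 0 ⟨h.zero_mem, trivial⟩)
  rwa [← h.B_eq h.zero_mem] at this

theorem finiteDimensional_of_nonpos (h : SplittingHypothesis ⊤ V L B P Q) {K : Submodule ℝ H}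
    (hK : ∀ u ∈ K, ⟪B 0 u, u⟫ ≤ 0) : FiniteDimensional ℝ K := by
  obtain ⟨C, hC, hCe⟩ := h.eventually_coercive
  rw [h.B_eq h.zero_mem] at hK
  exact finiteDimensional_of_form_nonpos hC hCe.self_of_nhds
    (h.compact_Q 0 ⟨h.zero_mem, trivial⟩) hK

theorem finiteDimensional_nullSpace (h : SplittingHypothesis ⊤ V L B P Q) :
    FiniteDimensional ℝ (nullSpace (B 0)) :=
  h.finiteDimensional_of_nonpos fun u hu => by
    have : B 0 u = 0 := hu
    simp [this]

theorem finiteDimensional_negSpace (h : SplittingHypothesis ⊤ V L B P Q) :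
    FiniteDimensional ℝ (negSpace (B 0)) :=
  h.finiteDimensional_of_nonpos fun _ hu =>
    form_nonpos_of_mem_negSpace h.isSelfAdjoint_B_zero.isSymmetric hu

/-- The form of `B x` is coercive on `posSpace (B 0)`, uniformly for `x` near `0`, although `B x`
converges to `B 0` only strongly. -/
theorem eventually_form_posSpace (h : SplittingHypothesis ⊤ V L B P Q) :
    ∃ a > (0 : ℝ), ∀ᶠ x in 𝓝 (0 : H), ∀ u ∈ posSpace (B 0), a * ‖u‖ ^ 2 ≤ ⟪B x u, u⟫ := by
  obtain ⟨C, hC, hCe⟩ := h.eventually_coercive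
  obtain ⟨a, ha, hae⟩ := h.exists_form_B_zero_bound
  set m := min a C / 2 with hm
  have hm0 : 0 < m := by positivity
  refine ⟨m, hm0, ?_⟩
  by_contra hcon
  set bad : Set H := {x | ¬ ∀ u ∈ posSpace (B 0), m * ‖u‖ ^ 2 ≤ ⟪B x u, u⟫} with hbad
  have hne : (𝓝 (0 : H) ⊓ 𝓟 bad).NeBot := frequently_iff_neBot.1 (not_eventually.1 hcon)
  let 𝒰 : Ultrafilter H := Ultrafilter.of (𝓝 (0 : H) ⊓ 𝓟 bad)
  have h𝒰 : (𝒰 : Filter H) ≤ 𝓝 0 := (Ultrafilter.of_le _).trans inf_le_left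
  have h𝒰bad : ∀ᶠ x in 𝒰, x ∈ bad :=
    (Ultrafilter.of_le (𝓝 (0 : H) ⊓ 𝓟 bad)).trans inf_le_right (mem_principal_self bad)
  have hex : ∀ x ∈ bad, ∃ u ∈ posSpace (B 0), ‖u‖ = 1 ∧ ⟪B x u, u⟫ ≤ m := by
    intro x hx
    simp only [hbad, mem_ofPred_eq, not_forall, not_le] at hx
    obtain ⟨u, hu, hlt⟩ := hx
    have hu0 : u ≠ 0 := by rintro rfl; simp at hlt
    have hn : ‖u‖ ≠ 0 := norm_ne_zero_iff.2 hu0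
    refine ⟨‖u‖⁻¹ • u, Submodule.smul_mem _ _ hu, by simp [norm_smul, hn], ?_⟩
    rw [map_smul, real_inner_smul_left, real_inner_smul_right, ← mul_assoc, ← mul_inv,
      ← div_eq_inv_mul, div_le_iff₀ (by positivity), ← sq]
    exact hlt.le
  obtain ⟨x₁, hx₁⟩ := h𝒰bad.exists
  obtain ⟨u₁, hu₁, hu₁1, -⟩ := hex x₁ hx₁
  have hex' : ∀ x, ∃ u ∈ posSpace (B 0), ‖u‖ = 1 ∧ (x ∈ bad → ⟪B x u, u⟫ ≤ m) := by
    intro x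
    by_cases hx : x ∈ bad
    · obtain ⟨u, h1, h2, h3⟩ := hex x hx
      exact ⟨u, h1, h2, fun _ => h3⟩
    · exact ⟨u₁, hu₁, hu₁1, fun h => absurd h hx⟩
  choose u huK hu1 hub using hex'
  obtain ⟨u₀, hweak⟩ := exists_weak_limit 𝒰 u fun x => (hu1 x).le
  have hV : ∀ᶠ x in 𝒰, x ∈ V := h𝒰 h.mem_nhds
  obtain ⟨hle, hu₀1⟩ := form_weak_lower_bound (b := fun _ => m) (P := P) (Q := Q)
    (hV.mono fun x hx => h.selfAdjoint_P x ⟨hx, trivial⟩)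
    (fun v => (h.tendsto_P v).mono_left h𝒰) (h𝒰 hCe) (h.tendsto_Q.mono_left h𝒰)
    (h.compact_Q 0 ⟨h.zero_mem, trivial⟩) hu1 hweak
    (by
      filter_upwards [hV, h𝒰bad] with x hx hx'
      rw [← h.B_eq hx]
      exact hub x hx') tendsto_const_nhds
  rw [← h.B_eq h.zero_mem] at hle
  have h1 := hae u₀ (mem_posSpace_of_weak huK hweak)
  have h2 : ‖u₀‖ ^ 2 ≤ 1 := by nlinarith [norm_nonneg u₀]
  have h3 : min a C * ‖u₀‖ ^ 2 ≤ a * ‖u₀‖ ^ 2 := by gcongr; exact min_le_left _ _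
  have h4 : min a C * (1 - ‖u₀‖ ^ 2) ≤ C * (1 - ‖u₀‖ ^ 2) :=
    mul_le_mul_of_nonneg_right (min_le_right _ _) (by linarith)
  linarith

end SplittingHypothesis

end LocalEstimates

/-! ### Saddle families -/

section SaddleFamilies

variable {H : Type*} [NormedAddCommGroup H] [InnerProductSpace ℝ H]

/-- `H` is the orthogonal sum of the subspaces `E₀`, `Ep`, `Em`. -/
structure IsOrthogonalSplitting (E₀ Ep Em : Submodule ℝ H) [E₀.HasOrthogonalProjection]
    [Ep.HasOrthogonalProjection] [Em.HasOrthogonalProjection] : Prop where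
  sum_eq : ∀ x : H, E₀.starProjection x + Ep.starProjection x + Em.starProjection x = x
  ortho_null_pos : E₀ ⟂ Ep
  ortho_null_neg : E₀ ⟂ Em
  ortho_pos_neg : Ep ⟂ Em

/-- The difference of the orthogonal projections onto `Ep` and `Em`. -/
noncomputable def signProj (Ep Em : Submodule ℝ H) [Ep.HasOrthogonalProjection]
    [Em.HasOrthogonalProjection] : H →L[ℝ] H := Ep.starProjection - Em.starProjection

theorem starProjection_eq_zero_of_isOrtho {U W : Submodule ℝ H} [W.HasOrthogonalProjection]
    (h : U ⟂ W) {x : H} (hx : x ∈ U) : W.starProjection x = 0 :=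
  (Submodule.starProjection_apply_eq_zero_iff W).2 (h hx)

theorem starProjection_add_left_of_isOrtho {U W : Submodule ℝ H} [U.HasOrthogonalProjection]
    (h : U ⟂ W) {u w : H} (hu : u ∈ U) (hw : w ∈ W) : U.starProjection (u + w) = u := by
  rw [map_add, Submodule.starProjection_eq_self_iff.2 hu,
    starProjection_eq_zero_of_isOrtho h.symm hw, add_zero]

theorem starProjection_add_right_of_isOrtho {U W : Submodule ℝ H} [W.HasOrthogonalProjection]
    (h : U ⟂ W) {u w : H} (hu : u ∈ U) (hw : w ∈ W) : W.starProjection (u + w) = w := by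
  rw [map_add, Submodule.starProjection_eq_self_iff.2 hw,
    starProjection_eq_zero_of_isOrtho h hu, zero_add]

namespace IsOrthogonalSplitting

variable {E₀ Ep Em : Submodule ℝ H} [E₀.HasOrthogonalProjection] [Ep.HasOrthogonalProjection]
  [Em.HasOrthogonalProjection]

theorem pos_mem (h : IsOrthogonalSplitting E₀ Ep Em) {x : H} (hx : x ∈ Ep) : x ∈ E₀ᗮ :=
  h.ortho_null_pos.symm hx

theorem neg_mem (h : IsOrthogonalSplitting E₀ Ep Em) {x : H} (hx : x ∈ Em) : x ∈ E₀ᗮ :=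
  h.ortho_null_neg.symm hx

theorem eq_add_of_mem (h : IsOrthogonalSplitting E₀ Ep Em) {d : H} (hd : d ∈ E₀ᗮ) :
    d = Ep.starProjection d + Em.starProjection d := by
  have h1 := h.sum_eq d
  rw [(Submodule.starProjection_apply_eq_zero_iff E₀).2 hd, zero_add] at h1
  exact h1.symm

theorem orthogonal_starProjection (h : IsOrthogonalSplitting E₀ Ep Em) (x : H) :
    E₀ᗮ.starProjection x = Ep.starProjection x + Em.starProjection x := by
  have h1 := h.sum_eq x
  have h2 := Submodule.starProjection_add_starProjection_orthogonal (K := E₀) x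
  rw [add_assoc] at h1
  exact add_left_cancel (h2.trans h1.symm)

theorem norm_sq_eq (h : IsOrthogonalSplitting E₀ Ep Em) {d : H} (hd : d ∈ E₀ᗮ) :
    ‖d‖ ^ 2 = ‖Ep.starProjection d‖ ^ 2 + ‖Em.starProjection d‖ ^ 2 := by
  have h1 : ⟪Ep.starProjection d, Em.starProjection d⟫ = 0 :=
    Submodule.isOrtho_iff_inner_eq.1 h.ortho_pos_neg _ (Submodule.starProjection_apply_mem _ _) _
      (Submodule.starProjection_apply_mem _ _)
  conv_lhs => rw [h.eq_add_of_mem hd]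
  rw [norm_add_sq_real, h1]; ring

theorem norm_signProj_le (h : IsOrthogonalSplitting E₀ Ep Em) (x : H) :
    ‖signProj Ep Em x‖ ≤ ‖x‖ := by
  have h1 : ⟪Ep.starProjection x, Em.starProjection x⟫ = 0 :=
    Submodule.isOrtho_iff_inner_eq.1 h.ortho_pos_neg _ (Submodule.starProjection_apply_mem _ _) _
      (Submodule.starProjection_apply_mem _ _)
  have h2 : ‖signProj Ep Em x‖ = ‖E₀ᗮ.starProjection x‖ := by
    rw [← sq_eq_sq₀ (norm_nonneg _) (norm_nonneg _), h.orthogonal_starProjection, signProj,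
      sub_apply, norm_add_sq_real, norm_sub_sq_real, h1]
    ring
  rw [h2]
  exact Submodule.norm_starProjection_apply_le _ _

theorem signProj_mem (h : IsOrthogonalSplitting E₀ Ep Em) (x : H) : signProj Ep Em x ∈ E₀ᗮ :=
  Submodule.sub_mem _ (h.pos_mem (Submodule.starProjection_apply_mem _ _))
    (h.neg_mem (Submodule.starProjection_apply_mem _ _))

theorem inner_signProj (x y : H) : ⟪signProj Ep Em x, y⟫ = ⟪x, signProj Ep Em y⟫ := by
  simp only [signProj, sub_apply, inner_sub_left, inner_sub_right,
    Submodule.inner_starProjection_left_eq_right]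

theorem signProj_eq_zero_iff (h : IsOrthogonalSplitting E₀ Ep Em) {x : H} :
    signProj Ep Em x = 0 ↔ Ep.starProjection x = 0 ∧ Em.starProjection x = 0 := by
  refine ⟨fun h0 => ?_, fun h0 => by simp [signProj, h0.1, h0.2]⟩
  have h1 : Ep.starProjection x = Em.starProjection x := sub_eq_zero.1 h0
  have h2 : Ep.starProjection (Ep.starProjection x) = 0 := by
    rw [h1]
    exact starProjection_eq_zero_of_isOrtho h.ortho_pos_neg.symm
      (Submodule.starProjection_apply_mem _ _)
  rw [Submodule.starProjection_eq_self_iff.2 (Submodule.starProjection_apply_mem _ _)] at h2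
  exact ⟨h2, h1 ▸ h2⟩

theorem orthogonal_starProjection_eq_zero_iff (h : IsOrthogonalSplitting E₀ Ep Em) {x : H} :
    E₀ᗮ.starProjection x = 0 ↔ signProj Ep Em x = 0 := by
  rw [h.signProj_eq_zero_iff, h.orthogonal_starProjection]
  refine ⟨fun h0 => ?_, fun h0 => by simp [h0.1, h0.2]⟩
  have h1 := starProjection_add_left_of_isOrtho h.ortho_pos_neg
    (Submodule.starProjection_apply_mem Ep x)
    (Submodule.starProjection_apply_mem Em x)
  have h2 := starProjection_add_right_of_isOrtho h.ortho_pos_neg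
    (Submodule.starProjection_apply_mem Ep x)
    (Submodule.starProjection_apply_mem Em x)
  rw [h0, map_zero] at h1 h2
  exact ⟨h1.symm, h2.symm⟩

end IsOrthogonalSplitting

variable [CompleteSpace H]

/-- A family of `C¹` functionals `f lam`, `lam ∈ C`, on the ball of radius `R`, with critical point
`0` and gradients `F lam` that are Lipschitz and strongly monotone on `E₀ᗮ` up to the sign of the
splitting `E₀ᗮ = Ep ⊕ Em`; displacements `e` in `E₀` enter the monotonicity as a controlled
error. -/
structure IsSaddleFamily {Λ : Type*} [TopologicalSpace Λ] (C : Set Λ) (E₀ Ep Em : Submodule ℝ H)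
    [E₀.HasOrthogonalProjection] [Ep.HasOrthogonalProjection] [Em.HasOrthogonalProjection]
    (f : Λ → H → ℝ) (F : Λ → H → H) (R a M : ℝ) : Prop extends
    IsOrthogonalSplitting E₀ Ep Em where
  radius_pos : 0 < R
  const_pos : 0 < a
  const_le : a ≤ M
  grad : ∀ lam ∈ C, ∀ x, ‖x‖ < R → HasGradientAt (f lam) (F lam x) x
  cont_f : ContinuousOn (fun p : Λ × H => f p.1 p.2) (C ×ˢ Metric.ball 0 R)
  cont_F : ContinuousOn (fun p : Λ × H => F p.1 p.2) (C ×ˢ Metric.ball 0 R)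
  crit : ∀ lam ∈ C, F lam 0 = 0
  lip : ∀ lam ∈ C, ∀ x y, ‖x‖ < R → ‖y‖ < R → ‖F lam y - F lam x‖ ≤ M * ‖y - x‖
  mono : ∀ lam ∈ C, ∀ x y, ‖x‖ < R → ‖y‖ < R → ∀ e ∈ E₀, ∀ d ∈ E₀ᗮ, y - x = e + d →
    a * ‖d‖ ^ 2 - a * (‖e‖ * ‖d‖) ≤ ⟪F lam y - F lam x, signProj Ep Em d⟫

/-- A symmetric operator that is positive definite on `Ep`, negative definite on `Em` and small on
`E₀` satisfies the infinitesimal form of the monotonicity of a saddle family. -/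
theorem IsOrthogonalSplitting.form_signProj_ge {E₀ Ep Em : Submodule ℝ H}
    [E₀.HasOrthogonalProjection] [Ep.HasOrthogonalProjection] [Em.HasOrthogonalProjection]
    (h : IsOrthogonalSplitting E₀ Ep Em) {A : H →L[ℝ] H} (hA : IsSelfAdjoint A) {a : ℝ}
    (hpos : ∀ u ∈ Ep, a * ‖u‖ ^ 2 ≤ ⟪A u, u⟫) (hneg : ∀ u ∈ Em, ⟪A u, u⟫ ≤ -a * ‖u‖ ^ 2)
    (hnull : ∀ e ∈ E₀, ‖A e‖ ≤ a * ‖e‖) {e d : H} (he : e ∈ E₀) (hd : d ∈ E₀ᗮ) :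
    a * ‖d‖ ^ 2 - a * (‖e‖ * ‖d‖) ≤ ⟪A (e + d), signProj Ep Em d⟫ := by
  set u := Ep.starProjection d with hu
  set v := Em.starProjection d with hv
  have h1 : ⟪A d, signProj Ep Em d⟫ = ⟪A u, u⟫ - ⟪A v, v⟫ := by
    have h2 : ⟪A u, v⟫ = ⟪A v, u⟫ := by
      rw [hA.isSymmetric.apply_clm, real_inner_comm]
    have h3 : signProj Ep Em d = u - v := rfl
    rw [h3, h.eq_add_of_mem hd, ← hu, ← hv, map_add, inner_add_left, inner_sub_right,
      inner_sub_right, h2]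
    ring
  have h4 : -(a * (‖e‖ * ‖d‖)) ≤ ⟪A e, signProj Ep Em d⟫ := by
    have h5 := (abs_le.1 (abs_real_inner_le_norm (A e) (signProj Ep Em d))).1
    have h6 : ‖A e‖ * ‖signProj Ep Em d‖ ≤ (a * ‖e‖) * ‖d‖ := by
      gcongr
      · exact (norm_nonneg _).trans (hnull e he)
      · exact hnull e he
      · exact h.norm_signProj_le d
    linarith
  have h7 := hpos u (Submodule.starProjection_apply_mem _ _)
  have h8 := hneg v (Submodule.starProjection_apply_mem _ _)
  rw [map_add, inner_add_left, h1, h.norm_sq_eq hd, ← hu, ← hv]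
  linarith

end SaddleFamilies

/-! ### The perturbed functionals form a saddle family -/

section Perturbed

variable {H : Type*} [NormedAddCommGroup H] [InnerProductSpace ℝ H] [CompleteSpace H]

theorem isOrthogonalSplitting_of_isSelfAdjoint {A : H →L[ℝ] H} (hA : IsSelfAdjoint A)
    [(nullSpace A).HasOrthogonalProjection] [(posSpace A).HasOrthogonalProjection]
    [(negSpace A).HasOrthogonalProjection] :
    IsOrthogonalSplitting (nullSpace A) (posSpace A) (negSpace A) := by
  have h0m : nullSpace A ⟂ negSpace A := Submodule.isOrtho_iff_inner_eq.2 fun x hx y hy =>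
    inner_eq_zero_of_mem_nullSpace_negSpace hA.isSymmetric hx hy
  have hsup : nullSpace A ⊔ negSpace A ⟂ posSpace A := Submodule.isOrtho_orthogonal_right _
  have h0p : nullSpace A ⟂ posSpace A := hsup.mono_left le_sup_left
  have hmp : negSpace A ⟂ posSpace A := hsup.mono_left le_sup_right
  refine ⟨fun x => ?_, h0p, h0m, hmp.symm⟩
  set w := x - (nullSpace A).starProjection x - (negSpace A).starProjection x with hw
  have hwp : w ∈ posSpace A := by
    rw [posSpace, ← Submodule.inf_orthogonal]
    constructor
    · exact Submodule.sub_mem _ (Submodule.sub_starProjection_mem_orthogonal x)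
        (h0m.symm (Submodule.starProjection_apply_mem _ _))
    · rw [hw, sub_right_comm]
      exact Submodule.sub_mem _ (Submodule.sub_starProjection_mem_orthogonal x)
        (h0m (Submodule.starProjection_apply_mem _ _))
  have h1 : (posSpace A).starProjection x = w := by
    have h2 : x = (nullSpace A).starProjection x + (negSpace A).starProjection x + w := by
      rw [hw]; abel
    conv_lhs => rw [h2]
    rw [map_add, map_add,
      starProjection_eq_zero_of_isOrtho h0p (Submodule.starProjection_apply_mem _ _),
      starProjection_eq_zero_of_isOrtho hmp (Submodule.starProjection_apply_mem _ _),
      Submodule.starProjection_eq_self_iff.2 hwp, zero_add, zero_add]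
  rw [h1, hw]; abel

/-- The gradient of the perturbed functional. -/
noncomputable def perturbedGradient {n : ℕ} (L : H → ℝ) (G : Fin n → H → ℝ) (lam : Fin n → ℝ)
    (u : H) : H := gradient L u + ∑ j, lam j • gradient (G j) u

theorem hasGradientAt_of_contDiffOn {V : Set H} (hV : IsOpen V) {L : H → ℝ}
    (hL : ContDiffOn ℝ 1 L V) {x : H} (hx : x ∈ V) : HasGradientAt L (gradient L x) x :=
  ((hL.contDiffAt (hV.mem_nhds hx)).differentiableAt one_ne_zero).hasGradientAt

theorem continuousOn_gradient {V : Set H} (hV : IsOpen V) {L : H → ℝ}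
    (hL : ContDiffOn ℝ 1 L V) : ContinuousOn (gradient L) V :=
  (InnerProductSpace.toDual ℝ H).symm.continuous.comp_continuousOn
    (hL.continuousOn_fderiv_of_isOpen hV le_rfl)

theorem abs_le_of_mem_paramCube {n : ℕ} {δ : ℝ} {lam : Fin n → ℝ} (h : lam ∈ paramCube n δ)
    (j : Fin n) : |lam j| ≤ δ := abs_le.2 ⟨h.1 j, h.2 j⟩

theorem hasGradientAt_perturbed {V : Set H} (hV : IsOpen V) {L : H → ℝ} (hL : ContDiffOn ℝ 1 L V)
    {n : ℕ} {G : Fin n → H → ℝ} (hG : ∀ j, ContDiffOn ℝ 1 (G j) V) (lam : Fin n → ℝ) {x : H}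
    (hx : x ∈ V) : HasGradientAt (perturbed L G lam) (perturbedGradient L G lam x) x := by
  have h1 := (hasGradientAt_of_contDiffOn hV hL hx).hasFDerivAt
  have h2 := fun j => ((hasGradientAt_of_contDiffOn hV (hG j) hx).hasFDerivAt).const_mul (lam j)
  rw [hasGradientAt_iff_hasFDerivAt, perturbedGradient, map_add, map_sum]
  refine (h1.add (HasFDerivAt.fun_sum fun j (_ : j ∈ Finset.univ) => h2 j)).congr_fderiv ?_
  simp

theorem SplittingHypothesis.exists_isSaddleFamily {V : Set H} {L : H → ℝ} {B P Q : H → H →L[ℝ] H}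
    (hL : SplittingHypothesis ⊤ V L B P Q) {n : ℕ} {G : Fin n → H → ℝ}
    {G₂ : Fin n → H → H →L[ℝ] H} (hG : ∀ j, PerturbationHypothesis V (G j) (G₂ j))
    [(nullSpace (B 0)).HasOrthogonalProjection] [(posSpace (B 0)).HasOrthogonalProjection]
    [(negSpace (B 0)).HasOrthogonalProjection] {ρ : ℝ} (hρ : 0 < ρ) :
    ∃ δ ∈ Ioo 0 ρ, ∃ R a M : ℝ, IsSaddleFamily (paramCube n δ) (nullSpace (B 0)) (posSpace (B 0))
      (negSpace (B 0)) (perturbed L G) (perturbedGradient L G) R a M ∧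
      Metric.ball 0 R ⊆ V := by
  have := hL.finiteDimensional_nullSpace
  have := hL.finiteDimensional_negSpace
  have hsplit := isOrthogonalSplitting_of_isSelfAdjoint hL.isSelfAdjoint_B_zero
  obtain ⟨a₁, ha₁, hpos⟩ := hL.eventually_form_posSpace
  obtain ⟨a₂, ha₂, hneg⟩ := exists_form_le_of_mem_negSpace hL.isSelfAdjoint_B_zero.isSymmetric
  obtain ⟨M₁, hM₁⟩ := hL.eventually_norm_B_le
  set a := min a₁ a₂ with ha
  have ha0 : 0 < a := lt_min ha₁ ha₂
  set M₂ := ∑ j, ‖G₂ j 0‖ with hM₂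
  have hM₂0 : 0 ≤ M₂ := Finset.sum_nonneg fun _ _ => norm_nonneg _
  have hG₂ : ∀ᶠ x in 𝓝 (0 : H), ∑ j, ‖G₂ j x‖ < M₂ + 1 := by
    have h1 : Tendsto (fun x => ∑ j, ‖G₂ j x‖) (𝓝 0) (𝓝 M₂) :=
      tendsto_finsetSum _ fun j _ =>
        (((hG j).continuous_at_zero.continuousAt hL.mem_nhds).norm)
    exact h1.eventually_lt_const (lt_add_one _)
  set δ := min (ρ / 2) (a / (4 * (M₂ + 1))) with hδ
  have hδ0 : 0 < δ := by positivity
  have hδρ : δ < ρ := (min_le_left _ _).trans_lt (by linarith)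
  have hδa : δ * (M₂ + 1) ≤ a / 4 := by
    calc δ * (M₂ + 1) ≤ a / (4 * (M₂ + 1)) * (M₂ + 1) := by gcongr; exact min_le_right _ _
      _ = a / 4 := by field_simp
  have hev := (((hpos.and hM₁).and hG₂).and hL.mem_nhds).and
    ((eventually_norm_sub_apply_le_of_finiteDimensional hL.tendsto_B (nullSpace (B 0))
      (show 0 < a / 4 by positivity)).and
    (eventually_norm_sub_apply_le_of_finiteDimensional hL.tendsto_B (negSpace (B 0))
      (show 0 < a / 4 by positivity)))
  obtain ⟨R, hR, hball⟩ := Metric.eventually_nhds_iff_ball.1 hev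
  have hV : Metric.ball 0 R ⊆ V := fun x hx => (hball x hx).1.2
  -- the second derivative of the perturbed functional
  set A : (Fin n → ℝ) → H → H →L[ℝ] H := fun lam x => B x + ∑ j, lam j • G₂ j x with hA
  have hsmall : ∀ lam ∈ paramCube n δ, ∀ x ∈ Metric.ball (0 : H) R,
      ‖∑ j, lam j • G₂ j x‖ ≤ a / 4 := by
    intro lam hlam x hx
    calc ‖∑ j, lam j • G₂ j x‖ ≤ ∑ j, δ * ‖G₂ j x‖ := by
          refine norm_sum_le_of_le _ fun j _ => ?_
          rw [norm_smul]
          gcongr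
          exact abs_le_of_mem_paramCube hlam j
      _ = δ * ∑ j, ‖G₂ j x‖ := by rw [Finset.mul_sum]
      _ ≤ δ * (M₂ + 1) := by gcongr; exact (hball x hx).1.1.2.le
      _ ≤ a / 4 := hδa
  have hsmall' : ∀ lam ∈ paramCube n δ, ∀ x ∈ Metric.ball (0 : H) R, ∀ u,
      ‖(∑ j, lam j • G₂ j x) u‖ ≤ a / 4 * ‖u‖ := fun lam hlam x hx u =>
    ContinuousLinearMap.le_of_opNorm_le _ (hsmall lam hlam x hx) u
  have hsmall'' : ∀ lam ∈ paramCube n δ, ∀ x ∈ Metric.ball (0 : H) R, ∀ u,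
      |⟪(∑ j, lam j • G₂ j x) u, u⟫| ≤ a / 4 * ‖u‖ ^ 2 := fun lam hlam x hx u => by
    refine (abs_real_inner_le_norm _ _).trans ?_
    rw [sq, ← mul_assoc]
    gcongr
    exact hsmall' lam hlam x hx u
  have hAsymm : ∀ lam, ∀ x ∈ Metric.ball (0 : H) R, IsSelfAdjoint (A lam x) := by
    intro lam x hx
    refine (hL.selfAdjoint_B x ⟨hV hx, trivial⟩).add ?_
    exact isSelfAdjoint_sum _ fun j _ =>
      (IsSelfAdjoint.all (lam j)).smul ((hG j).selfAdjoint x (hV hx))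
  have hApos : ∀ lam ∈ paramCube n δ, ∀ x ∈ Metric.ball (0 : H) R, ∀ u ∈ posSpace (B 0),
      a / 2 * ‖u‖ ^ 2 ≤ ⟪A lam x u, u⟫ := by
    intro lam hlam x hx u hu
    have h1 := (hball x hx).1.1.1.1 u hu
    have h2 := (abs_le.1 (hsmall'' lam hlam x hx u)).1
    have h3 : a * ‖u‖ ^ 2 ≤ a₁ * ‖u‖ ^ 2 := by gcongr; exact min_le_left _ _
    rw [hA, add_apply, inner_add_left]
    nlinarith [sq_nonneg ‖u‖]
  have hAneg : ∀ lam ∈ paramCube n δ, ∀ x ∈ Metric.ball (0 : H) R, ∀ u ∈ negSpace (B 0),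
      ⟪A lam x u, u⟫ ≤ -(a / 2) * ‖u‖ ^ 2 := by
    intro lam hlam x hx u hu
    have h1 := hneg u hu
    have h2 := (abs_le.1 (hsmall'' lam hlam x hx u)).2
    have h3 : a * ‖u‖ ^ 2 ≤ a₂ * ‖u‖ ^ 2 := by gcongr; exact min_le_right _ _
    have h4 : ⟪B x u - B 0 u, u⟫ ≤ a / 4 * ‖u‖ ^ 2 := by
      refine (real_inner_le_norm _ _).trans ?_
      rw [sq, ← mul_assoc]
      gcongr
      exact (hball x hx).2.2 u hu
    rw [inner_sub_left] at h4
    rw [hA, add_apply, inner_add_left]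
    linarith
  have hAnull : ∀ lam ∈ paramCube n δ, ∀ x ∈ Metric.ball (0 : H) R, ∀ u ∈ nullSpace (B 0),
      ‖A lam x u‖ ≤ a / 2 * ‖u‖ := by
    intro lam hlam x hx u hu
    have h1 := (hball x hx).2.1 u hu
    have h2 : B 0 u = 0 := hu
    rw [h2, sub_zero] at h1
    rw [hA, add_apply]
    refine (norm_add_le _ _).trans ?_
    have h3 := hsmall' lam hlam x hx u
    linarith
  have hgat : ∀ lam, ∀ x, ‖x‖ < R → HasGateauxDerivAt (perturbedGradient L G lam) (A lam x) x := by
    intro lam x hx v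
    have hxV : x ∈ V := hV (by simpa using hx)
    have h1 := hL.gateaux x ⟨hxV, trivial⟩ v
    have h2 := fun j => (hG j).gateaux x hxV v
    unfold HasLineDerivAt at h1 h2 ⊢
    have h3 := h1.add (HasDerivAt.fun_sum fun j (_ : j ∈ Finset.univ) => (h2 j).const_smul (lam j))
    refine h3.congr_deriv ?_
    simp [hA]
  have hmem : ∀ {x : H}, ‖x‖ < R → x ∈ Metric.ball (0 : H) R := fun hx => by simpa using hx
  refine ⟨δ, ⟨hδ0, hδρ⟩, R, a / 2, max (a / 2) (M₁ + a / 4),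
    ⟨hsplit, hR, by positivity, le_max_left _ _, fun lam _ x hx => ?_, ?_, ?_, fun lam _ => ?_,
      fun lam hlam x y hx hy => ?_, fun lam hlam x y hx hy e he d hd hxy => ?_⟩, hV⟩
  · exact hasGradientAt_perturbed hL.isOpen hL.contDiffOn (fun j => (hG j).contDiffOn) lam
      (hV (hmem hx))
  · have hmaps : MapsTo (fun p : (Fin n → ℝ) × H => p.2) (paramCube n δ ×ˢ Metric.ball 0 R) V :=
      fun p hp => hV hp.2
    refine (hL.contDiffOn.continuousOn.comp continuousOn_snd hmaps).add
      (continuousOn_finsetSum _ fun j _ => ContinuousOn.mul ?_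
        ((hG j).contDiffOn.continuousOn.comp continuousOn_snd hmaps))
    fun_prop
  · have hmaps : MapsTo (fun p : (Fin n → ℝ) × H => p.2) (paramCube n δ ×ˢ Metric.ball 0 R) V :=
      fun p hp => hV hp.2
    refine ((continuousOn_gradient hL.isOpen hL.contDiffOn).comp continuousOn_snd hmaps).add
      (continuousOn_finsetSum _ fun j _ => ContinuousOn.smul ?_
        ((continuousOn_gradient hL.isOpen (hG j).contDiffOn).comp continuousOn_snd hmaps))
    fun_prop
  · have h1 : gradient L 0 = 0 := by simp [gradient, hL.critical]
    have h2 : ∀ j, gradient (G j) 0 = 0 := fun j => by simp [gradient, (hG j).critical]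
    simp [perturbedGradient, h1, h2]
  · set w := perturbedGradient L G lam y - perturbedGradient L G lam x with hw
    obtain ⟨ξ, hξ, hξe⟩ := exists_inner_sub_eq_of_gateaux (hgat lam) hx hy w
    rw [← hw, real_inner_self_eq_norm_sq] at hξe
    have h1 : ‖A lam ξ‖ ≤ max (a / 2) (M₁ + a / 4) :=
      ((norm_add_le _ _).trans (add_le_add (hball ξ (hmem hξ)).1.1.1.2
        (hsmall lam hlam ξ (hmem hξ)))).trans (le_max_right _ _)
    have h2 := real_inner_le_norm (A lam ξ (y - x)) w
    rw [← hξe, sq] at h2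
    refine le_trans ?_ (ContinuousLinearMap.le_of_opNorm_le _ h1 (y - x))
    rcases (norm_nonneg w).eq_or_lt with h0 | h0
    · rw [← h0]; exact norm_nonneg _
    · exact le_of_mul_le_mul_right h2 h0
  · obtain ⟨ξ, hξ, hξe⟩ := exists_inner_sub_eq_of_gateaux (hgat lam) hx hy
      (signProj (posSpace (B 0)) (negSpace (B 0)) d)
    rw [hξe, hxy]
    exact hsplit.form_signProj_ge (hAsymm lam ξ (hmem hξ)) (hApos lam hlam ξ (hmem hξ))
      (hAneg lam hlam ξ (hmem hξ)) (hAnull lam hlam ξ (hmem hξ)) he hd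

end Perturbed

/-! ### Lyapunov–Schmidt reduction of a saddle family -/

section Reduction

variable {H : Type*} [NormedAddCommGroup H] [InnerProductSpace ℝ H] [CompleteSpace H]
  {Λ : Type*} [TopologicalSpace Λ]

/-- `ψ lam z` is the unique solution in `E₀ᗮ` near `0` of the equation saying that the component in
`E₀ᗮ` of the gradient `F lam` vanishes at `z + ψ lam z`. -/
structure IsReduction (C : Set Λ) (E₀ Ep Em : Submodule ℝ H) [Ep.HasOrthogonalProjection]
    [Em.HasOrthogonalProjection] (F : Λ → H → H) (R r ε : ℝ) (ψ : Λ → H → H) : Prop where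
  cont : ContinuousOn (fun p : Λ × H => ψ p.1 p.2) (C ×ˢ subBall E₀ ε)
  mem : ∀ lam ∈ C, ∀ z ∈ subBall E₀ ε, ψ lam z ∈ E₀ᗮ
  norm_lt : ∀ lam ∈ C, ∀ z ∈ subBall E₀ ε, ‖ψ lam z‖ < r
  eqn : ∀ lam ∈ C, ∀ z ∈ subBall E₀ ε, signProj Ep Em (F lam (z + ψ lam z)) = 0
  unique : ∀ lam ∈ C, ∀ z ∈ subBall E₀ ε, ∀ u ∈ E₀ᗮ, ‖u‖ ≤ R / 4 →
    signProj Ep Em (F lam (z + u)) = 0 → u = ψ lam z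
  map_zero : ∀ lam ∈ C, ψ lam 0 = 0
  lipschitz : ∀ lam ∈ C, ∀ z₁ ∈ subBall E₀ ε, ∀ z₂ ∈ subBall E₀ ε,
    ‖ψ lam z₁ - ψ lam z₂‖ ≤ ‖z₁ - z₂‖

variable {C : Set Λ} {E₀ Ep Em : Submodule ℝ H} [E₀.HasOrthogonalProjection]
  [Ep.HasOrthogonalProjection] [Em.HasOrthogonalProjection] {f : Λ → H → ℝ} {F : Λ → H → H}
  {R a M r ε : ℝ}

theorem IsSaddleFamily.bound_pos (h : IsSaddleFamily C E₀ Ep Em f F R a M) : 0 < M :=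
  h.const_pos.trans_le h.const_le

theorem IsSaddleFamily.exists_isReduction (h : IsSaddleFamily C E₀ Ep Em f F R a M)
    (hrR : r ≤ R / 8) (hε : 0 < ε) (hεR : ε ≤ R / 8) (hεr : M * ε ≤ a * r) :
    ∃ ψ : Λ → H → H, IsReduction C E₀ Ep Em F R r ε ψ := by
  have hR := h.radius_pos
  have ha := h.const_pos
  have hM := h.bound_pos
  have hlt : ∀ z u : H, ‖z‖ < ε → ‖u‖ ≤ R / 4 → ‖z + u‖ < R := fun z u hz hu =>
    (norm_add_le z u).trans_lt (by linarith)
  have h0R : ‖(0 : H)‖ < R := by simpa using hR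
  have hT0 : ∀ lam ∈ C, ∀ z : H, ‖z‖ < ε → ‖signProj Ep Em (F lam z)‖ ≤ M * ‖z‖ := by
    intro lam hlam z hz
    refine (h.norm_signProj_le _).trans ?_
    have h1 := h.lip lam hlam 0 z h0R (by linarith)
    rwa [h.crit lam hlam, sub_zero, sub_zero] at h1
  have hdiff : ∀ lam ∈ C, ∀ x y, ‖x‖ < R → ‖y‖ < R → ∀ e ∈ E₀, ∀ d ∈ E₀ᗮ, y - x = e + d →
      a * ‖d‖ ^ 2 - a * (‖e‖ * ‖d‖) ≤
        ⟪signProj Ep Em (F lam y) - signProj Ep Em (F lam x), d⟫ := by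
    intro lam hlam x y hx hy e he d hd hxy
    rw [← map_sub, IsOrthogonalSplitting.inner_signProj]
    exact h.mono lam hlam x y hx hy e he d hd hxy
  obtain ⟨ψ, hψc, hψ⟩ := exists_continuousOn_zero (S := C ×ˢ subBall E₀ ε) (K := E₀ᗮ)
    (T := fun p u => signProj Ep Em (F p.1 (p.2 + u))) (ρ := R / 4) (a := a) (M := M)
    (Submodule.isClosed_orthogonal E₀) (by positivity) ha h.const_le
    (fun p _ u _ _ => h.signProj_mem _)
    (by
      rintro ⟨lam, z⟩ ⟨hlam, hz, hzε⟩ u hu v hv hu' hv'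
      rw [← map_sub]
      refine (h.norm_signProj_le _).trans ?_
      simpa using h.lip lam hlam _ _ (hlt z v hzε hv') (hlt z u hzε hu'))
    (by
      rintro ⟨lam, z⟩ ⟨hlam, hz, hzε⟩ u hu v hv hu' hv'
      have h1 := hdiff lam hlam _ _ (hlt z v hzε hv') (hlt z u hzε hu') 0 E₀.zero_mem (u - v)
        (Submodule.sub_mem _ hu hv) (by abel)
      simpa using h1)
    (by
      rintro ⟨lam, z⟩ ⟨hlam, hz, hzε⟩
      simp only [add_zero]
      refine (hT0 lam hlam z hzε).trans ?_
      have h1 : M * ‖z‖ ≤ M * ε := by gcongr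
      have h2 : a * r ≤ a * (R / 8) := by gcongr
      linarith)
    (by
      intro u hu hu'
      refine (signProj Ep Em).continuous.comp_continuousOn (h.cont_F.comp (f := fun p : Λ × H =>
        (p.1, p.2 + u)) (by fun_prop) ?_)
      rintro ⟨lam, z⟩ ⟨hlam, hz, hzε⟩
      exact ⟨hlam, by simpa using hlt z u hzε hu'⟩)
  have hball : ∀ lam ∈ C, ∀ z ∈ subBall E₀ ε, (lam, z) ∈ C ×ˢ subBall E₀ ε :=
    fun lam hlam z hz => ⟨hlam, hz⟩
  refine ⟨fun lam z => ψ (lam, z), hψc, fun lam hlam z hz => (hψ _ (hball lam hlam z hz)).1,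
    fun lam hlam z hz => ?_, fun lam hlam z hz => ?_, fun lam hlam z hz u hu hu' h0 => ?_,
    fun lam hlam => ?_, fun lam hlam z₁ hz₁ z₂ hz₂ => ?_⟩
  · obtain ⟨-, -, h1, -⟩ := hψ _ (hball lam hlam z hz)
    simp only [add_zero] at h1
    have h2 := hT0 lam hlam z hz.2
    have h3 : M * ‖z‖ < M * ε := mul_lt_mul_of_pos_left hz.2 hM
    exact lt_of_mul_lt_mul_left (by linarith) ha.le
  · obtain ⟨h1, h2, -, h3⟩ := hψ _ (hball lam hlam z hz)
    exact (h3 _ h1 h2).2 rfl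
  · obtain ⟨-, -, -, h3⟩ := hψ _ (hball lam hlam z hz)
    exact (h3 u hu hu').1 h0
  · have hz : (0 : H) ∈ subBall E₀ ε := ⟨E₀.zero_mem, by simpa using hε⟩
    obtain ⟨-, -, -, h3⟩ := hψ _ (hball lam hlam 0 hz)
    refine ((h3 0 (Submodule.zero_mem _) (by simpa using by positivity)).1 ?_).symm
    simp [h.crit lam hlam]
  · obtain ⟨hm1, hn1, -, he1⟩ := hψ _ (hball lam hlam z₁ hz₁)
    obtain ⟨hm2, hn2, -, he2⟩ := hψ _ (hball lam hlam z₂ hz₂)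
    have h1 := hdiff lam hlam (z₂ + ψ (lam, z₂)) (z₁ + ψ (lam, z₁)) (hlt _ _ hz₂.2 hn2)
      (hlt _ _ hz₁.2 hn1) (z₁ - z₂) (E₀.sub_mem hz₁.1 hz₂.1) (ψ (lam, z₁) - ψ (lam, z₂))
      (Submodule.sub_mem _ hm1 hm2) (by abel)
    rw [(he1 _ hm1 hn1).2 rfl, (he2 _ hm2 hn2).2 rfl, sub_zero, inner_zero_left] at h1
    set t := ‖ψ (lam, z₁) - ψ (lam, z₂)‖ with ht
    rcases (norm_nonneg (ψ (lam, z₁) - ψ (lam, z₂))).eq_or_lt with h0 | h0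
    · simp only [← ht] at h0 ⊢
      rw [← h0]; exact norm_nonneg _
    · refine le_of_mul_le_mul_right ?_ (mul_pos ha h0)
      rw [← ht] at h0 ⊢
      linarith

namespace IsReduction

variable {ψ : Λ → H → H}

omit [CompleteSpace H] in
/-- At `z + ψ lam z` the gradient is orthogonal to `E₀ᗮ`. -/
theorem inner_eq_zero (hψ : IsReduction C E₀ Ep Em F R r ε ψ)
    (h : IsOrthogonalSplitting E₀ Ep Em) {lam : Λ} (hlam : lam ∈ C) {z : H}
    (hz : z ∈ subBall E₀ ε) {d : H} (hd : d ∈ E₀ᗮ) : ⟪F lam (z + ψ lam z), d⟫ = 0 := by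
  have h1 := h.orthogonal_starProjection_eq_zero_iff.2 (hψ.eqn lam hlam z hz)
  rw [← Submodule.starProjection_eq_self_iff.2 hd, ← Submodule.inner_starProjection_left_eq_right,
    h1, inner_zero_left]

omit [CompleteSpace H] [E₀.HasOrthogonalProjection] in
theorem norm_add_lt (hψ : IsReduction C E₀ Ep Em F R r ε ψ) (hrR : r ≤ R / 8) (hεR : ε ≤ R / 8)
    {lam : Λ} (hlam : lam ∈ C) {z : H} (hz : z ∈ subBall E₀ ε) : ‖z + ψ lam z‖ < R / 4 := by
  have h1 := hψ.norm_lt lam hlam z hz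
  have h2 := hz.2
  exact (norm_add_le _ _).trans_lt (by linarith)

/-- The derivative of the reduced functional: the contribution of the derivative of `ψ lam`, which
need not exist, is absorbed because the gradient is orthogonal to the increments of `ψ lam`. -/
theorem hasFDerivAt (hψ : IsReduction C E₀ Ep Em F R r ε ψ)
    (h : IsSaddleFamily C E₀ Ep Em f F R a M) (hrR : r ≤ R / 8) (hεR : ε ≤ R / 8)
    {lam : Λ} (hlam : lam ∈ C) {z : E₀} (hz : z ∈ Metric.ball (0 : E₀) ε) :
    HasFDerivAt (fun w : E₀ => f lam ((w : H) + ψ lam w))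
      ((InnerProductSpace.toDual ℝ H (F lam ((z : H) + ψ lam z))).comp E₀.subtypeL) z := by
  have hmem : ∀ w ∈ Metric.ball (0 : E₀) ε, (w : H) ∈ subBall E₀ ε := fun w hw =>
    ⟨w.2, by simpa using hw⟩
  have hzb := hmem z hz
  have hnear : ∀ᶠ w in 𝓝 z, w ∈ Metric.ball (0 : E₀) ε := Metric.isOpen_ball.mem_nhds hz
  have hR := h.radius_pos
  have hf := (h.grad lam hlam _ ((hψ.norm_add_lt hrR hεR hlam hzb).trans (by linarith))).hasFDerivAt
  have hO : (fun w : E₀ => ((w : H) + ψ lam w) - ((z : H) + ψ lam z)) =O[𝓝 z] fun w => w - z := by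
    refine Asymptotics.IsBigO.of_bound 2 ?_
    filter_upwards [hnear] with w hw
    have h1 := hψ.lipschitz lam hlam w (hmem w hw) z hzb
    have h2 : ((w : H) + ψ lam w) - ((z : H) + ψ lam z) = ((w : H) - z) + (ψ lam w - ψ lam z) := by
      abel
    have h3 : ‖w - z‖ = ‖(w : H) - z‖ := rfl
    rw [h2, h3]
    refine (norm_add_le _ _).trans ?_
    linarith
  have htend : Tendsto (fun w : E₀ => (w : H) + ψ lam w) (𝓝 z) (𝓝 ((z : H) + ψ lam z)) := by
    rw [tendsto_iff_norm_sub_tendsto_zero, ← tendsto_zero_iff_norm_tendsto_zero]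
    refine hO.trans_tendsto ?_
    have : Continuous fun w : E₀ => w - z := by fun_prop
    simpa using this.tendsto z
  refine .of_isLittleO (((hf.isLittleO.comp_tendsto htend).trans_isBigO hO).congr' ?_ .rfl)
  filter_upwards [hnear] with w hw
  have h1 := hψ.inner_eq_zero h.toIsOrthogonalSplitting hlam hzb
    (Submodule.sub_mem _ (hψ.mem lam hlam w (hmem w hw)) (hψ.mem lam hlam z hzb))
  have h2 : ((w : H) + ψ lam w) - ((z : H) + ψ lam z) = ((w : H) - z) + (ψ lam w - ψ lam z) := by
    abel
  simp only [Function.comp, h2, InnerProductSpace.toDual_apply_apply, inner_add_right, h1, add_zero]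
  rfl

end IsReduction

end Reduction

/-! ### Convexity along segments -/

section Segments

variable {H : Type*} [NormedAddCommGroup H] [InnerProductSpace ℝ H] [CompleteSpace H]

theorem hasDerivAt_along_segment {f : H → ℝ} {F : H → H} {x d : H} {t : ℝ}
    (hf : HasGradientAt f (F (x + t • d)) (x + t • d)) :
    HasDerivAt (fun t : ℝ => f (x + t • d)) ⟪F (x + t • d), d⟫ t := by
  have h1 : HasDerivAt (fun t : ℝ => x + t • d) d t := by
    simpa using ((hasDerivAt_id t).smul_const d).const_add x
  have h2 := hf.hasFDerivAt.comp_hasDerivAt t h1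
  rw [InnerProductSpace.toDual_apply_apply] at h2
  exact h2

theorem le_of_gradient_mono {f : H → ℝ} {F : H → H} {x d : H} {m : ℝ}
    (hf : ∀ t ∈ Icc (0 : ℝ) 1, HasGradientAt f (F (x + t • d)) (x + t • d))
    (hm : ∀ s ∈ Icc (0 : ℝ) 1, ∀ t ∈ Icc (0 : ℝ) 1, s ≤ t →
      m * (t - s) ≤ ⟪F (x + t • d) - F (x + s • d), d⟫) :
    f x + ⟪F x, d⟫ + m / 2 ≤ f (x + d) := by
  set k : ℝ → ℝ := fun t => f (x + t • d) - (⟪F x, d⟫ * t + m * (t ^ 2 / 2)) with hk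
  have hkd : ∀ t ∈ Icc (0 : ℝ) 1, HasDerivAt k (⟪F (x + t • d), d⟫ - (⟪F x, d⟫ + m * t)) t := by
    intro t ht
    have h1 := hasDerivAt_along_segment (hf t ht)
    have h2 : HasDerivAt (fun t : ℝ => ⟪F x, d⟫ * t + m * (t ^ 2 / 2)) (⟪F x, d⟫ + m * t) t := by
      have h3 := ((hasDerivAt_id t).const_mul ⟪F x, d⟫).add
        ((((hasDerivAt_id t).pow 2).div_const 2).const_mul m)
      refine h3.congr_deriv ?_
      simp
    exact h1.sub h2
  have hmono : MonotoneOn k (Icc 0 1) := by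
    refine monotoneOn_of_deriv_nonneg (convex_Icc 0 1)
      (fun t ht => (hkd t ht).continuousAt.continuousWithinAt) (fun t ht => ?_) fun t ht => ?_
    · exact (hkd t (interior_subset ht)).differentiableAt.differentiableWithinAt
    · have ht' := interior_subset ht
      rw [(hkd t ht').deriv]
      have h1 := hm 0 ⟨le_rfl, zero_le_one⟩ t ht' ht'.1
      rw [zero_smul, add_zero, inner_sub_left, sub_zero] at h1
      linarith
  have h1 := hmono (left_mem_Icc.2 zero_le_one) (right_mem_Icc.2 zero_le_one) zero_le_one
  simp only [hk, zero_smul, add_zero, one_smul] at h1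
  norm_num at h1
  linarith

theorem le_combination_of_gradient_mono {f : H → ℝ} {F : H → H} {x d : H}
    (hf : ∀ t ∈ Icc (0 : ℝ) 1, HasGradientAt f (F (x + t • d)) (x + t • d))
    (hm : ∀ s ∈ Icc (0 : ℝ) 1, ∀ t ∈ Icc (0 : ℝ) 1, s ≤ t →
      0 ≤ ⟪F (x + t • d) - F (x + s • d), d⟫) {t : ℝ} (ht : t ∈ Icc (0 : ℝ) 1) :
    f (x + t • d) ≤ (1 - t) * f x + t * f (x + d) := by
  have hkd := fun t ht => hasDerivAt_along_segment (hf t ht)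
  have hconv : ConvexOn ℝ (Icc (0 : ℝ) 1) fun t : ℝ => f (x + t • d) := by
    refine MonotoneOn.convexOn_of_deriv (convex_Icc 0 1)
      (fun t ht => (hkd t ht).continuousAt.continuousWithinAt)
      (fun t ht => (hkd t (interior_subset ht)).differentiableAt.differentiableWithinAt) ?_
    intro s hs t ht hst
    rw [(hkd s (interior_subset hs)).deriv, (hkd t (interior_subset ht)).deriv]
    have h1 := hm s (interior_subset hs) t (interior_subset ht) hst
    rwa [inner_sub_left, sub_nonneg] at h1
  have h1 := hconv.2 (left_mem_Icc.2 zero_le_one) (right_mem_Icc.2 zero_le_one)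
    (sub_nonneg.2 ht.2) ht.1 (by ring)
  simpa using h1

end Segments

/-! ### Families with a strict saddle point at the origin -/

section CenteredSaddles

variable {H : Type*} [NormedAddCommGroup H] [InnerProductSpace ℝ H] [CompleteSpace H]
  {X : Type*} [TopologicalSpace X]

/-- A family of `C¹` functionals on the ball of radius `R` that vanish at `0`, are critical there in
the directions of `Ep` and `Em`, and are strongly convex along `Ep` and strongly concave along
`Em`. -/
structure IsCenteredSaddle (S : Set X) (Ep Em : Submodule ℝ H) (f : X → H → ℝ) (F : X → H → H)
    (R a M : ℝ) : Prop where
  ortho : Ep ⟂ Em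
  radius_pos : 0 < R
  const_pos : 0 < a
  const_le : a ≤ M
  grad : ∀ p ∈ S, ∀ x, ‖x‖ < R → HasGradientAt (f p) (F p x) x
  cont_f : ContinuousOn (fun q : X × H => f q.1 q.2) (S ×ˢ Metric.ball 0 R)
  cont_F : ContinuousOn (fun q : X × H => F q.1 q.2) (S ×ˢ Metric.ball 0 R)
  map_zero : ∀ p ∈ S, f p 0 = 0
  crit_pos : ∀ p ∈ S, ∀ u ∈ Ep, ⟪F p 0, u⟫ = 0
  crit_neg : ∀ p ∈ S, ∀ v ∈ Em, ⟪F p 0, v⟫ = 0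
  lip : ∀ p ∈ S, ∀ x y, ‖x‖ < R → ‖y‖ < R → ‖F p y - F p x‖ ≤ M * ‖y - x‖
  mono_pos : ∀ p ∈ S, ∀ x y, ‖x‖ < R → ‖y‖ < R → y - x ∈ Ep →
    a * ‖y - x‖ ^ 2 ≤ ⟪F p y - F p x, y - x⟫
  mono_neg : ∀ p ∈ S, ∀ x y, ‖x‖ < R → ‖y‖ < R → y - x ∈ Em →
    ⟪F p y - F p x, y - x⟫ ≤ -(a * ‖y - x‖ ^ 2)

namespace IsCenteredSaddle

variable {S : Set X} {Ep Em : Submodule ℝ H} {f : X → H → ℝ} {F : X → H → H} {R a M : ℝ}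

omit [CompleteSpace H] in
theorem norm_segment_lt {x d : H} (hx : ‖x‖ < R) (hxd : ‖x + d‖ < R) {t : ℝ}
    (ht : t ∈ Icc (0 : ℝ) 1) : ‖x + t • d‖ < R := by
  have h1 := (convex_ball (0 : H) R).add_smul_mem (x := x) (y := d) (by simpa using hx)
    (by simpa using hxd) ht
  simpa using h1

theorem mono_pos_segment (h : IsCenteredSaddle S Ep Em f F R a M) {p : X} (hp : p ∈ S) {x d : H}
    (hx : ‖x‖ < R) (hxd : ‖x + d‖ < R) (hd : d ∈ Ep) {s t : ℝ} (hs : s ∈ Icc (0 : ℝ) 1)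
    (ht : t ∈ Icc (0 : ℝ) 1) (hst : s ≤ t) :
    a * ‖d‖ ^ 2 * (t - s) ≤ ⟪F p (x + t • d) - F p (x + s • d), d⟫ := by
  have h1 : (x + t • d) - (x + s • d) = (t - s) • d := by module
  have h2 := h.mono_pos p hp (x + s • d) (x + t • d) (norm_segment_lt hx hxd hs)
    (norm_segment_lt hx hxd ht) (h1 ▸ Ep.smul_mem _ hd)
  rw [h1, norm_smul, real_inner_smul_right, mul_pow, Real.norm_eq_abs, sq_abs] at h2
  rcases (sub_nonneg.2 hst).eq_or_lt with h0 | h0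
  · have : s = t := by linarith
    subst this
    simp
  · refine le_of_mul_le_mul_left ?_ h0
    linarith

theorem mono_neg_segment (h : IsCenteredSaddle S Ep Em f F R a M) {p : X} (hp : p ∈ S) {x d : H}
    (hx : ‖x‖ < R) (hxd : ‖x + d‖ < R) (hd : d ∈ Em) {s t : ℝ} (hs : s ∈ Icc (0 : ℝ) 1)
    (ht : t ∈ Icc (0 : ℝ) 1) (hst : s ≤ t) :
    a * ‖d‖ ^ 2 * (t - s) ≤ ⟪-F p (x + t • d) - -F p (x + s • d), d⟫ := by
  have h1 : (x + t • d) - (x + s • d) = (t - s) • d := by module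
  have h2 := h.mono_neg p hp (x + s • d) (x + t • d) (norm_segment_lt hx hxd hs)
    (norm_segment_lt hx hxd ht) (h1 ▸ Em.smul_mem _ hd)
  rw [h1, norm_smul, real_inner_smul_right, mul_pow, Real.norm_eq_abs, sq_abs] at h2
  have h3 : -F p (x + t • d) - -F p (x + s • d) = -(F p (x + t • d) - F p (x + s • d)) := by abel
  rw [h3, inner_neg_left]
  rcases (sub_nonneg.2 hst).eq_or_lt with h0 | h0
  · have : s = t := by linarith
    subst this
    simp
  · refine le_of_mul_le_mul_left ?_ h0
    linarith

theorem grad_segment (h : IsCenteredSaddle S Ep Em f F R a M) {p : X} (hp : p ∈ S) {x d : H}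
    (hx : ‖x‖ < R) (hxd : ‖x + d‖ < R) :
    ∀ t ∈ Icc (0 : ℝ) 1, HasGradientAt (f p) (F p (x + t • d)) (x + t • d) :=
  fun _ ht => h.grad p hp _ (norm_segment_lt hx hxd ht)

theorem grad_neg_segment (h : IsCenteredSaddle S Ep Em f F R a M) {p : X} (hp : p ∈ S) {x d : H}
    (hx : ‖x‖ < R) (hxd : ‖x + d‖ < R) : ∀ t ∈ Icc (0 : ℝ) 1,
    HasGradientAt (fun y => -f p y) ((fun y => -F p y) (x + t • d)) (x + t • d) := fun t ht => by
  have h1 := (h.grad_segment hp hx hxd t ht).hasFDerivAt.neg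
  rw [hasGradientAt_iff_hasFDerivAt, map_neg]
  exact h1

theorem lower_pos (h : IsCenteredSaddle S Ep Em f F R a M) {p : X} (hp : p ∈ S) {x d : H}
    (hx : ‖x‖ < R) (hxd : ‖x + d‖ < R) (hd : d ∈ Ep) :
    f p x + ⟪F p x, d⟫ + a / 2 * ‖d‖ ^ 2 ≤ f p (x + d) := by
  have h1 := le_of_gradient_mono (h.grad_segment hp hx hxd)
    (fun s hs t ht hst => h.mono_pos_segment hp hx hxd hd hs ht hst)
  linarith

theorem upper_neg (h : IsCenteredSaddle S Ep Em f F R a M) {p : X} (hp : p ∈ S) {x d : H}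
    (hx : ‖x‖ < R) (hxd : ‖x + d‖ < R) (hd : d ∈ Em) :
    f p (x + d) ≤ f p x + ⟪F p x, d⟫ - a / 2 * ‖d‖ ^ 2 := by
  have h1 := le_of_gradient_mono (f := fun y => -f p y) (F := fun y => -F p y)
    (h.grad_neg_segment hp hx hxd)
    (fun s hs t ht hst => h.mono_neg_segment hp hx hxd hd hs ht hst)
  simp only [inner_neg_left] at h1
  linarith

theorem convex_pos (h : IsCenteredSaddle S Ep Em f F R a M) {p : X} (hp : p ∈ S) {x d : H}
    (hx : ‖x‖ < R) (hxd : ‖x + d‖ < R) (hd : d ∈ Ep) {t : ℝ} (ht : t ∈ Icc (0 : ℝ) 1) :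
    f p (x + t • d) ≤ (1 - t) * f p x + t * f p (x + d) := by
  refine le_combination_of_gradient_mono (h.grad_segment hp hx hxd) (fun s hs t ht hst => ?_) ht
  refine le_trans ?_ (h.mono_pos_segment hp hx hxd hd hs ht hst)
  have := h.const_pos
  have := sub_nonneg.2 hst
  positivity

theorem concave_neg (h : IsCenteredSaddle S Ep Em f F R a M) {p : X} (hp : p ∈ S) {x d : H}
    (hx : ‖x‖ < R) (hxd : ‖x + d‖ < R) (hd : d ∈ Em) {t : ℝ} (ht : t ∈ Icc (0 : ℝ) 1) :
    (1 - t) * f p x + t * f p (x + d) ≤ f p (x + t • d) := by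
  have h1 := le_combination_of_gradient_mono (f := fun y => -f p y) (F := fun y => -F p y)
    (h.grad_neg_segment hp hx hxd)
    (fun s hs t ht hst => ?_) ht
  · linarith
  refine le_trans ?_ (h.mono_neg_segment hp hx hxd hd hs ht hst)
  have := h.const_pos
  have := sub_nonneg.2 hst
  positivity

end IsCenteredSaddle

/-- `φ (p, u)` is the critical point, and hence the maximum point, of `v ↦ f p (u + v)` on the ball
of radius `R / 4` of `Em`, for `u` in the ball of radius `R₁` of `Ep`. -/
structure IsRidge (S : Set X) (Ep Em : Submodule ℝ H) [Em.HasOrthogonalProjection] (F : X → H → H)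
    (R R₁ : ℝ) (φ : X × H → H) : Prop where
  cont : ContinuousOn φ (S ×ˢ subBall Ep R₁)
  mem : ∀ p ∈ S, ∀ u ∈ subBall Ep R₁, φ (p, u) ∈ Em
  norm_le : ∀ p ∈ S, ∀ u ∈ subBall Ep R₁, ‖φ (p, u)‖ ≤ R / 4
  eqn : ∀ p ∈ S, ∀ u ∈ subBall Ep R₁, Em.starProjection (F p (u + φ (p, u))) = 0
  unique : ∀ p ∈ S, ∀ u ∈ subBall Ep R₁, ∀ v ∈ Em, ‖v‖ ≤ R / 4 →
    Em.starProjection (F p (u + v)) = 0 → v = φ (p, u)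
  map_zero : ∀ p ∈ S, φ (p, 0) = 0

namespace IsRidge

variable {S : Set X} {Ep Em : Submodule ℝ H} [Em.HasOrthogonalProjection] {F : X → H → H}
  {R R₁ : ℝ} {φ : X × H → H}

omit [CompleteSpace H] in
theorem norm_lt (hφ : IsRidge S Ep Em F R R₁ φ) (hR₁R : R₁ ≤ R / 4) {p : X} (hp : p ∈ S) {u : H}
    (hu : u ∈ subBall Ep R₁) : ‖u + φ (p, u)‖ < R / 2 := by
  have h1 := hφ.norm_le p hp u hu
  have h2 := hu.2
  exact (norm_add_le _ _).trans_lt (by linarith)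

omit [CompleteSpace H] in
theorem inner_eq_zero (hφ : IsRidge S Ep Em F R R₁ φ) {p : X} (hp : p ∈ S) {u : H}
    (hu : u ∈ subBall Ep R₁) {v : H} (hv : v ∈ Em) : ⟪F p (u + φ (p, u)), v⟫ = 0 := by
  rw [← Submodule.starProjection_eq_self_iff.2 hv, ← Submodule.inner_starProjection_left_eq_right,
    hφ.eqn p hp u hu, inner_zero_left]

end IsRidge

/-- The maximum of `f p` on the fibre over `u`. -/
def ridgeEnergy (f : X → H → ℝ) (φ : X × H → H) (p : X) (u : H) : ℝ := f p (u + φ (p, u))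

/-- The drop of `f p` below its maximum on the fibre over `u`, at distance `v` from the maximum
point; here `q = (p, u)`. -/
def fibreDrop (f : X → H → ℝ) (φ : X × H → H) (q : X × H) (v : H) : ℝ :=
  f q.1 (q.2 + φ q) - f q.1 (q.2 + φ q + v)

namespace IsCenteredSaddle

variable {S : Set X} {Ep Em : Submodule ℝ H} {f : X → H → ℝ} {F : X → H → H} {R a M R₁ : ℝ}

theorem exists_isRidge [Em.HasOrthogonalProjection] (h : IsCenteredSaddle S Ep Em f F R a M)
    (hR₁ : 0 < R₁) (hR₁R : R₁ ≤ R / 4) (hR₁M : M * R₁ ≤ a * R / 8) :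
    ∃ φ : X × H → H, IsRidge S Ep Em F R R₁ φ := by
  have hR := h.radius_pos
  have ha := h.const_pos
  have hM : 0 < M := ha.trans_le h.const_le
  have hlt : ∀ u v : H, ‖u‖ < R₁ → ‖v‖ ≤ R / 4 → ‖u + v‖ < R := fun u v hu hv =>
    (norm_add_le u v).trans_lt (by linarith)
  have hF0 : ∀ p ∈ S, Em.starProjection (F p 0) = 0 := fun p hp =>
    (Submodule.starProjection_apply_eq_zero_iff _).2
      ((Submodule.mem_orthogonal' _ _).2 fun v hv => h.crit_neg p hp v hv)
  obtain ⟨φ, hφc, hφ⟩ := exists_continuousOn_zero (S := S ×ˢ subBall Ep R₁) (K := Em)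
    (T := fun q v => -Em.starProjection (F q.1 (q.2 + v))) (ρ := R / 4) (a := a) (M := M)
    (Em.orthogonal_orthogonal ▸ Submodule.isClosed_orthogonal Emᗮ) (by positivity) ha h.const_le
    (fun q _ v _ _ => Em.neg_mem (Submodule.starProjection_apply_mem _ _))
    (by
      rintro ⟨p, u⟩ ⟨hp, hu, huR⟩ v hv w hw hv' hw'
      rw [neg_sub_neg, ← map_sub, norm_sub_rev v w]
      refine (Submodule.norm_starProjection_apply_le _ _).trans ?_
      simpa using h.lip p hp _ _ (hlt u v huR hv') (hlt u w huR hw'))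
    (by
      rintro ⟨p, u⟩ ⟨hp, hu, huR⟩ v hv w hw hv' hw'
      have hvw := Em.sub_mem hv hw
      have h1 := h.mono_neg p hp (u + w) (u + v) (hlt u w huR hw') (hlt u v huR hv')
        (by simpa using hvw)
      rw [add_sub_add_left_eq_sub] at h1
      rw [neg_sub_neg, ← map_sub, Submodule.inner_starProjection_left_eq_right,
        Submodule.starProjection_eq_self_iff.2 hvw, ← neg_sub (F p (u + v)), inner_neg_left]
      linarith)
    (by
      rintro ⟨p, u⟩ ⟨hp, hu, huR⟩
      simp only [add_zero, norm_neg]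
      have h1 := h.lip p hp 0 u (by simpa using hR) (by linarith)
      have h2 : Em.starProjection (F p u) = Em.starProjection (F p u - F p 0) := by
        rw [map_sub, hF0 p hp, sub_zero]
      rw [h2]
      refine (Submodule.norm_starProjection_apply_le _ _).trans (h1.trans ?_)
      rw [sub_zero]
      have h3 : M * ‖u‖ ≤ M * R₁ := by gcongr
      linarith)
    (by
      intro v hv hv'
      refine (Em.starProjection.continuous.comp_continuousOn (h.cont_F.comp (f := fun q : X × H =>
        (q.1, q.2 + v)) (by fun_prop) ?_)).neg
      rintro ⟨p, u⟩ ⟨hp, hu, huR⟩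
      exact ⟨hp, by simpa using hlt u v huR hv'⟩)
  refine ⟨φ, hφc, fun p hp u hu => (hφ (p, u) ⟨hp, hu⟩).1,
    fun p hp u hu => (hφ (p, u) ⟨hp, hu⟩).2.1,
    fun p hp u hu => ?_, fun p hp u hu v hv hv' h0 => ?_, fun p hp => ?_⟩
  · obtain ⟨h1, h2, -, h3⟩ := hφ (p, u) ⟨hp, hu⟩
    exact neg_eq_zero.1 ((h3 _ h1 h2).2 rfl)
  · obtain ⟨-, -, -, h3⟩ := hφ (p, u) ⟨hp, hu⟩
    exact (h3 v hv hv').1 (neg_eq_zero.2 h0)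
  · obtain ⟨-, -, -, h3⟩ := hφ (p, 0) ⟨hp, Ep.zero_mem, by simpa using hR₁⟩
    refine ((h3 0 Em.zero_mem (by simpa using by positivity)).1 ?_).symm
    simp [hF0 p hp]

variable [Em.HasOrthogonalProjection] {φ : X × H → H}

theorem fibreDrop_ge (h : IsCenteredSaddle S Ep Em f F R a M) (hφ : IsRidge S Ep Em F R R₁ φ)
    (hR₁R : R₁ ≤ R / 4) {p : X} (hp : p ∈ S) {u : H} (hu : u ∈ subBall Ep R₁) {v : H} (hv : v ∈ Em)
    (hvR : ‖v‖ ≤ R / 2) : a / 2 * ‖v‖ ^ 2 ≤ fibreDrop f φ (p, u) v := by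
  have h1 := hφ.norm_lt hR₁R hp hu
  have h2 := h.upper_neg hp (x := u + φ (p, u)) (d := v) (by linarith [h.radius_pos])
    ((norm_add_le _ _).trans_lt (by linarith)) hv
  rw [hφ.inner_eq_zero hp hu hv] at h2
  simp only [fibreDrop]
  linarith

theorem le_ridgeEnergy (h : IsCenteredSaddle S Ep Em f F R a M) (hφ : IsRidge S Ep Em F R R₁ φ)
    (hR₁R : R₁ ≤ R / 4) {p : X} (hp : p ∈ S) {u : H} (hu : u ∈ subBall Ep R₁) {v : H} (hv : v ∈ Em)
    (hvR : ‖v‖ ≤ R / 4) : f p (u + v) ≤ ridgeEnergy f φ p u := by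
  have h1 := h.fibreDrop_ge hφ hR₁R hp hu (v := v - φ (p, u)) (Em.sub_mem hv (hφ.mem p hp u hu))
    ((norm_sub_le _ _).trans (by linarith [hφ.norm_le p hp u hu]))
  have h2 : u + φ (p, u) + (v - φ (p, u)) = u + v := by abel
  simp only [fibreDrop, h2] at h1
  simp only [ridgeEnergy]
  have := h.const_pos
  have : 0 ≤ a / 2 * ‖v - φ (p, u)‖ ^ 2 := by positivity
  linarith

theorem isRadialFamily_ridgeEnergy (h : IsCenteredSaddle S Ep Em f F R a M)
    (hφ : IsRidge S Ep Em F R R₁ φ) (hR₁ : 0 < R₁) (hR₁R : R₁ ≤ R / 4) :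
    IsRadialFamily S Ep R₁ (a / 2) (ridgeEnergy f φ) := by
  have hR := h.radius_pos
  have ha := h.const_pos
  have hzero : ∀ p ∈ S, ridgeEnergy f φ p 0 = 0 := fun p hp => by
    simp [ridgeEnergy, hφ.map_zero p hp, h.map_zero p hp]
  refine ⟨hR₁, by positivity, ?_, hzero, fun p hp u hu huR => ?_, fun p hp u hu huR t ht => ?_⟩
  · refine h.cont_f.comp (f := fun q : X × H => (q.1, q.2 + φ q))
      (continuousOn_fst.prodMk (continuousOn_snd.add hφ.cont)) ?_
    rintro ⟨p, u⟩ ⟨hp, hu⟩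
    have := hφ.norm_lt hR₁R hp hu
    exact ⟨hp, by simpa using this.trans (by linarith)⟩
  · have h1 := h.le_ridgeEnergy hφ hR₁R hp ⟨hu, huR⟩ Em.zero_mem (by simpa using by positivity)
    have h2 := h.lower_pos hp (x := 0) (d := u) (by simpa using hR)
      (by simpa using huR.trans_le (by linarith)) hu
    rw [h.map_zero p hp, h.crit_pos p hp u hu, zero_add, zero_add, zero_add] at h2
    rw [add_zero] at h1
    linarith
  · have htu : t • u ∈ subBall Ep R₁ := by
      refine ⟨Ep.smul_mem _ hu, ?_⟩
      rw [norm_smul, Real.norm_of_nonneg ht.1]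
      exact (mul_le_of_le_one_left (norm_nonneg _) ht.2).trans_lt huR
    -- compare with the values over `0` and over `u` at the same height `v`
    set v := φ (p, t • u) with hv
    have hvm : v ∈ Em := hφ.mem p hp _ htu
    have hvR : ‖v‖ ≤ R / 4 := hφ.norm_le p hp _ htu
    have h1 := h.convex_pos hp (x := v) (d := u) (by linarith)
      ((norm_add_le _ _).trans_lt (by linarith)) hu ht
    have h2 := h.le_ridgeEnergy hφ hR₁R hp (u := 0) ⟨Ep.zero_mem, by simpa using hR₁⟩ hvm hvR
    have h3 := h.le_ridgeEnergy hφ hR₁R hp ⟨hu, huR⟩ hvm hvR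
    rw [hzero p hp, zero_add] at h2
    have h4 : ridgeEnergy f φ p (t • u) = f p (v + t • u) := by rw [ridgeEnergy, ← hv, add_comm]
    rw [h4]
    rw [add_comm u v] at h3
    have h5 : (1 - t) * f p v ≤ 0 := mul_nonpos_of_nonneg_of_nonpos (sub_nonneg.2 ht.2) h2
    have h6 : t * f p (v + u) ≤ t * ridgeEnergy f φ p u := mul_le_mul_of_nonneg_left h3 ht.1
    linarith

theorem isRadialFamily_fibreDrop (h : IsCenteredSaddle S Ep Em f F R a M)
    (hφ : IsRidge S Ep Em F R R₁ φ) (hR₁R : R₁ ≤ R / 4) :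
    IsRadialFamily (S ×ˢ subBall Ep R₁) Em (R / 4) (a / 2) (fibreDrop f φ) := by
  have hR := h.radius_pos
  have ha := h.const_pos
  have hlt : ∀ p ∈ S, ∀ u ∈ subBall Ep R₁, ∀ v : H, ‖v‖ < R / 4 → ‖u + φ (p, u) + v‖ < R := by
    intro p hp u hu v hv
    have := hφ.norm_lt hR₁R hp hu
    exact (norm_add_le _ _).trans_lt (by linarith)
  refine ⟨by positivity, by positivity, ?_, fun q hq => by simp [fibreDrop], ?_, ?_⟩
  · have hφ' : ContinuousOn (fun q : (X × H) × H => φ q.1)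
        ((S ×ˢ subBall Ep R₁) ×ˢ subBall Em (R / 4)) :=
      hφ.cont.comp continuousOn_fst fun q hq => hq.1
    have hx : ContinuousOn (fun q : (X × H) × H => q.1.2 + φ q.1)
        ((S ×ˢ subBall Ep R₁) ×ˢ subBall Em (R / 4)) :=
      (continuous_snd.comp continuous_fst).continuousOn.add hφ'
    have hp' : ContinuousOn (fun q : (X × H) × H => q.1.1)
        ((S ×ˢ subBall Ep R₁) ×ˢ subBall Em (R / 4)) :=
      (continuous_fst.comp continuous_fst).continuousOn
    have hc1 := h.cont_f.comp (hp'.prodMk hx) (by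
      rintro ⟨⟨p, u⟩, v⟩ ⟨⟨hp, hu⟩, hv⟩
      exact ⟨hp, by simpa using hlt p hp u hu 0 (by simpa using hR)⟩)
    have hc2 := h.cont_f.comp (hp'.prodMk (hx.add continuousOn_snd)) (by
      rintro ⟨⟨p, u⟩, v⟩ ⟨⟨hp, hu⟩, hv⟩
      exact ⟨hp, by simpa using hlt p hp u hu v hv.2⟩)
    exact hc1.sub hc2
  · rintro ⟨p, u⟩ ⟨hp, hu⟩ v hv hvR
    exact h.fibreDrop_ge hφ hR₁R hp hu hv (by linarith)
  · rintro ⟨p, u⟩ ⟨hp, hu⟩ v hv hvR t ht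
    have h1 := h.concave_neg hp (x := u + φ (p, u)) (d := v)
      (by simpa using hlt p hp u hu 0 (by simpa using hR)) (hlt p hp u hu v hvR) hv ht
    simp only [fibreDrop]
    linarith

end IsCenteredSaddle

end CenteredSaddles

/-! ### The Morse map of a family of saddles -/

section MorseMap

theorem exists_isOpen_inter_lt {X : Type*} [TopologicalSpace X] {D A : Set X}
    (hA : ∃ O, IsOpen O ∧ A = D ∩ O) {f : X → ℝ} (hf : ContinuousOn f A) (b : ℝ) :
    ∃ O, IsOpen O ∧ {x | x ∈ A ∧ f x < b} = D ∩ O := by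
  obtain ⟨O, hO, rfl⟩ := hA
  obtain ⟨U, hU, hUeq⟩ := continuousOn_iff'.1 hf (Iio b) isOpen_Iio
  refine ⟨O ∩ U, hO.inter hU, ?_⟩
  ext x
  have h1 := Set.ext_iff.1 hUeq x
  simp only [mem_inter_iff, mem_preimage, mem_Iio, mem_ofPred_eq] at h1 ⊢
  tauto

theorem exists_homeomorph_of_continuousOn {X Y : Type*} [TopologicalSpace X] [TopologicalSpace Y]
    {s : Set X} {t : Set Y} {f : X → Y} {g : Y → X} (hf : ContinuousOn f s) (hg : ContinuousOn g t)
    (hfs : MapsTo f s t) (hgt : MapsTo g t s) (hl : ∀ x ∈ s, g (f x) = x)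
    (hr : ∀ y ∈ t, f (g y) = y) : ∃ e : s ≃ₜ t, ∀ p, (e p : Y) = f p :=
  ⟨{ toFun := hfs.restrict f s t
     invFun := hgt.restrict g t s
     left_inv := fun x => Subtype.ext (hl x x.2)
     right_inv := fun y => Subtype.ext (hr y y.2)
     continuous_toFun := hf.mapsToRestrict hfs
     continuous_invFun := hg.mapsToRestrict hgt }, fun _ => rfl⟩

variable {H : Type*} [NormedAddCommGroup H] [InnerProductSpace ℝ H] [CompleteSpace H]
  {X : Type*} [TopologicalSpace X]

/-- The sum of the open balls of radii `r` and `s` in `Ep` and `Em`. -/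
def ballSum (Ep Em : Submodule ℝ H) (r s : ℝ) : Set H :=
  {u | ∃ up ∈ Ep, ∃ um ∈ Em, ‖up‖ < r ∧ ‖um‖ < s ∧ u = up + um}

/-- A family of centred saddles together with its ridge `φ` and the inverses `ξ₁`, `ξ₂` of the
radial square roots of the ridge energy and of the fibre drop. -/
structure IsMorseData (S : Set X) (Ep Em : Submodule ℝ H) [Em.HasOrthogonalProjection]
    (f : X → H → ℝ) (F : X → H → H) (R R₁ a M : ℝ) (φ : X × H → H) (ξ₁ : X → H → H)
    (ξ₂ : X × H → H → H) : Prop where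
  radius_pos : 0 < R₁
  radius_le : R₁ ≤ R / 4
  saddle : IsCenteredSaddle S Ep Em f F R a M
  ridge : IsRidge S Ep Em F R R₁ φ
  inv_ridge : IsRadialInverse S Ep R₁ (a / 2) (ridgeEnergy f φ) ξ₁
  inv_drop : IsRadialInverse (S ×ˢ subBall Ep R₁) Em (R / 4) (a / 2) (fibreDrop f φ) ξ₂

theorem IsCenteredSaddle.exists_isMorseData {S : Set X} {Ep Em : Submodule ℝ H}
    [Em.HasOrthogonalProjection] {f : X → H → ℝ} {F : X → H → H} {R R₁ a M : ℝ}
    (h : IsCenteredSaddle S Ep Em f F R a M) (hR₁ : 0 < R₁) (hR₁R : R₁ ≤ R / 4)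
    (hR₁M : M * R₁ ≤ a * R / 8) :
    ∃ φ ξ₁ ξ₂, IsMorseData S Ep Em f F R R₁ a M φ ξ₁ ξ₂ := by
  obtain ⟨φ, hφ⟩ := h.exists_isRidge hR₁ hR₁R hR₁M
  obtain ⟨ξ₁, h₁⟩ := (h.isRadialFamily_ridgeEnergy hφ hR₁ hR₁R).exists_isRadialInverse
  obtain ⟨ξ₂, h₂⟩ := (h.isRadialFamily_fibreDrop hφ hR₁R).exists_isRadialInverse
  exact ⟨φ, ξ₁, ξ₂, hR₁, hR₁R, h, hφ, h₁, h₂⟩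

/-- The chart in which the family takes the form `‖u⁺‖ ^ 2 - ‖u⁻‖ ^ 2`: the component in `Ep`
selects a point of the ridge, the component in `Em` a displacement from it along the fibre. -/
noncomputable def morseMap (Ep Em : Submodule ℝ H) [Ep.HasOrthogonalProjection]
    [Em.HasOrthogonalProjection] (φ : X × H → H) (ξ₁ : X → H → H) (ξ₂ : X × H → H → H) (p : X)
    (u : H) : H :=
  ξ₁ p (Ep.starProjection u) + φ (p, ξ₁ p (Ep.starProjection u)) +
    ξ₂ (p, ξ₁ p (Ep.starProjection u)) (Em.starProjection u)

/-- The displacement of `w` from the ridge along the fibre. -/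
noncomputable def fibrePart (Ep Em : Submodule ℝ H) [Ep.HasOrthogonalProjection]
    [Em.HasOrthogonalProjection] (φ : X × H → H) (p : X) (w : H) : H :=
  Em.starProjection w - φ (p, Ep.starProjection w)

/-- The `Ep`-component of the inverse of `morseMap`. -/
noncomputable def posCoord (Ep : Submodule ℝ H) [Ep.HasOrthogonalProjection] (f : X → H → ℝ)
    (φ : X × H → H) (p : X) (w : H) : H :=
  radialSqrt (ridgeEnergy f φ p) (Ep.starProjection w)

/-- The `Em`-component of the inverse of `morseMap`. -/
noncomputable def negCoord (Ep Em : Submodule ℝ H) [Ep.HasOrthogonalProjection]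
    [Em.HasOrthogonalProjection] (f : X → H → ℝ) (φ : X × H → H) (p : X) (w : H) : H :=
  radialSqrt (fibreDrop f φ (p, Ep.starProjection w)) (fibrePart Ep Em φ p w)

/-- The range of `morseMap` on the sum of the balls of radius `r`. -/
def morseTarget (S : Set X) (Ep Em : Submodule ℝ H) [Ep.HasOrthogonalProjection]
    [Em.HasOrthogonalProjection] (f : X → H → ℝ) (φ : X × H → H) (R R₁ r : ℝ) : Set (X × H) :=
  {q | ((((q ∈ S ×ˢ (univ : Set H) ∧ ‖Ep.starProjection q.2‖ < R₁) ∧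
    ‖fibrePart Ep Em φ q.1 q.2‖ < R / 4) ∧ ‖posCoord Ep f φ q.1 q.2‖ < r) ∧
    ‖negCoord Ep Em f φ q.1 q.2‖ < r)}

omit [CompleteSpace H] in
theorem radialSqrt_mem (g : H → ℝ) {K : Submodule ℝ H} {x : H} (hx : x ∈ K) :
    radialSqrt g x ∈ K := K.smul_mem _ hx

namespace IsMorseData

variable {S : Set X} {Ep Em : Submodule ℝ H} [Ep.HasOrthogonalProjection]
  [Em.HasOrthogonalProjection] {f : X → H → ℝ} {F : X → H → H} {R R₁ a M r : ℝ} {φ : X × H → H}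
  {ξ₁ : X → H → H} {ξ₂ : X × H → H → H}

omit [Ep.HasOrthogonalProjection] in
theorem radial_ridge (h : IsMorseData S Ep Em f F R R₁ a M φ ξ₁ ξ₂) :
    IsRadialFamily S Ep R₁ (a / 2) (ridgeEnergy f φ) :=
  h.saddle.isRadialFamily_ridgeEnergy h.ridge h.radius_pos h.radius_le

omit [Ep.HasOrthogonalProjection] in
theorem radial_drop (h : IsMorseData S Ep Em f F R R₁ a M φ ξ₁ ξ₂) :
    IsRadialFamily (S ×ˢ subBall Ep R₁) Em (R / 4) (a / 2) (fibreDrop f φ) :=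
  h.saddle.isRadialFamily_fibreDrop h.ridge h.radius_le

omit [CompleteSpace H] [Ep.HasOrthogonalProjection] in
theorem pos_mem_subBall (hr : r ≤ √(a / 2) * R₁) {up : H} (hup : up ∈ Ep) (hupr : ‖up‖ < r) :
    up ∈ subBall Ep (√(a / 2) * R₁) := ⟨hup, hupr.trans_le hr⟩

omit [Ep.HasOrthogonalProjection] in
theorem neg_mem_subBall (h : IsMorseData S Ep Em f F R R₁ a M φ ξ₁ ξ₂)
    (hr : r ≤ √(a / 2) * R₁) {um : H} (hum : um ∈ Em) (humr : ‖um‖ < r) :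
    um ∈ subBall Em (√(a / 2) * (R / 4)) :=
  ⟨hum, humr.trans_le (hr.trans (mul_le_mul_of_nonneg_left h.radius_le (Real.sqrt_nonneg _)))⟩

theorem morseMap_add (h : IsMorseData S Ep Em f F R R₁ a M φ ξ₁ ξ₂) (p : X) {up um : H}
    (hup : up ∈ Ep) (hum : um ∈ Em) : morseMap Ep Em φ ξ₁ ξ₂ p (up + um) =
      ξ₁ p up + (φ (p, ξ₁ p up) + ξ₂ (p, ξ₁ p up) um) := by
  rw [morseMap, starProjection_add_left_of_isOrtho h.saddle.ortho hup hum,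
    starProjection_add_right_of_isOrtho h.saddle.ortho hup hum, add_assoc]

/-- The components of `morseMap p (up + um)` and the balls that contain them. -/
theorem morseMap_components (h : IsMorseData S Ep Em f F R R₁ a M φ ξ₁ ξ₂)
    (hr : r ≤ √(a / 2) * R₁) {p : X} (hp : p ∈ S) {up um : H} (hup : up ∈ Ep) (hum : um ∈ Em)
    (hupr : ‖up‖ < r) (humr : ‖um‖ < r) :
    ξ₁ p up ∈ subBall Ep R₁ ∧ φ (p, ξ₁ p up) ∈ Em ∧ ξ₂ (p, ξ₁ p up) um ∈ subBall Em (R / 4) ∧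
    Ep.starProjection (morseMap Ep Em φ ξ₁ ξ₂ p (up + um)) = ξ₁ p up ∧
    Em.starProjection (morseMap Ep Em φ ξ₁ ξ₂ p (up + um)) =
      φ (p, ξ₁ p up) + ξ₂ (p, ξ₁ p up) um ∧
    fibrePart Ep Em φ p (morseMap Ep Em φ ξ₁ ξ₂ p (up + um)) = ξ₂ (p, ξ₁ p up) um := by
  have h1 := h.inv_ridge.mem p hp up (pos_mem_subBall hr hup hupr)
  have h2 := h.ridge.mem p hp _ h1
  have h3 := h.inv_drop.mem (p, ξ₁ p up) ⟨hp, h1⟩ um (h.neg_mem_subBall hr hum humr)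
  have h4 := starProjection_add_left_of_isOrtho h.saddle.ortho h1.1 (Em.add_mem h2 h3.1)
  have h5 := starProjection_add_right_of_isOrtho h.saddle.ortho h1.1 (Em.add_mem h2 h3.1)
  rw [← h.morseMap_add p hup hum] at h4 h5
  exact ⟨h1, h2, h3, h4, h5, by rw [fibrePart, h4, h5, add_sub_cancel_left]⟩

theorem norm_morseMap_lt (h : IsMorseData S Ep Em f F R R₁ a M φ ξ₁ ξ₂)
    (hr : r ≤ √(a / 2) * R₁) {p : X} (hp : p ∈ S) {up um : H} (hup : up ∈ Ep) (hum : um ∈ Em)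
    (hupr : ‖up‖ < r) (humr : ‖um‖ < r) : ‖morseMap Ep Em φ ξ₁ ξ₂ p (up + um)‖ < R := by
  obtain ⟨h1, -, h3, -⟩ := h.morseMap_components hr hp hup hum hupr humr
  have h4 := h.ridge.norm_lt h.radius_le hp h1
  have h5 := h3.2
  have := h.saddle.radius_pos
  rw [h.morseMap_add p hup hum, ← add_assoc]
  exact (norm_add_le _ _).trans_lt (by linarith)

theorem apply_morseMap (h : IsMorseData S Ep Em f F R R₁ a M φ ξ₁ ξ₂)
    (hr : r ≤ √(a / 2) * R₁) {p : X} (hp : p ∈ S) {up um : H} (hup : up ∈ Ep) (hum : um ∈ Em)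
    (hupr : ‖up‖ < r) (humr : ‖um‖ < r) :
    f p (morseMap Ep Em φ ξ₁ ξ₂ p (up + um)) = ‖up‖ ^ 2 - ‖um‖ ^ 2 := by
  obtain ⟨h1, -, h3, -⟩ := h.morseMap_components hr hp hup hum hupr humr
  have h4 := h.radial_ridge.norm_sq_radialSqrt hp h1.1 h1.2
  have h5 := h.radial_drop.norm_sq_radialSqrt (p := (p, ξ₁ p up)) ⟨hp, h1⟩ h3.1 h3.2
  rw [h.inv_ridge.radialSqrt_eq hp (pos_mem_subBall hr hup hupr)] at h4
  rw [h.inv_drop.radialSqrt_eq (p := (p, ξ₁ p up)) ⟨hp, h1⟩ (h.neg_mem_subBall hr hum humr)] at h5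
  rw [h4, h5, h.morseMap_add p hup hum, ← add_assoc]
  simp [ridgeEnergy, fibreDrop]

theorem morseMap_zero (h : IsMorseData S Ep Em f F R R₁ a M φ ξ₁ ξ₂) {p : X} (hp : p ∈ S) :
    morseMap Ep Em φ ξ₁ ξ₂ p 0 = 0 := by
  have hR := h.saddle.radius_pos
  have ha := h.saddle.const_pos
  have h1 := h.inv_ridge.map_zero h.radius_pos (by positivity) hp
  have h2 := h.inv_drop.map_zero (by positivity) (by positivity) (p := (p, 0))
    ⟨hp, Ep.zero_mem, by simpa using h.radius_pos⟩
  simp [morseMap, h1, h2, h.ridge.map_zero p hp]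

theorem morseMap_mem_neg_iff (h : IsMorseData S Ep Em f F R R₁ a M φ ξ₁ ξ₂)
    (hr : r ≤ √(a / 2) * R₁) {p : X} (hp : p ∈ S) {up um : H} (hup : up ∈ Ep) (hum : um ∈ Em)
    (hupr : ‖up‖ < r) (humr : ‖um‖ < r) :
    morseMap Ep Em φ ξ₁ ξ₂ p (up + um) ∈ Em ↔ up + um ∈ Em := by
  obtain ⟨h1, h2, h3, h4, -⟩ := h.morseMap_components hr hp hup hum hupr humr
  have ha := h.saddle.const_pos
  constructor
  · intro hmem
    rw [starProjection_eq_zero_of_isOrtho h.saddle.ortho.symm hmem] at h4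
    have h5 := h.inv_ridge.radialSqrt_eq hp (pos_mem_subBall hr hup hupr)
    rw [← h4] at h5
    have h6 : up = 0 := by rw [← h5]; simp [radialSqrt]
    rw [h6, zero_add]
    exact hum
  · intro hmem
    have h5 := starProjection_add_left_of_isOrtho h.saddle.ortho hup hum
    rw [starProjection_eq_zero_of_isOrtho h.saddle.ortho.symm hmem] at h5
    rw [h.morseMap_add p hup hum, ← h5, h.inv_ridge.map_zero h.radius_pos (by positivity) hp,
      zero_add]
    rw [← h5, h.inv_ridge.map_zero h.radius_pos (by positivity) hp] at h2 h3
    exact Em.add_mem h2 h3.1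

theorem coord_morseMap (h : IsMorseData S Ep Em f F R R₁ a M φ ξ₁ ξ₂)
    (hr : r ≤ √(a / 2) * R₁) {p : X} (hp : p ∈ S) {up um : H} (hup : up ∈ Ep) (hum : um ∈ Em)
    (hupr : ‖up‖ < r) (humr : ‖um‖ < r) :
    posCoord Ep f φ p (morseMap Ep Em φ ξ₁ ξ₂ p (up + um)) = up ∧
      negCoord Ep Em f φ p (morseMap Ep Em φ ξ₁ ξ₂ p (up + um)) = um := by
  obtain ⟨h1, h2, h3, h4, h5, h6⟩ := h.morseMap_components hr hp hup hum hupr humr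
  rw [posCoord, negCoord, h4, h6]
  exact ⟨h.inv_ridge.radialSqrt_eq hp (pos_mem_subBall hr hup hupr),
    h.inv_drop.radialSqrt_eq (p := (p, ξ₁ p up)) ⟨hp, h1⟩ (h.neg_mem_subBall hr hum humr)⟩

theorem morseMap_mem_target (h : IsMorseData S Ep Em f F R R₁ a M φ ξ₁ ξ₂)
    (hr : r ≤ √(a / 2) * R₁) {p : X} (hp : p ∈ S) {up um : H} (hup : up ∈ Ep) (hum : um ∈ Em)
    (hupr : ‖up‖ < r) (humr : ‖um‖ < r) :
    (p, morseMap Ep Em φ ξ₁ ξ₂ p (up + um)) ∈ morseTarget S Ep Em f φ R R₁ r := by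
  obtain ⟨h1, h2, h3, h4, h5, h6⟩ := h.morseMap_components hr hp hup hum hupr humr
  obtain ⟨h7, h8⟩ := h.coord_morseMap hr hp hup hum hupr humr
  refine ⟨⟨⟨⟨⟨hp, mem_univ _⟩, ?_⟩, ?_⟩, ?_⟩, ?_⟩
  · rw [h4]; exact h1.2
  · rw [h6]; exact h3.2
  · rw [h7]; exact hupr
  · rw [h8]; exact humr

theorem coord_mem (h : IsMorseData S Ep Em f F R R₁ a M φ ξ₁ ξ₂) {q : X × H}
    (hq : q ∈ morseTarget S Ep Em f φ R R₁ r) :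
    Ep.starProjection q.2 ∈ subBall Ep R₁ ∧ fibrePart Ep Em φ q.1 q.2 ∈ subBall Em (R / 4) ∧
    posCoord Ep f φ q.1 q.2 ∈ Ep ∧ negCoord Ep Em f φ q.1 q.2 ∈ Em := by
  obtain ⟨⟨⟨⟨⟨hp, -⟩, h1⟩, h2⟩, -⟩, -⟩ := hq
  have h3 : Ep.starProjection q.2 ∈ subBall Ep R₁ := ⟨Submodule.starProjection_apply_mem _ _, h1⟩
  have h4 : fibrePart Ep Em φ q.1 q.2 ∈ Em :=
    Em.sub_mem (Submodule.starProjection_apply_mem _ _) (h.ridge.mem q.1 hp _ h3)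
  exact ⟨h3, ⟨h4, h2⟩, radialSqrt_mem _ h3.1, radialSqrt_mem _ h4⟩

theorem morseMap_coord (h : IsMorseData S Ep Em f F R R₁ a M φ ξ₁ ξ₂)
    (hr : r ≤ √(a / 2) * R₁) {q : X × H} (hq : q ∈ morseTarget S Ep Em f φ R R₁ r) :
    morseMap Ep Em φ ξ₁ ξ₂ q.1 (posCoord Ep f φ q.1 q.2 + negCoord Ep Em f φ q.1 q.2) =
      Ep.starProjection q.2 + Em.starProjection q.2 := by
  obtain ⟨h1, h2, h3, h4⟩ := h.coord_mem hq
  obtain ⟨⟨⟨⟨⟨hp, -⟩, -⟩, -⟩, h5⟩, h6⟩ := hq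
  have h7 := (h.inv_ridge.eq_iff q.1 hp _ (pos_mem_subBall hr h3 h5) _ h1).1 rfl
  have h8 := (h.inv_drop.eq_iff (q.1, Ep.starProjection q.2) ⟨hp, h1⟩ _
    (h.neg_mem_subBall hr h4 h6) _ h2).1 rfl
  rw [h.morseMap_add q.1 h3 h4, ← h7, ← h8, fibrePart]
  abel

theorem continuousOn_morseMap (h : IsMorseData S Ep Em f F R R₁ a M φ ξ₁ ξ₂)
    (hr : r ≤ √(a / 2) * R₁) :
    ContinuousOn (fun q : X × H => morseMap Ep Em φ ξ₁ ξ₂ q.1 q.2) (S ×ˢ ballSum Ep Em r r) := by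
  have hproj : ∀ q ∈ S ×ˢ ballSum Ep Em r r, q.1 ∈ S ∧
      Ep.starProjection q.2 ∈ subBall Ep (√(a / 2) * R₁) ∧
      Em.starProjection q.2 ∈ subBall Em (√(a / 2) * (R / 4)) := by
    rintro ⟨p, u⟩ ⟨hp, up, hup, um, hum, hupr, humr, rfl⟩
    refine ⟨hp, ?_, ?_⟩
    · rw [starProjection_add_left_of_isOrtho h.saddle.ortho hup hum]
      exact pos_mem_subBall hr hup hupr
    · rw [starProjection_add_right_of_isOrtho h.saddle.ortho hup hum]
      exact h.neg_mem_subBall hr hum humr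
  have hEp : ContinuousOn (fun q : X × H => Ep.starProjection q.2) (S ×ˢ ballSum Ep Em r r) := by
    fun_prop
  have hEm : ContinuousOn (fun q : X × H => Em.starProjection q.2) (S ×ˢ ballSum Ep Em r r) := by
    fun_prop
  have h1 : ContinuousOn (fun q : X × H => ξ₁ q.1 (Ep.starProjection q.2))
      (S ×ˢ ballSum Ep Em r r) :=
    h.inv_ridge.cont.comp (continuousOn_fst.prodMk hEp) fun q hq =>
      ⟨(hproj q hq).1, (hproj q hq).2.1⟩
  have hmem : ∀ q ∈ S ×ˢ ballSum Ep Em r r,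
      (q.1, ξ₁ q.1 (Ep.starProjection q.2)) ∈ S ×ˢ subBall Ep R₁ := fun q hq =>
    ⟨(hproj q hq).1, h.inv_ridge.mem q.1 (hproj q hq).1 _ (hproj q hq).2.1⟩
  have h2 := continuousOn_fst.prodMk h1
  exact (h1.add (h.ridge.cont.comp h2 hmem)).add
    (h.inv_drop.cont.comp (h2.prodMk hEm) fun q hq => ⟨hmem q hq, (hproj q hq).2.2⟩)

/-- The range of the Morse map is relatively open and its coordinates are continuous. -/
theorem isOpen_target_and_continuousOn_coord (h : IsMorseData S Ep Em f F R R₁ a M φ ξ₁ ξ₂)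
    (r : ℝ) :
    (∃ O, IsOpen O ∧ morseTarget S Ep Em f φ R R₁ r = S ×ˢ (univ : Set H) ∩ O) ∧
    ContinuousOn (fun q : X × H => posCoord Ep f φ q.1 q.2 + negCoord Ep Em f φ q.1 q.2)
      (morseTarget S Ep Em f φ R R₁ r) := by
  have hEp : Continuous fun q : X × H => Ep.starProjection q.2 := by fun_prop
  have hEm : Continuous fun q : X × H => Em.starProjection q.2 := by fun_prop
  have hA₀ : ∃ O, IsOpen O ∧ (S ×ˢ (univ : Set H)) = S ×ˢ (univ : Set H) ∩ O :=
    ⟨univ, isOpen_univ, (inter_univ _).symm⟩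
  have hA₁ := exists_isOpen_inter_lt hA₀ hEp.norm.continuousOn R₁
  set A₁ := {q : X × H | q ∈ S ×ˢ (univ : Set H) ∧ ‖Ep.starProjection q.2‖ < R₁} with hA₁d
  have hm₁ : ∀ q ∈ A₁, (q.1, Ep.starProjection q.2) ∈ S ×ˢ subBall Ep R₁ := fun q hq =>
    ⟨hq.1.1, Submodule.starProjection_apply_mem _ _, hq.2⟩
  have hc₁ : ContinuousOn (fun q : X × H => (q.1, Ep.starProjection q.2)) A₁ :=
    continuousOn_fst.prodMk hEp.continuousOn
  have hfib : ContinuousOn (fun q : X × H => fibrePart Ep Em φ q.1 q.2) A₁ :=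
    hEm.continuousOn.sub (h.ridge.cont.comp hc₁ hm₁)
  have hA₂ := exists_isOpen_inter_lt hA₁ hfib.norm (R / 4)
  set A₂ := {q : X × H | q ∈ A₁ ∧ ‖fibrePart Ep Em φ q.1 q.2‖ < R / 4} with hA₂d
  have h21 : A₂ ⊆ A₁ := fun q hq => hq.1
  have hm₂ : ∀ q ∈ A₂, ((q.1, Ep.starProjection q.2), fibrePart Ep Em φ q.1 q.2) ∈
      (S ×ˢ subBall Ep R₁) ×ˢ subBall Em (R / 4) := fun q hq =>
    ⟨hm₁ q hq.1, Em.sub_mem (Submodule.starProjection_apply_mem _ _)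
      (h.ridge.mem q.1 hq.1.1.1 _ (hm₁ q hq.1).2), hq.2⟩
  have hpos : ContinuousOn (fun q : X × H => posCoord Ep f φ q.1 q.2) A₂ :=
    h.radial_ridge.continuousOn_radialSqrt.comp (hc₁.mono h21) fun q hq => hm₁ q hq.1
  have hneg : ContinuousOn (fun q : X × H => negCoord Ep Em f φ q.1 q.2) A₂ :=
    h.radial_drop.continuousOn_radialSqrt.comp ((hc₁.mono h21).prodMk (hfib.mono h21)) hm₂
  have hA₃ := exists_isOpen_inter_lt hA₂ hpos.norm r
  set A₃ := {q : X × H | q ∈ A₂ ∧ ‖posCoord Ep f φ q.1 q.2‖ < r} with hA₃d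
  have h32 : A₃ ⊆ A₂ := fun q hq => hq.1
  have hA₄ := exists_isOpen_inter_lt hA₃ (hneg.mono h32).norm r
  exact ⟨hA₄, (hpos.add hneg).mono fun q hq => h32 hq.1⟩

end IsMorseData

/-! ### Equivariance of the Morse map -/

namespace IsMorseData

variable {S : Set X} {Ep Em : Submodule ℝ H} [Ep.HasOrthogonalProjection]
  [Em.HasOrthogonalProjection] {f : X → H → ℝ} {F : X → H → H} {R R₁ a M r : ℝ} {φ : X × H → H}
  {ξ₁ : X → H → H} {ξ₂ : X × H → H → H} {U : H ≃ₗᵢ[ℝ] H} {p p' : X}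

omit [CompleteSpace H] in
theorem radialSqrt_map {g g' : H → ℝ} {x : H} (hg : g' (U x) = g x) :
    radialSqrt g' (U x) = U (radialSqrt g x) := by
  rw [radialSqrt, radialSqrt, hg, U.norm_map, map_smul]

omit [CompleteSpace H] in
theorem map_mem_subBall {K : Submodule ℝ H} (hU : ∀ x ∈ K, U x ∈ K) {t : ℝ} {x : H}
    (hx : x ∈ subBall K t) : U x ∈ subBall K t :=
  ⟨hU x hx.1, by rw [U.norm_map]; exact hx.2⟩

/-- If an isometry carries the member `f p` of the family to `f p'`, it carries the Morse map of the
former to that of the latter, because each ingredient of the Morse map is characterised uniquely. -/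
theorem morseMap_map (h : IsMorseData S Ep Em f F R R₁ a M φ ξ₁ ξ₂)
    (hr : r ≤ √(a / 2) * R₁) (hp : p ∈ S) (hp' : p' ∈ S)
    (hUp : ∀ x ∈ Ep, U x ∈ Ep) (hUm : ∀ x ∈ Em, U x ∈ Em)
    (hproj : ∀ x, Em.starProjection (U x) = U (Em.starProjection x))
    (hf : ∀ x, ‖x‖ < R → f p' (U x) = f p x) (hF : ∀ x, ‖x‖ < R → F p' (U x) = U (F p x))
    {up um : H} (hup : up ∈ Ep) (hum : um ∈ Em) (hupr : ‖up‖ < r) (humr : ‖um‖ < r) :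
    morseMap Ep Em φ ξ₁ ξ₂ p' (U (up + um)) = U (morseMap Ep Em φ ξ₁ ξ₂ p (up + um)) := by
  have hR := h.saddle.radius_pos
  have hφ : ∀ u ∈ subBall Ep R₁, φ (p', U u) = U (φ (p, u)) := by
    intro u hu
    have h1 := h.ridge.norm_lt h.radius_le hp hu
    refine (h.ridge.unique p' hp' (U u) (map_mem_subBall hUp hu) (U (φ (p, u)))
      (hUm _ (h.ridge.mem p hp u hu)) (by rw [U.norm_map]; exact h.ridge.norm_le p hp u hu) ?_).symm
    rw [← map_add, hF _ (h1.trans (by linarith)), hproj, h.ridge.eqn p hp u hu, map_zero]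
  have hξ₁ : ∀ y ∈ subBall Ep (√(a / 2) * R₁), ξ₁ p' (U y) = U (ξ₁ p y) := by
    intro y hy
    have h1 := h.inv_ridge.mem p hp y hy
    refine ((h.inv_ridge.eq_iff p' hp' _ (map_mem_subBall hUp hy) _
      (map_mem_subBall hUp h1)).1 ?_).symm
    rw [radialSqrt_map (g := ridgeEnergy f φ p), h.inv_ridge.radialSqrt_eq hp hy]
    rw [ridgeEnergy, ridgeEnergy, hφ _ h1, ← map_add]
    exact hf _ ((h.ridge.norm_lt h.radius_le hp h1).trans (by linarith))
  have hξ₂ : ∀ u ∈ subBall Ep R₁, ∀ y ∈ subBall Em (√(a / 2) * (R / 4)),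
      ξ₂ (p', U u) (U y) = U (ξ₂ (p, u) y) := by
    intro u hu y hy
    have h1 := h.inv_drop.mem (p, u) ⟨hp, hu⟩ y hy
    have h2 := h.ridge.norm_lt h.radius_le hp hu
    refine ((h.inv_drop.eq_iff (p', U u) ⟨hp', map_mem_subBall hUp hu⟩ _ (map_mem_subBall hUm hy) _
      (map_mem_subBall hUm h1)).1 ?_).symm
    rw [radialSqrt_map (g := fibreDrop f φ (p, u)),
      h.inv_drop.radialSqrt_eq (p := (p, u)) ⟨hp, hu⟩ hy]
    simp only [fibreDrop, hφ u hu]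
    rw [← map_add, ← map_add, hf _ (h2.trans (by linarith)), hf]
    exact (norm_add_le _ _).trans_lt (by linarith [h1.2])
  have hy := pos_mem_subBall hr hup hupr
  have h1 := h.inv_ridge.mem p hp up hy
  rw [map_add, h.morseMap_add p' (hUp up hup) (hUm um hum), h.morseMap_add p hup hum,
    hξ₁ up hy, hφ _ h1, hξ₂ _ h1 _ (h.neg_mem_subBall hr hum humr), map_add, map_add]

end IsMorseData

end MorseMap

/-! ### The splitting homeomorphism -/

section Splitting

variable {H : Type*} [NormedAddCommGroup H] [InnerProductSpace ℝ H] [CompleteSpace H]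
  {Λ : Type*} [TopologicalSpace Λ]

/-- The point `z + ψ lam z` of the reduction, for `p = (lam, z)`. -/
def reductionPoint (ψ : Λ → H → H) (p : Λ × H) : H := p.2 + ψ p.1 p.2

/-- The functional `f lam` seen from the point `reductionPoint ψ p`. -/
def centeredFunctional (f : Λ → H → ℝ) (ψ : Λ → H → H) (p : Λ × H) (x : H) : ℝ :=
  f p.1 (reductionPoint ψ p + x) - f p.1 (reductionPoint ψ p)

/-- The gradient of `centeredFunctional`. -/
def centeredGradient (F : Λ → H → H) (ψ : Λ → H → H) (p : Λ × H) (x : H) : H :=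
  F p.1 (reductionPoint ψ p + x)

variable {C : Set Λ} {E₀ Ep Em : Submodule ℝ H} [E₀.HasOrthogonalProjection]
  [Ep.HasOrthogonalProjection] [Em.HasOrthogonalProjection] {f : Λ → H → ℝ} {F : Λ → H → H}
  {R R₁ a M r ε : ℝ} {ψ : Λ → H → H} {φ : (Λ × H) × H → H} {ξ₁ : Λ × H → H → H}
  {ξ₂ : (Λ × H) × H → H → H}

omit [CompleteSpace H] in
theorem signProj_apply_pos (h : IsOrthogonalSplitting E₀ Ep Em) {d : H} (hd : d ∈ Ep) :
    signProj Ep Em d = d := by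
  rw [signProj, sub_apply, Submodule.starProjection_eq_self_iff.2 hd,
    starProjection_eq_zero_of_isOrtho h.ortho_pos_neg hd, sub_zero]

omit [CompleteSpace H] in
theorem signProj_apply_neg (h : IsOrthogonalSplitting E₀ Ep Em) {d : H} (hd : d ∈ Em) :
    signProj Ep Em d = -d := by
  rw [signProj, sub_apply, Submodule.starProjection_eq_self_iff.2 hd,
    starProjection_eq_zero_of_isOrtho h.ortho_pos_neg.symm hd, zero_sub]

omit [CompleteSpace H] [E₀.HasOrthogonalProjection] in
theorem IsReduction.continuousOn_reductionPoint (hψ : IsReduction C E₀ Ep Em F R r ε ψ) :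
    ContinuousOn (reductionPoint ψ) (C ×ˢ subBall E₀ ε) := continuousOn_snd.add hψ.cont

theorem IsReduction.isCenteredSaddle (hψ : IsReduction C E₀ Ep Em F R r ε ψ)
    (h : IsSaddleFamily C E₀ Ep Em f F R a M) (hrR : r ≤ R / 8) (hεR : ε ≤ R / 8) :
    IsCenteredSaddle (C ×ˢ subBall E₀ ε) Ep Em (centeredFunctional f ψ) (centeredGradient F ψ)
      (3 * R / 4) a M := by
  have hR := h.radius_pos
  have hc : ∀ p ∈ C ×ˢ subBall E₀ ε, ‖reductionPoint ψ p‖ < R / 4 := fun p hp =>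
    hψ.norm_add_lt hrR hεR hp.1 hp.2
  have hlt : ∀ p ∈ C ×ˢ subBall E₀ ε, ∀ x : H, ‖x‖ < 3 * R / 4 → ‖reductionPoint ψ p + x‖ < R :=
    fun p hp x hx => (norm_add_le _ _).trans_lt (by linarith [hc p hp])
  have hinc : ∀ p ∈ C ×ˢ subBall E₀ ε, ∀ x y : H, ‖x‖ < 3 * R / 4 → ‖y‖ < 3 * R / 4 →
      y - x ∈ E₀ᗮ → a * ‖y - x‖ ^ 2 ≤
        ⟪F p.1 (reductionPoint ψ p + y) - F p.1 (reductionPoint ψ p + x),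
          signProj Ep Em (y - x)⟫ := by
    intro p hp x y hx hy hxy
    have h1 := h.mono p.1 hp.1 _ _ (hlt p hp x hx) (hlt p hp y hy) 0 E₀.zero_mem (y - x) hxy
      (by abel)
    simpa using h1
  have hmaps : MapsTo (fun q : (Λ × H) × H => (q.1.1, reductionPoint ψ q.1 + q.2))
      ((C ×ˢ subBall E₀ ε) ×ˢ Metric.ball 0 (3 * R / 4)) (C ×ˢ Metric.ball 0 R) :=
    fun q hq => ⟨hq.1.1, by simpa using hlt q.1 hq.1 q.2 (by simpa using hq.2)⟩
  have hctr : ContinuousOn (fun q : (Λ × H) × H => reductionPoint ψ q.1)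
      ((C ×ˢ subBall E₀ ε) ×ˢ Metric.ball 0 (3 * R / 4)) :=
    hψ.continuousOn_reductionPoint.comp continuousOn_fst fun q hq => hq.1
  have hlam : ContinuousOn (fun q : (Λ × H) × H => q.1.1)
      ((C ×ˢ subBall E₀ ε) ×ˢ Metric.ball 0 (3 * R / 4)) :=
    (continuous_fst.comp continuous_fst).continuousOn
  have hcont := hlam.prodMk (hctr.add continuousOn_snd)
  refine ⟨h.ortho_pos_neg, by positivity, h.const_pos, h.const_le, fun p hp x hx => ?_, ?_, ?_,
    fun p hp => by simp [centeredFunctional], fun p hp u hu => ?_, fun p hp v hv => ?_,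
    fun p hp x y hx hy => ?_, fun p hp x y hx hy hxy => ?_, fun p hp x y hx hy hxy => ?_⟩
  · have h1 := (h.grad p.1 hp.1 _ (hlt p hp x hx)).hasFDerivAt
    rw [hasGradientAt_iff_hasFDerivAt]
    exact ((hasFDerivAt_comp_add_left (reductionPoint ψ p)).2 h1).sub_const _
  · refine (h.cont_f.comp hcont hmaps).sub (h.cont_f.comp (hlam.prodMk hctr) fun q hq => ?_)
    exact ⟨hq.1.1, by simpa using (hc q.1 hq.1).trans (by linarith)⟩
  · exact h.cont_F.comp hcont hmaps
  · simp only [centeredGradient, add_zero]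
    exact hψ.inner_eq_zero h.toIsOrthogonalSplitting hp.1 hp.2 (h.pos_mem hu)
  · simp only [centeredGradient, add_zero]
    exact hψ.inner_eq_zero h.toIsOrthogonalSplitting hp.1 hp.2 (h.neg_mem hv)
  · simpa [centeredGradient] using h.lip p.1 hp.1 _ _ (hlt p hp x hx) (hlt p hp y hy)
  · have h1 := hinc p hp x y hx hy (h.pos_mem hxy)
    rwa [signProj_apply_pos h.toIsOrthogonalSplitting hxy] at h1
  · have h1 := hinc p hp x y hx hy (h.neg_mem hxy)
    rw [signProj_apply_neg h.toIsOrthogonalSplitting hxy, inner_neg_right] at h1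
    simp only [centeredGradient]
    linarith

/-- The splitting map `Φ lam z u`. -/
noncomputable def splittingMap (Ep Em : Submodule ℝ H) [Ep.HasOrthogonalProjection]
    [Em.HasOrthogonalProjection] (ψ : Λ → H → H) (φ : (Λ × H) × H → H) (ξ₁ : Λ × H → H → H)
    (ξ₂ : (Λ × H) × H → H → H) (lam : Λ) (z u : H) : H :=
  z + ψ lam z + morseMap Ep Em φ ξ₁ ξ₂ (lam, z) u

theorem IsMorseData.morseMap_mem_orthogonal
    (hd : IsMorseData (C ×ˢ subBall E₀ ε) Ep Em (centeredFunctional f ψ) (centeredGradient F ψ)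
      (3 * R / 4) R₁ a M φ ξ₁ ξ₂) (h : IsOrthogonalSplitting E₀ Ep Em)
    (hr : r ≤ √(a / 2) * R₁) {p : Λ × H} (hp : p ∈ C ×ˢ subBall E₀ ε) {u : H}
    (hu : u ∈ ballSum Ep Em r r) : morseMap Ep Em φ ξ₁ ξ₂ p u ∈ E₀ᗮ := by
  obtain ⟨up, hup, um, hum, hupr, humr, rfl⟩ := hu
  obtain ⟨h1, h2, h3, -⟩ := hd.morseMap_components hr hp hup hum hupr humr
  rw [hd.morseMap_add p hup hum]
  exact Submodule.add_mem _ (h.pos_mem h1.1) (h.neg_mem (Em.add_mem h2 h3.1))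

theorem IsMorseData.exists_homeomorph
    (hd : IsMorseData (C ×ˢ subBall E₀ ε) Ep Em (centeredFunctional f ψ) (centeredGradient F ψ)
      (3 * R / 4) R₁ a M φ ξ₁ ξ₂) (h : IsOrthogonalSplitting E₀ Ep Em)
    (hψ : IsReduction C E₀ Ep Em F R r ε ψ) (hC : IsCompact C) (hε : 0 < ε) (hr0 : 0 < r)
    (hr : r ≤ √(a / 2) * R₁) (hrR : r ≤ R / 8) (hεR : ε ≤ R / 8) :
    ∃ (O : Set (Λ × H)) (W : Set H), IsOpen O ∧ IsOpen W ∧ (0 : H) ∈ W ∧ C ×ˢ W ⊆ O ∧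
      (∀ lam ∈ C, ∀ w : H, (lam, w) ∈ O → ‖w‖ < R) ∧
      ∃ e : ↥(C ×ˢ (subBall E₀ ε ×ˢ ballSum Ep Em r r)) ≃ₜ ↥((C ×ˢ (univ : Set H)) ∩ O),
        ∀ p, (e p : Λ × H) = (p.1.1, splittingMap Ep Em ψ φ ξ₁ ξ₂ p.1.1 p.1.2.1 p.1.2.2) := by
  set S := C ×ˢ subBall E₀ ε with hS
  -- the coordinates `((lam, z), x)` of a point `(lam, z + ψ lam z + x)`
  set κ : Λ × H → (Λ × H) × H := fun y =>
    ((y.1, E₀.starProjection y.2), y.2 - reductionPoint ψ (y.1, E₀.starProjection y.2)) with hκ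
  set T := morseTarget S Ep Em (centeredFunctional f ψ) φ (3 * R / 4) R₁ r with hT
  obtain ⟨⟨O₁, hO₁, hTO₁⟩, hcoord⟩ := hd.isOpen_target_and_continuousOn_coord r
  rw [← hT] at hTO₁ hcoord
  have hE₀ : Continuous fun y : Λ × H => E₀.starProjection y.2 := by fun_prop
  obtain ⟨O₂, hO₂, hA⟩ := exists_isOpen_inter_lt
    ⟨univ, isOpen_univ, (inter_univ (C ×ˢ (univ : Set H))).symm⟩ hE₀.norm.continuousOn ε
  set A := {y : Λ × H | y ∈ C ×ˢ (univ : Set H) ∧ ‖E₀.starProjection y.2‖ < ε} with hAd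
  have hAS : ∀ y ∈ A, (κ y).1 ∈ S := fun y hy =>
    ⟨hy.1.1, Submodule.starProjection_apply_mem _ _, hy.2⟩
  have hκc : ContinuousOn κ A := by
    have h1 : ContinuousOn (fun y : Λ × H => (y.1, E₀.starProjection y.2)) A :=
      (continuous_fst.prodMk hE₀).continuousOn
    exact h1.prodMk (continuousOn_snd.sub (hψ.continuousOn_reductionPoint.comp h1 hAS))
  obtain ⟨O₃, hO₃, hO₃eq⟩ := continuousOn_iff'.1 hκc O₁ hO₁
  have hmemT : ∀ y : Λ × H, (y.1 ∈ C ∧ y ∈ O₂ ∩ O₃) ↔ (y ∈ A ∧ κ y ∈ T) := by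
    intro y
    have h1 : y ∈ A ↔ y.1 ∈ C ∧ y ∈ O₂ := by
      have := Set.ext_iff.1 hA y
      simpa using this
    have h2 := Set.ext_iff.1 hO₃eq y
    simp only [mem_inter_iff, mem_preimage] at h2
    have h3 : y ∈ A → (κ y ∈ T ↔ κ y ∈ O₁) := fun hy => by
      rw [hTO₁]
      exact ⟨fun h => h.2, fun h => ⟨⟨hAS y hy, mem_univ _⟩, h⟩⟩
    rw [mem_inter_iff]
    tauto
  have hκmem : ∀ y ∈ A, (κ y).2 ∈ E₀ᗮ := by
    intro y hy
    have h1 : (κ y).2 = (y.2 - E₀.starProjection y.2) - ψ y.1 (E₀.starProjection y.2) := by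
      simp only [hκ, reductionPoint]; abel
    rw [h1]
    exact Submodule.sub_mem _ (Submodule.sub_starProjection_mem_orthogonal _)
      (hψ.mem _ hy.1.1 _ (hAS y hy).2)
  set Θ : Λ × H × H → Λ × H := fun q => (q.1, splittingMap Ep Em ψ φ ξ₁ ξ₂ q.1 q.2.1 q.2.2) with hΘ
  set D := C ×ˢ (subBall E₀ ε ×ˢ ballSum Ep Em r r) with hD
  have hDS : ∀ q ∈ D, (q.1, q.2.1) ∈ S := fun q hq => ⟨hq.1, hq.2.1⟩
  have hκΘ : ∀ q ∈ D, Θ q ∈ A ∧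
      κ (Θ q) = ((q.1, q.2.1), morseMap Ep Em φ ξ₁ ξ₂ (q.1, q.2.1) q.2.2) := by
    rintro ⟨lam, z, u⟩ ⟨hlam, hz, hu⟩
    have h1 := hd.morseMap_mem_orthogonal h hr (p := (lam, z)) ⟨hlam, hz⟩ hu
    have h2 : E₀.starProjection (splittingMap Ep Em ψ φ ξ₁ ξ₂ lam z u) = z := by
      rw [splittingMap, add_assoc]
      exact starProjection_add_left_of_isOrtho (Submodule.isOrtho_orthogonal_right E₀) hz.1
        (Submodule.add_mem _ (hψ.mem lam hlam z hz) h1)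
    refine ⟨⟨⟨hlam, mem_univ _⟩, ?_⟩, ?_⟩
    · simp only [hΘ, h2]
      exact hz.2
    · have h3 : splittingMap Ep Em ψ φ ξ₁ ξ₂ lam z u =
          reductionPoint ψ (lam, z) + morseMap Ep Em φ ξ₁ ξ₂ (lam, z) u := rfl
      simp only [hκ, hΘ, h2]
      rw [h3, add_sub_cancel_left]
  set N : (Λ × H) × H → H := fun q => posCoord Ep (centeredFunctional f ψ) φ q.1 q.2 +
    negCoord Ep Em (centeredFunctional f ψ) φ q.1 q.2 with hN
  set Ξ : Λ × H → Λ × H × H := fun y => (y.1, E₀.starProjection y.2, N (κ y)) with hΞ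
  have hright : ∀ y : Λ × H, y ∈ A → κ y ∈ T → Ξ y ∈ D ∧ Θ (Ξ y) = y := by
    intro y hy hyT
    obtain ⟨-, -, h3, h4⟩ := hd.coord_mem hyT
    have h5 := hd.morseMap_coord hr hyT
    refine ⟨⟨hy.1.1, (hAS y hy).2, _, h3, _, h4, hyT.1.2, hyT.2, rfl⟩, Prod.ext rfl ?_⟩
    rw [← h.eq_add_of_mem (hκmem y hy)] at h5
    have h6 : (Θ (Ξ y)).2 = reductionPoint ψ (y.1, E₀.starProjection y.2) + (κ y).2 := by
      rw [← h5]; rfl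
    rw [h6, hκ]
    simp
  have hcontΘ : ContinuousOn Θ D := by
    have h1 : ContinuousOn (fun q : Λ × H × H => (q.1, q.2.1)) D := by fun_prop
    have h2 : ContinuousOn (fun q : Λ × H × H => q.2.2) D := by fun_prop
    refine continuousOn_fst.prodMk (ContinuousOn.add ?_ ?_)
    · exact hψ.continuousOn_reductionPoint.comp h1 hDS
    · exact (hd.continuousOn_morseMap hr).comp (h1.prodMk h2) fun q hq => ⟨hDS q hq, hq.2.2⟩
  have hΘT : ∀ q ∈ D, Θ q ∈ A ∧ κ (Θ q) ∈ T := by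
    intro q hq
    obtain ⟨h1, h2⟩ := hκΘ q hq
    refine ⟨h1, ?_⟩
    obtain ⟨up, hup, um, hum, hupr, humr, hu⟩ := hq.2.2
    rw [h2, hu]
    exact hd.morseMap_mem_target hr (hDS q hq) hup hum hupr humr
  have hleft : ∀ q ∈ D, Ξ (Θ q) = q := by
    intro q hq
    obtain ⟨h1, h2⟩ := hκΘ q hq
    have h3 : E₀.starProjection (Θ q).2 = q.2.1 := congrArg (fun y => y.1.2) h2
    have h4 : N (κ (Θ q)) = q.2.2 := by
      rw [h2]
      obtain ⟨up, hup, um, hum, hupr, humr, hu⟩ := hq.2.2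
      obtain ⟨h5, h6⟩ := hd.coord_morseMap hr (hDS q hq) hup hum hupr humr
      simp only [hN, hu, h5, h6]
    simp only [hΞ, h3, h4]
    rfl
  have hbound : ∀ q ∈ D, ‖(Θ q).2‖ < R := by
    intro q hq
    have h1 := hψ.norm_add_lt hrR hεR hq.1 hq.2.1
    obtain ⟨up, hup, um, hum, hupr, humr, hu⟩ := hq.2.2
    have h2 := hd.norm_morseMap_lt hr (hDS q hq) hup hum hupr humr
    rw [← hu] at h2
    exact (norm_add_le _ _).trans_lt (by linarith)
  have hzeroD : ∀ lam ∈ C, (lam, (0 : H), (0 : H)) ∈ D := fun lam hlam =>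
    ⟨hlam, ⟨E₀.zero_mem, by simpa using hε⟩, 0, Ep.zero_mem, 0, Em.zero_mem, by simpa using hr0,
      by simpa using hr0, by simp⟩
  have hO : IsOpen (O₂ ∩ O₃) := hO₂.inter hO₃
  have hsub : C ×ˢ ({0} : Set H) ⊆ O₂ ∩ O₃ := by
    rintro ⟨lam, w⟩ ⟨hlam, rfl⟩
    have h1 : Θ (lam, 0, 0) = (lam, 0) := by
      have h2 := hd.morseMap_zero (hDS _ (hzeroD lam hlam))
      simp only at h2
      simp [hΘ, splittingMap, h2, hψ.map_zero lam hlam]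
    rw [← h1]
    exact ((hmemT _).2 (hΘT _ (hzeroD lam hlam))).2
  obtain ⟨W₀, W, -, hW, hCW₀, h0W, hWO⟩ := generalized_tube_lemma hC isCompact_singleton hO hsub
  refine ⟨O₂ ∩ O₃, W, hO, hW, h0W rfl, fun y hy => hWO ⟨hCW₀ hy.1, hy.2⟩,
    fun lam hlam w hw => ?_, ?_⟩
  · obtain ⟨h1, h2⟩ := (hmemT (lam, w)).1 ⟨hlam, hw⟩
    obtain ⟨h3, h4⟩ := hright _ h1 h2
    have h5 := hbound _ h3
    rwa [h4] at h5
  · refine exists_homeomorph_of_continuousOn (f := Θ) (g := Ξ) hcontΘ ?_ (fun q hq => ?_)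
      (fun y hy => ?_) hleft (fun y hy => ?_)
    · have h1 : ∀ y ∈ (C ×ˢ (univ : Set H)) ∩ (O₂ ∩ O₃), y ∈ A ∧ κ y ∈ T := fun y hy =>
        (hmemT y).1 ⟨hy.1.1, hy.2⟩
      refine continuousOn_fst.prodMk (hE₀.continuousOn.prodMk ?_)
      exact hcoord.comp (hκc.mono fun y hy => (h1 y hy).1) fun y hy => (h1 y hy).2
    · have h1 := (hmemT _).2 (hΘT q hq)
      exact ⟨⟨h1.1, mem_univ _⟩, h1.2⟩
    · obtain ⟨h1, h2⟩ := (hmemT y).1 ⟨hy.1.1, hy.2⟩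
      exact (hright y h1 h2).1
    · obtain ⟨h1, h2⟩ := (hmemT y).1 ⟨hy.1.1, hy.2⟩
      exact (hright y h1 h2).2

end Splitting

/-! ### Equivariance -/

section Equivariance

variable {H : Type*} [NormedAddCommGroup H] [InnerProductSpace ℝ H]

theorem IsOrthogonalSplitting.starProjection_neg_map {E₀ Ep Em : Submodule ℝ H}
    [E₀.HasOrthogonalProjection] [Ep.HasOrthogonalProjection] [Em.HasOrthogonalProjection]
    (h : IsOrthogonalSplitting E₀ Ep Em) {U : H ≃ₗᵢ[ℝ] H} (h0 : ∀ x ∈ E₀, U x ∈ E₀)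
    (hp : ∀ x ∈ Ep, U x ∈ Ep) (hm : ∀ x ∈ Em, U x ∈ Em) (x : H) :
    Em.starProjection (U x) = U (Em.starProjection x) := by
  conv_lhs => rw [← h.sum_eq x]
  rw [map_add, map_add, map_add, map_add,
    starProjection_eq_zero_of_isOrtho h.ortho_null_neg
      (h0 _ (Submodule.starProjection_apply_mem _ _)),
    starProjection_eq_zero_of_isOrtho h.ortho_pos_neg
      (hp _ (Submodule.starProjection_apply_mem _ _)),
    Submodule.starProjection_eq_self_iff.2 (hm _ (Submodule.starProjection_apply_mem _ _)),
    zero_add, zero_add]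

theorem IsOrthogonalSplitting.starProjection_pos_map {E₀ Ep Em : Submodule ℝ H}
    [E₀.HasOrthogonalProjection] [Ep.HasOrthogonalProjection] [Em.HasOrthogonalProjection]
    (h : IsOrthogonalSplitting E₀ Ep Em) {U : H ≃ₗᵢ[ℝ] H} (h0 : ∀ x ∈ E₀, U x ∈ E₀)
    (hp : ∀ x ∈ Ep, U x ∈ Ep) (hm : ∀ x ∈ Em, U x ∈ Em) (x : H) :
    Ep.starProjection (U x) = U (Ep.starProjection x) := by
  conv_lhs => rw [← h.sum_eq x]
  rw [map_add, map_add, map_add, map_add,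
    starProjection_eq_zero_of_isOrtho h.ortho_null_pos
      (h0 _ (Submodule.starProjection_apply_mem _ _)),
    starProjection_eq_zero_of_isOrtho h.ortho_pos_neg.symm
      (hm _ (Submodule.starProjection_apply_mem _ _)),
    Submodule.starProjection_eq_self_iff.2 (hp _ (Submodule.starProjection_apply_mem _ _)),
    zero_add, add_zero]

section Invariance

variable {A : H →L[ℝ] H} {U : H ≃ₗᵢ[ℝ] H}

theorem map_mem_nullSpace (hU : ∀ x, A (U x) = U (A x)) {x : H} (hx : x ∈ nullSpace A) :
    U x ∈ nullSpace A := by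
  have h1 : A x = 0 := hx
  have h2 : A (U x) = 0 := by rw [hU, h1, map_zero]
  exact h2

theorem map_mem_negSpace (hU : ∀ x, A (U x) = U (A x)) {x : H} (hx : x ∈ negSpace A) :
    U x ∈ negSpace A := by
  have h1 : negSpace A ≤ (negSpace A).comap (U.toLinearEquiv : H →ₗ[ℝ] H) := by
    refine iSup₂_le fun c hc w hw => ?_
    refine Submodule.mem_iSup_of_mem c (Submodule.mem_iSup_of_mem hc ?_)
    have h2 : A w = c • w := Module.End.mem_eigenspace_iff.1 hw
    refine Module.End.mem_eigenspace_iff.2 ?_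
    have h3 : A (U w) = c • U w := by rw [hU, h2, map_smul]
    exact h3
  exact h1 hx

theorem commute_symm (hU : ∀ x, A (U x) = U (A x)) (x : H) : A (U.symm x) = U.symm (A x) := by
  rw [U.eq_symm_apply, ← hU, U.apply_symm_apply]

theorem map_mem_orthogonal_of_symm {K : Submodule ℝ H} (hK : ∀ x ∈ K, U.symm x ∈ K) {x : H}
    (hx : x ∈ Kᗮ) : U x ∈ Kᗮ := by
  rw [Submodule.mem_orthogonal] at hx ⊢
  intro w hw
  rw [← hx _ (hK w hw), ← U.inner_map_map (U.symm w) x, U.apply_symm_apply]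

theorem map_mem_posSpace_of_commute (hU : ∀ x, A (U x) = U (A x)) {x : H} (hx : x ∈ posSpace A) :
    U x ∈ posSpace A := by
  refine map_mem_orthogonal_of_symm (fun w hw => ?_) hx
  obtain ⟨y, hy, z, hz, rfl⟩ := Submodule.mem_sup.1 hw
  rw [map_add]
  exact Submodule.add_mem_sup (map_mem_nullSpace (commute_symm hU) hy)
    (map_mem_negSpace (commute_symm hU) hz)

end Invariance

variable [CompleteSpace H]

/-- The gradient of an invariant function is equivariant. -/
theorem gradient_map_of_invariant {V : Set H} (hV : IsOpen V) {L : H → ℝ}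
    (hL : ContDiffOn ℝ 1 L V) {U : H ≃ₗᵢ[ℝ] H} (hU : ∀ x ∈ V, U x ∈ V ∧ L (U x) = L x) {x : H}
    (hx : x ∈ V) : gradient L (U x) = U (gradient L x) := by
  have h1 := (hasGradientAt_of_contDiffOn hV hL (hU x hx).1).hasFDerivAt
  have h2 := (hasGradientAt_of_contDiffOn hV hL hx).hasFDerivAt
  have h3 := h1.comp x (U : H ≃L[ℝ] H).hasFDerivAt
  have h4 : L ∘ (U : H ≃L[ℝ] H) =ᶠ[𝓝 x] L := by
    filter_upwards [hV.mem_nhds hx] with y hy using (hU y hy).2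
  have h5 := (h3.congr_of_eventuallyEq h4.symm).unique h2
  refine ext_inner_right ℝ fun w => ?_
  have h6 := congrArg (fun T : H →L[ℝ] ℝ => T (U.symm w)) h5
  simp only [ContinuousLinearMap.comp_apply, InnerProductSpace.toDual_apply_apply] at h6
  have h7 : (U : H ≃L[ℝ] H) (U.symm w) = w := U.apply_symm_apply w
  have h8 : ⟪gradient L (U x), w⟫ = ⟪gradient L x, U.symm w⟫ := by
    rw [← h6]
    exact congrArg _ h7.symm
  rw [h8, ← U.inner_map_map, U.apply_symm_apply]

/-- The Hessian at the origin of an invariant functional commutes with the isometry. -/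
theorem SplittingHypothesis.commute_of_invariant {V : Set H} {L : H → ℝ} {B P Q : H → H →L[ℝ] H}
    (hL : SplittingHypothesis ⊤ V L B P Q) {U : H ≃ₗᵢ[ℝ] H}
    (hU : ∀ x ∈ V, U x ∈ V ∧ L (U x) = L x) (x : H) : B 0 (U x) = U (B 0 x) := by
  have h1 := hL.gateaux 0 ⟨hL.zero_mem, trivial⟩ (U x)
  have h2 := hL.gateaux 0 ⟨hL.zero_mem, trivial⟩ x
  unfold HasLineDerivAt at h1 h2
  have h3 : HasDerivAt (fun t : ℝ => U (gradient L (0 + t • x))) (U (B 0 x)) 0 :=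
    (U : H ≃L[ℝ] H).hasFDerivAt.comp_hasDerivAt (0 : ℝ) h2
  have hc : Tendsto (fun t : ℝ => (0 : H) + t • x) (𝓝 0) (𝓝 0) := by
    have : Continuous fun t : ℝ => (0 : H) + t • x := by fun_prop
    simpa using this.tendsto 0
  have h4 : (fun t : ℝ => U (gradient L (0 + t • x))) =ᶠ[𝓝 0]
      fun t : ℝ => gradient L (0 + t • U x) := by
    filter_upwards [hc hL.mem_nhds] with t ht
    rw [← gradient_map_of_invariant hL.isOpen hL.contDiffOn hU ht]
    simp
  exact h1.unique (h3.congr_of_eventuallyEq h4.symm)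

omit [CompleteSpace H] in
/-- The reduction of an invariant saddle family is equivariant, by uniqueness. -/
theorem IsReduction.map_eq {Λ : Type*} [TopologicalSpace Λ] {C : Set Λ} {E₀ Ep Em : Submodule ℝ H}
    [E₀.HasOrthogonalProjection] [Ep.HasOrthogonalProjection] [Em.HasOrthogonalProjection]
    {F : Λ → H → H} {R r ε : ℝ} {ψ : Λ → H → H} (hψ : IsReduction C E₀ Ep Em F R r ε ψ)
    (h : IsOrthogonalSplitting E₀ Ep Em) (hR : 0 < R) (hrR : r ≤ R / 8) (hεR : ε ≤ R / 8)
    {U : H ≃ₗᵢ[ℝ] H} (h0 : ∀ x ∈ E₀, U x ∈ E₀)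
    (hp : ∀ x ∈ Ep, U x ∈ Ep) (hm : ∀ x ∈ Em, U x ∈ Em) {lam : Λ} (hlam : lam ∈ C)
    (hF : ∀ x, ‖x‖ < R → F lam (U x) = U (F lam x)) {z : H} (hz : z ∈ subBall E₀ ε) :
    ψ lam (U z) = U (ψ lam z) := by
  have h1 := hψ.mem lam hlam z hz
  have h2 : U (ψ lam z) ∈ E₀ᗮ := by
    rw [h.eq_add_of_mem h1, map_add]
    exact Submodule.add_mem _ (h.pos_mem (hp _ (Submodule.starProjection_apply_mem _ _)))
      (h.neg_mem (hm _ (Submodule.starProjection_apply_mem _ _)))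
  refine (hψ.unique lam hlam (U z) ⟨h0 z hz.1, by rw [U.norm_map]; exact hz.2⟩ _ h2 ?_ ?_).symm
  · rw [U.norm_map]
    exact (hψ.norm_lt lam hlam z hz).le.trans (by linarith)
  · rw [← map_add, hF _ ((hψ.norm_add_lt hrR hεR hlam hz).trans (by linarith))]
    have h3 := hψ.eqn lam hlam z hz
    rw [h.signProj_eq_zero_iff] at h3 ⊢
    rw [h.starProjection_pos_map h0 hp hm, h.starProjection_neg_map h0 hp hm, h3.1, h3.2]
    exact ⟨_root_.map_zero U, _root_.map_zero U⟩

end Equivariance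

/-! ### Values and equivariance of the splitting map -/

section SplittingMap

variable {H : Type*} [NormedAddCommGroup H] [InnerProductSpace ℝ H] [CompleteSpace H]
  {Λ : Type*} [TopologicalSpace Λ] {C : Set Λ} {E₀ Ep Em : Submodule ℝ H}
  [E₀.HasOrthogonalProjection] [Ep.HasOrthogonalProjection] [Em.HasOrthogonalProjection]
  {f : Λ → H → ℝ} {F : Λ → H → H} {R R₁ a M r ε : ℝ} {ψ : Λ → H → H} {φ : (Λ × H) × H → H}
  {ξ₁ : Λ × H → H → H} {ξ₂ : (Λ × H) × H → H → H}

omit [E₀.HasOrthogonalProjection] in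
theorem IsMorseData.apply_splittingMap
    (hd : IsMorseData (C ×ˢ subBall E₀ ε) Ep Em (centeredFunctional f ψ) (centeredGradient F ψ)
      (3 * R / 4) R₁ a M φ ξ₁ ξ₂) (hr : r ≤ √(a / 2) * R₁) {lam : Λ} (hlam : lam ∈ C) {z : H}
    (hz : z ∈ subBall E₀ ε) {up um : H} (hup : up ∈ Ep) (hum : um ∈ Em) (hupr : ‖up‖ < r)
    (humr : ‖um‖ < r) :
    f lam (splittingMap Ep Em ψ φ ξ₁ ξ₂ lam z (up + um)) =
      ‖up‖ ^ 2 - ‖um‖ ^ 2 + f lam (z + ψ lam z) := by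
  have h1 := hd.apply_morseMap hr (p := (lam, z)) ⟨hlam, hz⟩ hup hum hupr humr
  rw [centeredFunctional, sub_eq_iff_eq_add] at h1
  exact h1

theorem IsMorseData.splittingMap_map
    (hd : IsMorseData (C ×ˢ subBall E₀ ε) Ep Em (centeredFunctional f ψ) (centeredGradient F ψ)
      (3 * R / 4) R₁ a M φ ξ₁ ξ₂) (h : IsOrthogonalSplitting E₀ Ep Em)
    (hψ : IsReduction C E₀ Ep Em F R r ε ψ) (hR : 0 < R) (hr : r ≤ √(a / 2) * R₁)
    (hrR : r ≤ R / 8) (hεR : ε ≤ R / 8) {U : H ≃ₗᵢ[ℝ] H} (h0 : ∀ x ∈ E₀, U x ∈ E₀)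
    (hp : ∀ x ∈ Ep, U x ∈ Ep) (hm : ∀ x ∈ Em, U x ∈ Em) {lam : Λ} (hlam : lam ∈ C)
    (hf : ∀ x, ‖x‖ < R → f lam (U x) = f lam x)
    (hF : ∀ x, ‖x‖ < R → F lam (U x) = U (F lam x)) {z : H} (hz : z ∈ subBall E₀ ε) {u : H}
    (hu : u ∈ ballSum Ep Em r r) :
    splittingMap Ep Em ψ φ ξ₁ ξ₂ lam (U z) (U u) = U (splittingMap Ep Em ψ φ ξ₁ ξ₂ lam z u) := by
  obtain ⟨up, hup, um, hum, hupr, humr, rfl⟩ := hu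
  have h1 := hψ.map_eq h hR hrR hεR h0 hp hm hlam hF hz
  have h2 : reductionPoint ψ (lam, U z) = U (reductionPoint ψ (lam, z)) := by
    simp only [reductionPoint, h1, map_add]
  have h3 : ‖reductionPoint ψ (lam, z)‖ < R / 4 := hψ.norm_add_lt hrR hεR hlam hz
  have h4 : ∀ x : H, ‖x‖ < 3 * R / 4 → ‖reductionPoint ψ (lam, z) + x‖ < R := fun x hx =>
    (norm_add_le _ _).trans_lt (by linarith)
  have h5 := hd.morseMap_map hr (p := (lam, z)) (p' := (lam, U z)) ⟨hlam, hz⟩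
    ⟨hlam, IsMorseData.map_mem_subBall h0 hz⟩ hp hm (h.starProjection_neg_map h0 hp hm)
    (fun x hx => by
      simp only [centeredFunctional, h2, ← map_add]
      rw [hf _ (h4 x hx), hf _ (h3.trans (by linarith))])
    (fun x hx => by
      simp only [centeredGradient, h2, ← map_add]
      exact hF _ (h4 x hx)) hup hum hupr humr
  rw [splittingMap, splittingMap, h5, h1, map_add, map_add]

end SplittingMap

/-! ### Regularity of the reduced functional -/

section Regularity

theorem LocallyLipschitzOn.comp_lipschitzOnWith {X Y Z : Type*} [PseudoEMetricSpace X]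
    [PseudoEMetricSpace Y] [PseudoEMetricSpace Z] {N : Y → Z} {g : X → Y} {s : Set X} {t : Set Y}
    {K : NNReal} (hN : LocallyLipschitzOn t N) (hg : LipschitzOnWith K g s) (hst : MapsTo g s t) :
    LocallyLipschitzOn s (N ∘ g) := by
  intro x hx
  obtain ⟨K', t', ht', h⟩ := hN (hst hx)
  refine ⟨K' * K, g ⁻¹' t' ∩ s, inter_mem ?_ self_mem_nhdsWithin, ?_⟩
  · exact (hg.continuousOn x hx).tendsto_nhdsWithin hst ht'
  · exact h.comp (hg.mono inter_subset_right) fun y hy => hy.1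

theorem LipschitzWith.comp_locallyLipschitzOn {X Y Z : Type*} [PseudoEMetricSpace X]
    [PseudoEMetricSpace Y] [PseudoEMetricSpace Z] {N : Y → Z} {g : X → Y} {s : Set X}
    {K : NNReal} (hN : LipschitzWith K N) (hg : LocallyLipschitzOn s g) :
    LocallyLipschitzOn s (N ∘ g) := by
  intro x hx
  obtain ⟨K', t', ht', h⟩ := hg hx
  exact ⟨K * K', t', ht', hN.comp_lipschitzOnWith h⟩

theorem LocallyLipschitzOn.finsetSum {X E ι : Type*} [PseudoEMetricSpace X]
    [SeminormedAddCommGroup E] {s : Set X} {g : ι → X → E} (t : Finset ι)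
    (hg : ∀ i ∈ t, LocallyLipschitzOn s (g i)) :
    LocallyLipschitzOn s fun x => ∑ i ∈ t, g i x := by
  classical
  induction t using Finset.induction_on with
  | empty => simpa using (LipschitzWith.const (0 : E)).locallyLipschitz.locallyLipschitzOn
  | insert i t hi ih =>
    simp only [Finset.sum_insert hi]
    exact (hg i (Finset.mem_insert_self _ _)).add
      (ih fun j hj => hg j (Finset.mem_insert_of_mem hj))

theorem contDiffOn_one_of_hasFDerivAt {E F : Type*} [NormedAddCommGroup E] [NormedSpace ℝ E]
    [NormedAddCommGroup F] [NormedSpace ℝ F] {f : E → F} {f' : E → E →L[ℝ] F} {U : Set E}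
    (hU : IsOpen U) (hf : ∀ z ∈ U, HasFDerivAt f (f' z) z) (hf' : ContinuousOn f' U) :
    ContDiffOn ℝ 1 f U := by
  have h := contDiffOn_succ_iff_fderiv_of_isOpen (𝕜 := ℝ) (n := 0) (f := f) hU
  rw [zero_add] at h
  refine h.2 ⟨fun z hz => (hf z hz).differentiableAt.differentiableWithinAt, by simp, ?_⟩
  exact contDiffOn_zero.2 (hf'.congr fun z hz => (hf z hz).fderiv)

variable {H : Type*} [NormedAddCommGroup H] [InnerProductSpace ℝ H] [CompleteSpace H]

theorem toDual_perturbedGradient {n : ℕ} (L : H → ℝ) (G : Fin n → H → ℝ) (lam : Fin n → ℝ) (x : H) :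
    InnerProductSpace.toDual ℝ H (perturbedGradient L G lam x) =
      fderiv ℝ L x + ∑ j, lam j • fderiv ℝ (G j) x := by
  simp [perturbedGradient, gradient]

omit [CompleteSpace H] in
/-- A functional on a subspace `E` whose derivative at `z` is that of a `C¹` functional at
`z + σ z`, with `σ` Lipschitz, is of class `C¹`, and of class `C^{2-0}` if the latter functional
is. -/
theorem regularity_of_hasFDerivAt {V : Set H} {n : ℕ} {L : H → ℝ} {G : Fin n → H → ℝ}
    {lam : Fin n → ℝ} {E : Submodule ℝ H} {q : E → ℝ} {σ : E → H} {U : Set E}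
    (hV : IsOpen V) (hL : ContDiffOn ℝ 1 L V) (hG : ∀ j, ContDiffOn ℝ 1 (G j) V) (hU : IsOpen U)
    {K : NNReal} (hσ : LipschitzOnWith K (fun z : E => (z : H) + σ z) U)
    (hσV : MapsTo (fun z : E => (z : H) + σ z) U V)
    (hq : ∀ z ∈ U, HasFDerivAt q ((fderiv ℝ L ((z : H) + σ z) +
      ∑ j, lam j • fderiv ℝ (G j) ((z : H) + σ z)).comp E.subtypeL) z) :
    ContDiffOn ℝ 1 q U ∧
      (IsC2Minus L V → (∀ j, IsC2Minus (G j) V) → IsC2Minus q U) := by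
  set N : H → H →L[ℝ] ℝ := fun x => fderiv ℝ L x + ∑ j, lam j • fderiv ℝ (G j) x with hN
  have hNc : ContinuousOn N V :=
    (hL.continuousOn_fderiv_of_isOpen hV le_rfl).add (continuousOn_finsetSum _ fun j _ =>
      ((hG j).continuousOn_fderiv_of_isOpen hV le_rfl).const_smul (lam j))
  have hC1 : ContDiffOn ℝ 1 q U := contDiffOn_one_of_hasFDerivAt hU hq
    ((hNc.comp hσ.continuousOn hσV).clm_comp continuousOn_const)
  refine ⟨hC1, fun hL2 hG2 => ⟨hC1, ?_⟩⟩
  have hNl : LocallyLipschitzOn V N := hL2.2.add (LocallyLipschitzOn.finsetSum _ fun j _ =>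
    (lipschitzWith_smul (lam j)).comp_locallyLipschitzOn (hG2 j).2)
  have hιl : LipschitzWith ‖E.subtypeL‖₊ fun T : H →L[ℝ] ℝ => T.comp E.subtypeL :=
    LipschitzWith.of_dist_le_mul fun T S => by
      rw [dist_eq_norm, dist_eq_norm, ← ContinuousLinearMap.sub_comp, mul_comm]
      exact ContinuousLinearMap.opNorm_comp_le _ _
  have h1 := hιl.comp_locallyLipschitzOn (hNl.comp_lipschitzOnWith hσ hσV)
  intro z hz
  obtain ⟨K', t, ht, hKt⟩ := h1 hz
  refine ⟨K', t ∩ U, inter_mem ht self_mem_nhdsWithin, fun x hx y hy => ?_⟩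
  rw [(hq x hx.2).fderiv, (hq y hy.2).fderiv]
  exact hKt hx.1 hy.1

end Regularity

/-! ### The splitting theorem -/

theorem mainTheorem1 {H : Type*} [NormedAddCommGroup H] [InnerProductSpace ℝ H] [CompleteSpace H]
    (V : Set H) (L : H → ℝ) (B P Q : H → H →L[ℝ] H)
    (hL : SplittingHypothesis (⊤ : Submodule ℝ H) V L B P Q)
    (hnull : nullSpace (B 0) ≠ ⊥)
    (n : ℕ) (G : Fin n → H → ℝ) (G₂ : Fin n → H → H →L[ℝ] H)
    (hG : ∀ j, PerturbationHypothesis V (G j) (G₂ j)) :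
    -- the decomposition of `H`: `H⁰`, `H⁻` are finite-dimensional, `B 0` is definite on `H⁺`, `H⁻`
    (FiniteDimensional ℝ (nullSpace (B 0)) ∧ FiniteDimensional ℝ (negSpace (B 0)) ∧
      ∃ a > (0 : ℝ), (∀ u ∈ posSpace (B 0), a * ‖u‖ ^ 2 ≤ ⟪B 0 u, u⟫) ∧
        (∀ u ∈ negSpace (B 0), ⟪B 0 u, u⟫ ≤ -a * ‖u‖ ^ 2)) ∧
    ∀ ρ > (0 : ℝ), ∃ δ ∈ Ioo 0 ρ, ∃ ε ∈ Ioo 0 ρ, ∃ r ∈ Ioo 0 ρ, ∃ s ∈ Ioo 0 ρ,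
    ∃ (ψ : (Fin n → ℝ) → H → H) (Φ : (Fin n → ℝ) → H → H → H) (O : Set ((Fin n → ℝ) × H))
      (W : Set H),
      -- `ψ` is continuous, and is the unique solution of the reduction equation
      ContinuousOn (fun p : (Fin n → ℝ) × H => ψ p.1 p.2)
        (paramCube n δ ×ˢ nullBall (B 0) ε) ∧
      (∀ lam ∈ paramCube n δ, ψ lam 0 = 0) ∧
      (∀ lam ∈ paramCube n δ, ∀ z ∈ nullBall (B 0) ε, ∀ u ∈ saddleBox (B 0) r s,
        z + u ∈ V ∧
        ((nullSpace (B 0))ᗮ.starProjection (gradient L (z + u)) +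
            ∑ j, lam j • (nullSpace (B 0))ᗮ.starProjection (gradient (G j) (z + u)) = 0 ↔
          u = ψ lam z)) ∧
      (∀ lam ∈ paramCube n δ, ∀ z ∈ nullBall (B 0) ε, ψ lam z ∈ saddleBox (B 0) r s) ∧
      (∀ lam ∈ paramCube n δ, ∀ z₁ ∈ nullBall (B 0) ε, ∀ z₂ ∈ nullBall (B 0) ε,
        ‖ψ lam z₁ - ψ lam z₂‖ ≤ 3 * ‖z₁ - z₂‖) ∧
      -- the splitting homeomorphism
      IsOpen O ∧ IsOpen W ∧ (0 : H) ∈ W ∧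
      paramCube n δ ×ˢ W ⊆ O ∧
      (∀ lam ∈ paramCube n δ, ∀ w : H, (lam, w) ∈ O → w ∈ V) ∧
      (∃ e : ↥(paramCube n δ ×ˢ (nullBall (B 0) ε ×ˢ saddleBox (B 0) r s)) ≃ₜ
          ↥((paramCube n δ ×ˢ (univ : Set H)) ∩ O),
        ∀ p, (e p : (Fin n → ℝ) × H) = (p.1.1, Φ p.1.1 p.1.2.1 p.1.2.2)) ∧
      (∀ lam ∈ paramCube n δ, Φ lam 0 0 = 0) ∧
      (∀ lam ∈ paramCube n δ, ∀ z ∈ nullBall (B 0) ε,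
        ∀ up ∈ posSpace (B 0), ∀ um ∈ negSpace (B 0), ‖up‖ < r → ‖um‖ < s →
          perturbed L G lam (Φ lam z (up + um)) =
            ‖up‖ ^ 2 - ‖um‖ ^ 2 + perturbed L G lam (z + ψ lam z)) ∧
      -- `Φ_λ(z, u) = z + ψ(λ, z) + φ_{λ,z}(u)` with `φ_{λ,z}(u)` orthogonal to `H⁰`
      (∀ lam ∈ paramCube n δ, ∀ z ∈ nullBall (B 0) ε, Φ lam z 0 = z + ψ lam z) ∧
      (∀ lam ∈ paramCube n δ, ∀ z ∈ nullBall (B 0) ε, ∀ u ∈ saddleBox (B 0) r s,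
        Φ lam z u - (z + ψ lam z) ∈ (nullSpace (B 0))ᗮ ∧
        (Φ lam z u - (z + ψ lam z) ∈ negSpace (B 0) ↔ u ∈ negSpace (B 0))) ∧
      -- the reduced functional
      (∀ lam ∈ paramCube n δ,
        ContDiffOn ℝ 1 (reduced (B 0) L G ψ lam) (Metric.ball 0 ε) ∧
        (∀ z ∈ Metric.ball (0 : nullSpace (B 0)) ε,
          HasFDerivAt (reduced (B 0) L G ψ lam)
            ((fderiv ℝ L ((z : H) + ψ lam z) +
              ∑ j, lam j • fderiv ℝ (G j) ((z : H) + ψ lam z)).comp (nullSpace (B 0)).subtypeL) z) ∧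
        (IsC2Minus L V → (∀ j, IsC2Minus (G j) V) →
          IsC2Minus (reduced (B 0) L G ψ lam) (Metric.ball 0 ε))) ∧
      -- equivariance of `ψ` and `Φ`, invariance of the reduced functional
      (∀ (K : Type*) [Group K] (a : K →* (H ≃ₗᵢ[ℝ] H)),
        (∀ g : K, ∀ x ∈ V, a g x ∈ V ∧ L (a g x) = L x ∧ ∀ j, G j (a g x) = G j x) →
        ∀ g : K,
          (∀ z ∈ nullSpace (B 0), a g z ∈ nullSpace (B 0)) ∧
          (∀ u ∈ (nullSpace (B 0))ᗮ, a g u ∈ (nullSpace (B 0))ᗮ) ∧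
          ∀ lam ∈ paramCube n δ, ∀ z ∈ nullBall (B 0) ε,
            ψ lam (a g z) = a g (ψ lam z) ∧
            perturbed L G lam (a g z + ψ lam (a g z)) = perturbed L G lam (z + ψ lam z) ∧
            ∀ u ∈ saddleBox (B 0) r s, Φ lam (a g z) (a g u) = a g (Φ lam z u)) := by
  have hfin₀ := hL.finiteDimensional_nullSpace
  have hfin₁ := hL.finiteDimensional_negSpace
  have hproj : (posSpace (B 0)).HasOrthogonalProjection :=
    inferInstanceAs (nullSpace (B 0) ⊔ negSpace (B 0))ᗮ.HasOrthogonalProjection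
  refine ⟨⟨hfin₀, hfin₁, ?_⟩, fun ρ hρ => ?_⟩
  · obtain ⟨a₁, ha₁, h₁⟩ := hL.exists_form_B_zero_bound
    obtain ⟨a₂, ha₂, h₂⟩ := exists_form_le_of_mem_negSpace hL.isSelfAdjoint_B_zero.isSymmetric
    refine ⟨min a₁ a₂, lt_min ha₁ ha₂, fun u hu => ?_, fun u hu => ?_⟩
    · exact (mul_le_mul_of_nonneg_right (min_le_left a₁ a₂) (sq_nonneg _)).trans (h₁ u hu)
    · refine (h₂ u hu).trans ?_
      rw [neg_mul, neg_mul, neg_le_neg_iff]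
      exact mul_le_mul_of_nonneg_right (min_le_right a₁ a₂) (sq_nonneg _)
  obtain ⟨δ, hδ, R, a, M, h, hRV⟩ := hL.exists_isSaddleFamily hG hρ
  have hR := h.radius_pos
  have ha := h.const_pos
  have hM := h.bound_pos
  -- the chart exists on balls of radius `R₁`, the box has radius `r`, and `ε` makes `‖ψ‖ < r`
  set R₁ := a * R / (16 * M) with hR₁
  have hR₁0 : 0 < R₁ := by positivity
  have hR₁M : M * R₁ = a * R / 16 := by rw [hR₁]; field_simp
  have hR₁R : R₁ ≤ R / 16 := by
    refine le_of_mul_le_mul_left ?_ hM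
    rw [hR₁M]
    nlinarith [h.const_le]
  set r := min (ρ / 2) (min (R / 8) (√(a / 2) * R₁)) with hr
  have hr0 : 0 < r := by positivity
  have hrρ : r < ρ := (min_le_left _ _).trans_lt (by linarith)
  have hrR : r ≤ R / 8 := (min_le_right _ _).trans (min_le_left _ _)
  have hrR₁ : r ≤ √(a / 2) * R₁ := (min_le_right _ _).trans (min_le_right _ _)
  set ε := min (ρ / 2) (min (R / 8) (a * r / M)) with hε
  have hε0 : 0 < ε := by positivity
  have hερ : ε < ρ := (min_le_left _ _).trans_lt (by linarith)
  have hεR : ε ≤ R / 8 := (min_le_right _ _).trans (min_le_left _ _)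
  have hεr : M * ε ≤ a * r := by
    rw [mul_comm, ← le_div_iff₀ hM]
    exact (min_le_right _ _).trans (min_le_right _ _)
  obtain ⟨ψ, hψ⟩ := h.exists_isReduction hrR hε0 hεR hεr
  obtain ⟨φ, ξ₁, ξ₂, hd⟩ := (hψ.isCenteredSaddle h hrR hεR).exists_isMorseData hR₁0
    (by linarith) (by rw [hR₁M]; nlinarith [mul_pos ha hR])
  obtain ⟨O, W, hO, hW, h0W, hWO, hOR, e, he⟩ := hd.exists_homeomorph h.toIsOrthogonalSplitting hψ
    isCompact_Icc hε0 hr0 hrR₁ hrR hεR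
  have hmemV : ∀ {x : H}, ‖x‖ < R → x ∈ V := fun hx => hRV (by simpa using hx)
  have hbox : ∀ {u : H}, u ∈ saddleBox (B 0) r r → u ∈ (nullSpace (B 0))ᗮ ∧ ‖u‖ ≤ R / 4 := by
    rintro u ⟨up, hup, um, hum, hupr, humr, rfl⟩
    exact ⟨Submodule.add_mem _ (h.pos_mem hup) (h.neg_mem hum),
      (norm_add_le _ _).trans (by linarith)⟩
  have heqn : ∀ (lam : Fin n → ℝ) (x : H), (nullSpace (B 0))ᗮ.starProjection (gradient L x) +
      ∑ j, lam j • (nullSpace (B 0))ᗮ.starProjection (gradient (G j) x) = 0 ↔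
        signProj (posSpace (B 0)) (negSpace (B 0)) (perturbedGradient L G lam x) = 0 := by
    intro lam x
    rw [← h.orthogonal_starProjection_eq_zero_iff, perturbedGradient, map_add, map_sum]
    simp only [map_smul]
  refine ⟨δ, hδ, ε, ⟨hε0, hερ⟩, r, ⟨hr0, hrρ⟩, r, ⟨hr0, hrρ⟩, ψ,
    splittingMap (posSpace (B 0)) (negSpace (B 0)) ψ φ ξ₁ ξ₂, O, W, hψ.cont, hψ.map_zero,
    fun lam hlam z hz u hu => ⟨hmemV ?_, ?_⟩, fun lam hlam z hz => ?_,
    fun lam hlam z₁ hz₁ z₂ hz₂ => ?_, hO, hW, h0W, hWO,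
    fun lam hlam w hw => hmemV (hOR lam hlam w hw), ⟨e, he⟩, fun lam hlam => ?_,
    fun lam hlam z hz up hup um hum hupr humr =>
      hd.apply_splittingMap hrR₁ hlam hz hup hum hupr humr,
    fun lam hlam z hz => ?_, fun lam hlam z hz u hu => ?_, fun lam hlam => ?_, ?_⟩
  · exact (norm_add_le _ _).trans_lt (by linarith [hz.2, (hbox hu).2])
  · rw [heqn]
    refine ⟨hψ.unique lam hlam z hz u (hbox hu).1 (hbox hu).2, ?_⟩
    rintro rfl
    exact hψ.eqn lam hlam z hz
  · have h1 := hψ.norm_lt lam hlam z hz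
    exact ⟨_, Submodule.starProjection_apply_mem _ _, _, Submodule.starProjection_apply_mem _ _,
      (Submodule.norm_starProjection_apply_le _ _).trans_lt h1,
      (Submodule.norm_starProjection_apply_le _ _).trans_lt h1,
      h.eq_add_of_mem (hψ.mem lam hlam z hz)⟩
  · have h1 := hψ.lipschitz lam hlam z₁ hz₁ z₂ hz₂
    linarith [norm_nonneg (z₁ - z₂)]
  · have h1 : (0 : H) ∈ subBall (nullSpace (B 0)) ε := ⟨Submodule.zero_mem _, by simpa using hε0⟩
    have h2 := hd.morseMap_zero (p := (lam, 0)) ⟨hlam, h1⟩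
    rw [splittingMap, h2, hψ.map_zero lam hlam, add_zero, add_zero]
  · rw [splittingMap, hd.morseMap_zero (p := (lam, z)) ⟨hlam, hz⟩, add_zero]
  · rw [splittingMap, add_sub_cancel_left]
    refine ⟨hd.morseMap_mem_orthogonal h.toIsOrthogonalSplitting hrR₁ (p := (lam, z)) ⟨hlam, hz⟩ hu,
      ?_⟩
    obtain ⟨up, hup, um, hum, hupr, humr, rfl⟩ := hu
    exact hd.morseMap_mem_neg_iff hrR₁ (p := (lam, z)) ⟨hlam, hz⟩ hup hum hupr humr
  · have hmem : ∀ w ∈ Metric.ball (0 : nullSpace (B 0)) ε, (w : H) ∈ subBall (nullSpace (B 0)) ε :=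
      fun w hw => ⟨w.2, by simpa using hw⟩
    have hder : ∀ z ∈ Metric.ball (0 : nullSpace (B 0)) ε,
        HasFDerivAt (reduced (B 0) L G ψ lam)
          ((fderiv ℝ L ((z : H) + ψ lam z) +
            ∑ j, lam j • fderiv ℝ (G j) ((z : H) + ψ lam z)).comp
              (nullSpace (B 0)).subtypeL) z := fun z hz => by
      rw [← toDual_perturbedGradient]
      exact hψ.hasFDerivAt h hrR hεR hlam hz
    have hlip : LipschitzOnWith 2 (fun z : nullSpace (B 0) => (z : H) + ψ lam z)
        (Metric.ball 0 ε) := by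
      refine LipschitzOnWith.of_dist_le_mul fun z hz w hw => ?_
      have h1 := hψ.lipschitz lam hlam z (hmem z hz) w (hmem w hw)
      have h2 := dist_add_add_le (z : H) (ψ lam z) w (ψ lam w)
      have h3 : dist (z : H) w = dist z w := rfl
      rw [← dist_eq_norm, ← dist_eq_norm] at h1
      rw [h3] at h1 h2
      push_cast
      linarith
    have h1 := regularity_of_hasFDerivAt hL.isOpen hL.contDiffOn (fun j => (hG j).contDiffOn)
      Metric.isOpen_ball hlip
      (fun z hz => hmemV ((hψ.norm_add_lt hrR hεR hlam (hmem z hz)).trans (by linarith))) hder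
    exact ⟨h1.1, hder, h1.2⟩
  · intro K _ act hact g
    have hcomm := hL.commute_of_invariant (U := act g) fun x hx =>
      ⟨(hact g x hx).1, (hact g x hx).2.1⟩
    have h0 : ∀ x ∈ nullSpace (B 0), act g x ∈ nullSpace (B 0) := fun x hx =>
      map_mem_nullSpace hcomm hx
    have hp : ∀ x ∈ posSpace (B 0), act g x ∈ posSpace (B 0) := fun x hx =>
      map_mem_posSpace_of_commute hcomm hx
    have hm : ∀ x ∈ negSpace (B 0), act g x ∈ negSpace (B 0) := fun x hx =>
      map_mem_negSpace hcomm hx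
    have hf : ∀ lam : Fin n → ℝ, ∀ x, ‖x‖ < R →
        perturbed L G lam (act g x) = perturbed L G lam x := by
      intro lam x hx
      obtain ⟨-, h1, h2⟩ := hact g x (hmemV hx)
      simp only [perturbed, h1, h2]
    have hF : ∀ lam : Fin n → ℝ, ∀ x, ‖x‖ < R →
        perturbedGradient L G lam (act g x) = act g (perturbedGradient L G lam x) := by
      intro lam x hx
      have h1 := gradient_map_of_invariant hL.isOpen hL.contDiffOn (U := act g)
        (fun x hx => ⟨(hact g x hx).1, (hact g x hx).2.1⟩) (hmemV hx)
      have h2 := fun j => gradient_map_of_invariant hL.isOpen (hG j).contDiffOn (U := act g)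
        (fun x hx => ⟨(hact g x hx).1, (hact g x hx).2.2 j⟩) (hmemV hx)
      simp only [perturbedGradient, h1, h2, map_add, map_sum, map_smul]
    refine ⟨h0, fun u hu => map_mem_orthogonal_of_symm (fun w hw =>
      map_mem_nullSpace (commute_symm hcomm) hw) hu, fun lam hlam z hz => ?_⟩
    have hψg := hψ.map_eq h.toIsOrthogonalSplitting hR hrR hεR h0 hp hm hlam (hF lam) hz
    refine ⟨hψg, ?_, fun u hu => hd.splittingMap_map h.toIsOrthogonalSplitting hψ hR hrR₁ hrR hεR
      h0 hp hm hlam (hf lam) (hF lam) hz hu⟩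
    rw [hψg, ← map_add]
    exact hf lam _ ((hψ.norm_add_lt hrR hεR hlam hz).trans (by linarith))
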